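/- Let $\mathbb F$ be $\mathbb R$ or $\mathbb C$. A (unital) $\mathrm C^*$-category over $\mathbb F$ is a category $A$ whose Hom sets $A(x,y)$ are Banach spaces over $\mathbb F$, with bilinear composition satisfying $\|ba\|\le\|b\|\,\|a\|$, and with conjugate-linear maps $*:A(x,y)\to A(y,x)$ satisfying $(ba)^*=a^*b^*$, $a^{**}=a$, $\|a^*a\|=\|a\|^2$, and such that for every $a\in A(x,y)$ the spectrum $\{z\in\mathbb F : a^*a-z1_x \text{ is not invertible in } A(x,x)\}$ lies in $[0,\infty)$. A $*$-functor is an $\mathbb F$-linear (identity-preserving) functor commuting with $*$. Let $\mathsf C^*_1\mathsf{cat}$ be the category of small $\mathrm C^*$-categories and $*$-functors. An arrow $a\in A(x,y)$ is unitary if $a^*a=1_x$ and $aa^*=1_y$. A $*$-functor $F:A\to B$ is called a unitary equivalence if there are a $*$-functor $G:B\to A$ and natural isomorphisms $GF\simeq \mathrm{id}_A$, $FG\simeq\mathrm{id}_B$ with unitary components; a cofibration if it is injective on objects; a fibration if for every object $x$ of $A$ and every unitary $v:Fx\to y$ in $B$ there is a unitary $u:x\to x'$ in $A$ with $Fu=v$.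 Let $\emptyset$ be the empty $\mathrm C^*$-category, and regard $\mathbb F$ as a $\mathrm C^*$-category with one object, so that $*$-functors $\mathbb F\to A$ correspond to objects of $A$. Let $\mathbf 1$ be the universal $\mathrm C^*$-category generated by one arrow $a:0\to1$ with $\|a\|\le1$: $*$-functors $\mathbf 1\to A$ correspond bijectively (by the image of $a$) to arrows of $A$ of norm at most $1$. Let $\mathbf I$ be the universal $\mathrm C^*$-category generated by one unitary $u:0\to1$: $*$-functors $\mathbf I\to A$ correspond bijectively to unitary arrows of $A$. Let $U:\emptyset\to\mathbb F$ be the unique $*$-functor, let $V:\mathbb F\sqcup\mathbb F\to\mathbf 1$ send the two copies of $\mathbb F$ to the objects $0$ and $1$ respectively, let $P$ be the pushout of $V$ along itself, and let $W:P\to\mathbf 1$ be the $*$-functor whose two components are $\mathrm{id}_{\mathbf 1}$. Let $0:\mathbb F\to\mathbf I$ be the $*$-functor picking out the object $0$. **Proposition.** The unitary equivalences, cofibrations and fibrations are the weak equivalences, cofibrations and fibrations of a model structure on $\mathsf C^*_1\mathsf{cat}$ (which has all small limits and colimits), with functorial factorizations: the unitary model structure. The universal objects $\mathbf 1$, $\mathbf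 I$ and $P$ exist, and the unitary model structure is cofibrantly generated by the finite sets of generating cofibrations and generating trivial cofibrations $$I=\{U:\emptyset\to\mathbb F,\; V:\mathbb F\sqcup\mathbb F\to\mathbf 1,\; W:P\to\mathbf 1\},\qquad J=\{0:\mathbb F\to\mathbf I\}.$$ That is: the maps in $I$ are cofibrations and the map in $J$ is a trivial cofibration; the fibrations are exactly the maps with the right lifting property with respect to $J$; the trivial fibrations are exactly the maps with the right lifting property with respect to $I$; and the domains of the maps in $I$ (in $J$) are small relative to transfinite compositions of pushouts of maps in $I$ (in $J$). Moreover, $\emptyset$, $\mathbb F$ and $\mathbb F\sqcup\mathbb F$ are finite, and $P$ is $\aleph_1$-small. Here, for a cardinal $\kappa$, an object $A$ is $\kappa$-small relative to a class $\mathcal W$ of maps if for every limit ordinal $\lambda$ in which every subset of cardinality at most $\kappa$ is bounded, and for every colimit-preserving functor $X:\lambda\to\mathsf C^*_1\mathsf{cat}$ with all $X_\beta\to X_{\beta+1}$ in $\mathcal W$, the canonical map $\operatorname{colim}_{\beta<\lambda}\operatorname{Hom}(A,X_\beta)\to\operatorname{Hom}(A,\operatorname{colim}_{\beta<\lambda}X_\beta)$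 is bijective; $A$ is small relative to $\mathcal W$ if it is so for some $\kappa$; it is $\kappa$-small if it is so relative to all maps, and finite if it is $\kappa$-small for some finite $\kappa$. In fact, the bijectivity for $P$ holds for every limit ordinal $\lambda$ of uncountable cofinality, i.e. $P$ is even $\aleph_0$-small in this convention. -/

import Mathlib

open CategoryTheory Limits HomotopicalAlgebra Cardinal

universe u

/-- A small (unital) C*-category over `𝕜` (which is `ℝ` or `ℂ`): a small category whose Hom spaces
are Banach spaces over `𝕜` with bilinear submultiplicative composition, with a conjugate-linear
involutive contravariant involution `adj` that is the identity on objects, satisfying the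
C*-identity and the positivity axiom. With Mathlib's diagrammatic order of composition,
`a ≫ adj a` is the endomorphism usually written `a* a`. -/
structure CStarCat (𝕜 : Type) [RCLike 𝕜] : Type (u + 1) where
  /-- The set of objects. -/
  carrier : Type u
  [category : Category.{u} carrier]
  [normedAddCommGroup (x y : carrier) : NormedAddCommGroup (x ⟶ y)]
  [normedSpace (x y : carrier) : NormedSpace 𝕜 (x ⟶ y)]
  [completeSpace (x y : carrier) : CompleteSpace (x ⟶ y)]
  add_comp {x y z : carrier} (a b : x ⟶ y) (c : y ⟶ z) : (a + b) ≫ c = a ≫ c + b ≫ c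
  comp_add {x y z : carrier} (a : x ⟶ y) (b c : y ⟶ z) : a ≫ (b + c) = a ≫ b + a ≫ c
  smul_comp {x y z : carrier} (k : 𝕜) (a : x ⟶ y) (b : y ⟶ z) : (k • a) ≫ b = k • (a ≫ b)
  comp_smul {x y z : carrier} (a : x ⟶ y) (k : 𝕜) (b : y ⟶ z) : a ≫ (k • b) = k • (a ≫ b)
  norm_comp_le {x y z : carrier} (a : x ⟶ y) (b : y ⟶ z) : ‖a ≫ b‖ ≤ ‖a‖ * ‖b‖
  /-- The involution, usually written `a ↦ a*`. -/
  adj {x y : carrier} (a : x ⟶ y) : y ⟶ x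
  adj_add {x y : carrier} (a b : x ⟶ y) : adj (a + b) = adj a + adj b
  adj_smul {x y : carrier} (k : 𝕜) (a : x ⟶ y) : adj (k • a) = (starRingEnd 𝕜 k) • adj a
  adj_comp {x y z : carrier} (a : x ⟶ y) (b : y ⟶ z) : adj (a ≫ b) = adj b ≫ adj a
  adj_adj {x y : carrier} (a : x ⟶ y) : adj (adj a) = a
  norm_comp_adj {x y : carrier} (a : x ⟶ y) : ‖a ≫ adj a‖ = ‖a‖ ^ 2
  /-- The spectrum of `a* a` in the endomorphism algebra of `x` is contained in `[0, ∞)`. -/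
  positivity {x y : carrier} (a : x ⟶ y) (k : 𝕜) :
    ¬ IsIso (a ≫ adj a - k • 𝟙 x) → ∃ r : ℝ, 0 ≤ r ∧ (r : 𝕜) = k

namespace CStarCat

variable {𝕜 : Type} [RCLike 𝕜]

instance : CoeSort (CStarCat.{u} 𝕜) (Type u) := ⟨CStarCat.carrier⟩

attribute [instance] CStarCat.category CStarCat.normedAddCommGroup CStarCat.normedSpace
  CStarCat.completeSpace

/-- Unitary arrows: `a* a = 1` and `a a* = 1`. -/
def IsUnitary {A : CStarCat.{u} 𝕜} {x y : A} (a : x ⟶ y) : Prop :=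
  a ≫ A.adj a = 𝟙 x ∧ A.adj a ≫ a = 𝟙 y

/-- (Unit-preserving) *-functors: linear functors commuting with the involution. -/
@[ext]
structure StarFunctor (A B : CStarCat.{u} 𝕜) extends A ⥤ B where
  map_add {x y : A} (a b : x ⟶ y) : map (a + b) = map a + map b
  map_smul {x y : A} (k : 𝕜) (a : x ⟶ y) : map (k • a) = k • map a
  map_adj {x y : A} (a : x ⟶ y) : map (A.adj a) = B.adj (map a)

/-- The category of small C*-categories and *-functors. -/
instance : LargeCategory.{u} (CStarCat.{u} 𝕜) where
  Hom A B := StarFunctor A B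
  id A :=
    { toFunctor := 𝟭 A
      map_add := fun _ _ => rfl
      map_smul := fun _ _ => rfl
      map_adj := fun _ => rfl }
  comp F G :=
    { toFunctor := F.toFunctor ⋙ G.toFunctor
      map_add := fun a b => by
        simp only [Functor.comp_map, StarFunctor.map_add]
      map_smul := fun k a => by
        simp only [Functor.comp_map, StarFunctor.map_smul]
      map_adj := fun a => by
        simp only [Functor.comp_map, StarFunctor.map_adj] }

/-- The underlying functor of a morphism of C*-categories. -/
abbrev functor {A B : CStarCat.{u} 𝕜} (F : A ⟶ B) : A ⥤ B := StarFunctor.toFunctor F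

/-! ### The three classes of the unitary model structure -/

/-- Unitary equivalences: *-functors with a quasi-inverse *-functor, such that both natural
isomorphisms have unitary components. -/
def unitaryEquivalences (𝕜 : Type) [RCLike 𝕜] : MorphismProperty (CStarCat.{u} 𝕜) :=
  fun A B F => ∃ (G : B ⟶ A) (α : functor F ⋙ functor G ≅ 𝟭 A)
    (β : functor G ⋙ functor F ≅ 𝟭 B),
    (∀ x : A, IsUnitary (α.hom.app x)) ∧ ∀ y : B, IsUnitary (β.hom.app y)

/-- *-functors that are injective on objects. -/
def objInjective (𝕜 : Type) [RCLike 𝕜] : MorphismProperty (CStarCat.{u} 𝕜) :=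
  fun _ _ F => Function.Injective (functor F).obj

/-- *-functors `F` such that every unitary `v : F x ⟶ y` is of the form `F u`, for a unitary
`u : x ⟶ x'` (so that `F x' = y`). -/
def unitaryFibrations (𝕜 : Type) [RCLike 𝕜] : MorphismProperty (CStarCat.{u} 𝕜) :=
  fun A B F => ∀ (x : A) (y : B) (v : (functor F).obj x ⟶ y), IsUnitary v →
    ∃ (x' : A) (u : x ⟶ x'), IsUnitary u ∧ Arrow.mk ((functor F).map u) = Arrow.mk v

/-- `M` is the unitary model structure on small C*-categories: it has the prescribed three
classes of maps. As usual for model categories, the ambient category has all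
small limits and colimits and the two factorizations can be chosen functorially. -/
structure IsUnitaryModelStructure (M : ModelCategory (CStarCat.{u} 𝕜)) : Prop where
  weakEquivalences_eq : weakEquivalences (CStarCat.{u} 𝕜) = unitaryEquivalences 𝕜
  cofibrations_eq : cofibrations (CStarCat.{u} 𝕜) = objInjective 𝕜
  fibrations_eq : fibrations (CStarCat.{u} 𝕜) = unitaryFibrations 𝕜
  hasLimits : HasLimitsOfSize.{u, u} (CStarCat.{u} 𝕜)
  hasColimits : HasColimitsOfSize.{u, u} (CStarCat.{u} 𝕜)
  functorial_trivialCofibration_fibration : MorphismProperty.HasFunctorialFactorization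
    (trivialCofibrations (CStarCat.{u} 𝕜)) (fibrations (CStarCat.{u} 𝕜))
  functorial_cofibration_trivialFibration : MorphismProperty.HasFunctorialFactorization
    (cofibrations (CStarCat.{u} 𝕜)) (trivialFibrations (CStarCat.{u} 𝕜))

end CStarCat

/-! ### Smallness and cofibrant generation -/

section Small

variable {C : Type (u + 1)} [LargeCategory.{u} C]

/-- `A` is `κ`-small relative to the class `W` of maps: for every `κ`-filtered ordinal `J`
(a limit ordinal in which every subset of cardinality at most `κ` is bounded) and every
colimit-preserving sequence `X : J ⥤ C` whose successor maps are in `W`, the canonical map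
`colim Hom(A, X j) ⟶ Hom(A, colim X)` is bijective. -/
def IsCardinalSmallRel (κ : Cardinal.{u}) (W : MorphismProperty C) (A : C) : Prop :=
  ∀ (J : Type u) [LinearOrder J] [SuccOrder J] [OrderBot J] [WellFoundedLT J] [NoMaxOrder J],
    (∀ S : Set J, #S ≤ κ → BddAbove S) →
    ∀ (X : J ⥤ C) [X.IsWellOrderContinuous],
      (∀ j : J, W (X.map (homOfLE (Order.le_succ j)))) →
      PreservesColimit X (coyoneda.obj (Opposite.op A))

/-- `A` is small relative to `W` if it is `κ`-small relative to `W` for some `κ`. -/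
def IsSmallRel (W : MorphismProperty C) (A : C) : Prop :=
  ∃ κ : Cardinal.{u}, IsCardinalSmallRel κ W A

/-- `A` is `κ`-small: it is so relative to all maps. -/
def IsCardinalSmall (κ : Cardinal.{u}) (A : C) : Prop :=
  IsCardinalSmallRel κ (⊤ : MorphismProperty C) A

/-- `A` is finite: it is `κ`-small for a finite cardinal `κ`. -/
def IsFiniteObject (A : C) : Prop :=
  ∃ n : ℕ, IsCardinalSmall (n : Cardinal.{u}) A

/-- Relative `I`-cell complexes: transfinite compositions of pushouts of maps in `I`. -/
def relativeCells (I : MorphismProperty C) : MorphismProperty C :=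
  MorphismProperty.transfiniteCompositions.{u} I.pushouts

/-- The model category structure `M` is cofibrantly generated, with the set `I` of generating
cofibrations and the set `J` of generating trivial cofibrations. -/
structure IsCofibrantlyGeneratedBy (M : ModelCategory C) (I J : MorphismProperty C) : Prop where
  isSmall_I : MorphismProperty.IsSmall.{u} I
  isSmall_J : MorphismProperty.IsSmall.{u} J
  I_le_cofibrations : I ≤ cofibrations C
  J_le_trivialCofibrations : J ≤ trivialCofibrations C
  small_I {X Y : C} (i : X ⟶ Y) : I i → IsSmallRel (relativeCells I) X
  small_J {X Y : C} (j : X ⟶ Y) : J j → IsSmallRel (relativeCells J) X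
  fibrations_eq : fibrations C = J.rlp
  trivialFibrations_eq : trivialFibrations C = I.rlp

end Small

namespace CStarCat

variable {𝕜 : Type} [RCLike 𝕜]

/-! ### The generating maps -/

/-- The empty C*-category. -/
def empty (𝕜 : Type) [RCLike 𝕜] : CStarCat.{u} 𝕜 where
  carrier := PEmpty.{u + 1}
  category :=
    { Hom := fun x _ => x.elim
      id := fun x => x.elim
      comp := fun {x} => x.elim
      id_comp := fun {x} => x.elim
      comp_id := fun {x} => x.elim
      assoc := fun {x} => x.elim }
  normedAddCommGroup := fun x => x.elim
  normedSpace := fun x => x.elim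
  completeSpace := fun x => x.elim
  add_comp := fun {x} => x.elim
  comp_add := fun {x} => x.elim
  smul_comp := fun {x} => x.elim
  comp_smul := fun {x} => x.elim
  norm_comp_le := fun {x} => x.elim
  adj := fun {x} => x.elim
  adj_add := fun {x} => x.elim
  adj_smul := fun {x} => x.elim
  adj_comp := fun {x} => x.elim
  adj_adj := fun {x} => x.elim
  norm_comp_adj := fun {x} => x.elim
  positivity := fun {x} => x.elim

/-- The unique *-functor from the empty C*-category. -/
def fromEmpty (A : CStarCat.{u} 𝕜) : empty 𝕜 ⟶ A :=
  show StarFunctor (empty 𝕜) A from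
  { obj := fun x => PEmpty.elim x
    map := fun {x} => PEmpty.elim x
    map_id := fun x => PEmpty.elim x
    map_comp := fun {x} => PEmpty.elim x
    map_add := fun {x} => PEmpty.elim x
    map_smul := fun {x} => PEmpty.elim x
    map_adj := fun {x} => PEmpty.elim x }

/-- A type with one element, the object of the C*-category `base`. -/
inductive Pt (𝕜 : Type) : Type u
  | pt

/-- The category with one object whose endomorphism monoid is `𝕜`. -/
instance Pt.category (𝕜 : Type) [RCLike 𝕜] : Category.{u} (Pt.{u} 𝕜) where
  Hom _ _ := ULift.{u} 𝕜
  id _ := ⟨1⟩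
  comp a b := ⟨b.down * a.down⟩
  assoc _ _ _ := ULift.ext _ _ (mul_assoc _ _ _).symm

/-- The base field as a C*-category with one object, whose endomorphism algebra is `𝕜`. -/
def base (𝕜 : Type) [RCLike 𝕜] : CStarCat.{u} 𝕜 where
  carrier := Pt.{u} 𝕜
  category := Pt.category 𝕜
  normedAddCommGroup := fun _ _ => inferInstanceAs (NormedAddCommGroup (ULift.{u} 𝕜))
  normedSpace := fun _ _ => inferInstanceAs (NormedSpace 𝕜 (ULift.{u} 𝕜))
  completeSpace := fun _ _ => inferInstanceAs (CompleteSpace (ULift.{u} 𝕜))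
  add_comp := fun a b c => ULift.ext _ _ (mul_add _ _ _)
  comp_add := fun a b c => ULift.ext _ _ (add_mul _ _ _)
  smul_comp := fun k a b => ULift.ext _ _ (mul_left_comm _ _ _)
  comp_smul := fun a k b => ULift.ext _ _ (mul_assoc _ _ _)
  norm_comp_le := fun a b => by
    show ‖b.down * a.down‖ ≤ ‖a.down‖ * ‖b.down‖
    rw [norm_mul, mul_comm]
  adj := fun a => ⟨starRingEnd 𝕜 a.down⟩
  adj_add := fun a b => ULift.ext _ _ (map_add _ _ _)
  adj_smul := fun k a => ULift.ext _ _ (map_mul _ _ _)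
  adj_comp := fun a b => ULift.ext _ _ ((map_mul _ _ _).trans (mul_comm _ _))
  adj_adj := fun a => ULift.ext _ _ (RCLike.conj_conj _)
  norm_comp_adj := fun a => by
    show ‖starRingEnd 𝕜 a.down * a.down‖ = ‖a.down‖ ^ 2
    rw [norm_mul, RCLike.norm_conj, sq]
  positivity := fun a k h => by
    refine ⟨‖a.down‖ ^ 2, by positivity, ?_⟩
    by_contra hk
    apply h
    have hne : starRingEnd 𝕜 a.down * a.down - k * 1 ≠ 0 := by
      rw [RCLike.conj_mul, mul_one, sub_ne_zero]
      exact_mod_cast hk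
    refine ⟨⟨(starRingEnd 𝕜 a.down * a.down - k * 1)⁻¹⟩, ?_, ?_⟩
    · exact ULift.ext _ _ (inv_mul_cancel₀ hne)
    · exact ULift.ext _ _ (mul_inv_cancel₀ hne)

/-- The *-functor from the base field to `A` that picks out the object `x`. -/
def ofObj {A : CStarCat.{u} 𝕜} (x : A) : base 𝕜 ⟶ A :=
  show StarFunctor (base 𝕜) A from
  { obj := fun _ => x
    map := fun a => ULift.down (α := 𝕜) a • 𝟙 x
    map_id := fun _ => one_smul 𝕜 (𝟙 x)
    map_comp := fun a b => by
      rw [A.smul_comp, A.comp_smul, Category.comp_id, smul_smul]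
      exact congrArg (· • 𝟙 x) (mul_comm _ _)
    map_add := fun a b => add_smul (ULift.down (α := 𝕜) a) (ULift.down b) (𝟙 x)
    map_smul := fun k a => mul_smul k (ULift.down (α := 𝕜) a) (𝟙 x)
    map_adj := fun a => by
      have h : A.adj (𝟙 x) = 𝟙 x := by
        have h1 := A.adj_comp (A.adj (𝟙 x)) (𝟙 x)
        rw [Category.comp_id, A.adj_adj, Category.comp_id] at h1
        exact h1.symm
      show starRingEnd 𝕜 (ULift.down a) • 𝟙 x = A.adj (ULift.down (α := 𝕜) a • 𝟙 x)
      rw [A.adj_smul, h] }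

/-- The *-functor `F` sends the arrow `a` to the arrow `b` (and hence the endpoints of `a` to
those of `b`). -/
def Sends {A B : CStarCat.{u} 𝕜} (F : A ⟶ B) {x y : A} (a : x ⟶ y) {x' y' : B}
    (b : x' ⟶ y') : Prop :=
  Arrow.mk ((functor F).map a) = Arrow.mk b

/-- `A` is the universal C*-category generated by one arrow `a` of norm at most one. -/
structure IsUniversalContraction {A : CStarCat.{u} 𝕜} {x y : A} (a : x ⟶ y) : Prop where
  norm_le : ‖a‖ ≤ 1
  existsUnique (B : CStarCat.{u} 𝕜) {x' y' : B} (b : x' ⟶ y') :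
    ‖b‖ ≤ 1 → ∃! F : A ⟶ B, Sends F a b

/-- `A` is the universal C*-category generated by one unitary arrow `a`. -/
structure IsUniversalUnitary {A : CStarCat.{u} 𝕜} {x y : A} (a : x ⟶ y) : Prop where
  isUnitary : IsUnitary a
  existsUnique (B : CStarCat.{u} 𝕜) {x' y' : B} (b : x' ⟶ y') :
    IsUnitary b → ∃! F : A ⟶ B, Sends F a b

/-- The objects and maps used to define the generating (trivial) cofibrations. Each of them is
specified by a universal property, hence up to isomorphism. -/
structure Generators (𝕜 : Type) [RCLike 𝕜] where
  /-- The universal C*-category on an arrow `arr : s ⟶ t` of norm at most one. -/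
  one : CStarCat.{u} 𝕜
  {s t : one}
  arr : s ⟶ t
  isUniversal_arr : IsUniversalContraction arr
  /-- The coproduct of two copies of the base field. -/
  two : CStarCat.{u} 𝕜
  inl : base 𝕜 ⟶ two
  inr : base 𝕜 ⟶ two
  isCoproduct : Nonempty (IsColimit (BinaryCofan.mk inl inr))
  /-- The map sending the first copy of the base field to `s` and the second one to `t`. -/
  V : two ⟶ one
  inl_V : inl ≫ V = ofObj s
  inr_V : inr ≫ V = ofObj t
  /-- The pushout of `V` along itself. -/
  P : CStarCat.{u} 𝕜
  in₁ : one ⟶ P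
  in₂ : one ⟶ P
  isPushout : IsPushout V V in₁ in₂
  /-- The map with both components equal to the identity. -/
  W : P ⟶ one
  in₁_W : in₁ ≫ W = 𝟙 one
  in₂_W : in₂ ≫ W = 𝟙 one
  /-- The universal C*-category on a unitary `unitary : i₀ ⟶ i₁`. -/
  interval : CStarCat.{u} 𝕜
  {i₀ i₁ : interval}
  unitary : i₀ ⟶ i₁
  isUniversal_unitary : IsUniversalUnitary unitary

/-- The set `{∅ ⟶ 𝕜, 𝕜 ⊔ 𝕜 ⟶ 𝟏, P ⟶ 𝟏}`. -/
def Generators.I (G : Generators.{u} 𝕜) : MorphismProperty (CStarCat.{u} 𝕜) :=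
  .single (fromEmpty (base 𝕜)) ⊔ .single G.V ⊔ .single G.W

/-- The set `{𝕜 ⟶ 𝐈}`, whose only element picks out the source of the universal unitary. -/
def Generators.J (G : Generators.{u} 𝕜) : MorphismProperty (CStarCat.{u} 𝕜) :=
  .single (ofObj G.i₀)

end CStarCat

/-! Two facts about norms carry everything. The first is spectral: in a C*-category a self-adjoint
endomorphism `c` of an object with nonzero identity has a real spectral point of absolute value
`‖c‖` (`exists_abs_eq_norm_not_isIso`). Both base fields are treated as real, and the endomorphism
algebra is embedded isometrically in a complex Banach algebra, where Gelfand's formula applies;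
positivity forces the extremal spectral point to be real. Hence *-functors are contractive, and
fully faithful ones, which reflect invertibility, are isometric. The second fact is that, given the
other axioms, positivity amounts to `‖‖a‖² - a*a‖ ≤ ‖a‖²` (`positivity_of_norm_sub_le`,
`norm_smul_id_sub_le`). An inequality between norms passes to closed subspaces, to bounded products
and to germs, where spectra are harder to compare.

Limits are closed subspaces of bounded products. A presentation by norm-bounded generators and
relations has a universal model: its models realize only a set of norm functions on formal
expressions, so the product of one model for each such function contains it as a closed generated
subcategory. This gives all colimits and the universal contraction.

For the model structure, unitary equivalences are the maps that become invertible modulo unitary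
natural isomorphism, and trivial fibrations are the fully faithful *-functors surjective on objects
(`trivialFibration_iff`). Lifts are built by choosing values on objects and conjugating by
unitaries. The factorizations are a mapping cylinder, with homs taken from the target, and a path
construction, with homs taken from the source. A lifting problem against `J` is a unitary to be
lifted; those against `I` test surjectivity on objects, fullness and faithfulness, arrows being
rescaled to contractions.

For smallness, objects of a sequential colimit are the colimit of the object sets, which makes the
empty category, the base field and its double finite. If countable sets of stages are bounded, the
colimit consists of germs of arrows: norms are attained at late stages and a Cauchy sequence of
germs lives at one stage, so no completion is needed. A map out of `P` is a pair of parallel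
contractions, and these are represented by contractions at some stage. -/

/-! ### Real spectral points in real Banach algebras -/

section Analysis

variable {E : Type*} [NormedRing E] [NormedAlgebra ℝ E]

/-- The complex-valued dual space of a real normed space. -/
abbrev ComplexDual (E : Type*) [NormedRing E] [NormedAlgebra ℝ E] := E →L[ℝ] ℂ

/-- The complex Banach algebra of operators on the complex-valued dual. -/
abbrev ComplexDualOp (E : Type*) [NormedRing E] [NormedAlgebra ℝ E] :=
  ComplexDual E →L[ℂ] ComplexDual E

/-- The operator on the complex-valued dual induced by right multiplication by `c`. -/
noncomputable def dualRightMulOp (c : E) : ComplexDualOp E :=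
  LinearMap.mkContinuous
    { toFun := fun φ => φ.comp ((ContinuousLinearMap.mul ℝ E).flip c)
      map_add' := fun _ _ => rfl
      map_smul' := fun _ _ => rfl } ‖c‖ fun φ => by
        refine (ContinuousLinearMap.opNorm_comp_le _ _).trans ?_
        rw [mul_comm]
        refine mul_le_mul_of_nonneg_right ?_ (norm_nonneg _)
        refine ContinuousLinearMap.opNorm_le_bound _ (norm_nonneg _) fun x => ?_
        rw [mul_comm]; exact norm_mul_le _ _

lemma dualRightMulOp_apply (c : E) (φ : ComplexDual E) (x : E) :
    dualRightMulOp c φ x = φ (x * c) := rfl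

lemma dualRightMulOp_ext {S T : ComplexDualOp E}
    (h : ∀ φ x, S φ x = T φ x) : S = T :=
  ContinuousLinearMap.ext fun φ => ContinuousLinearMap.ext fun x => h φ x

lemma norm_dualRightMulOp_le (c : E) : ‖dualRightMulOp c‖ ≤ ‖c‖ :=
  LinearMap.mkContinuous_norm_le _ (norm_nonneg _) _

/-- Hahn–Banach gives a functional of norm at most one with value `‖c‖` at `c`. The operator applied
to it and evaluated at `1` has absolute value `‖c‖`; since `‖1‖ ≤ 1`, this bounds the operator norm
from below. -/
lemma norm_dualRightMulOp (h1 : ‖(1 : E)‖ ≤ 1) (c : E) : ‖dualRightMulOp c‖ = ‖c‖ := by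
  refine (norm_dualRightMulOp_le c).antisymm ?_
  obtain ⟨φ, hφ, hφc⟩ := exists_dual_vector'' ℝ c
  let ψ : ComplexDual E := Complex.ofRealCLM.comp φ
  have hψ : ‖ψ‖ ≤ 1 := by
    refine ContinuousLinearMap.opNorm_le_bound _ zero_le_one fun x => ?_
    have h := φ.le_opNorm x
    have h' : ‖ψ x‖ = ‖φ x‖ := Complex.norm_real _
    rw [h']
    exact h.trans (mul_le_mul_of_nonneg_right hφ (norm_nonneg _))
  have h : ‖dualRightMulOp c ψ 1‖ = ‖c‖ := by
    rw [dualRightMulOp_apply, one_mul]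
    have h' : ‖ψ c‖ = ‖φ c‖ := Complex.norm_real _
    rw [h', hφc]; simp
  rw [← h]
  calc ‖dualRightMulOp c ψ 1‖
      ≤ ‖dualRightMulOp c ψ‖ * ‖(1 : E)‖ := ContinuousLinearMap.le_opNorm _ _
    _ ≤ (‖dualRightMulOp c‖ * ‖ψ‖) * ‖(1 : E)‖ := by
        gcongr; exact ContinuousLinearMap.le_opNorm _ _
    _ ≤ (‖dualRightMulOp c‖ * 1) * 1 := by gcongr
    _ = _ := by rw [mul_one, mul_one]

/-- A real Banach algebra embeds into the operators on its complex-valued dual. -/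
noncomputable def dualRightMul : E →+* (ComplexDualOp E) where
  toFun := dualRightMulOp
  map_one' := dualRightMulOp_ext fun φ x => congrArg φ (mul_one x)
  map_mul' a b := dualRightMulOp_ext fun φ x => congrArg φ (mul_assoc x a b).symm
  map_zero' := dualRightMulOp_ext fun φ x => (congrArg φ (mul_zero x)).trans (map_zero φ)
  map_add' a b := dualRightMulOp_ext fun φ x => (congrArg φ (mul_add x a b)).trans (map_add φ _ _)

lemma dualRightMul_algebraMap (s : ℝ) :
    dualRightMul (algebraMap ℝ E s) =
      (s : ℂ) • (1 : ComplexDualOp E) :=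
  dualRightMulOp_ext fun φ x => by
    have h : φ (x * algebraMap ℝ E s) = s • φ x := by
      rw [← Algebra.commutes, ← Algebra.smul_def, map_smul]
    exact h

/-- An element of a real algebra whose quadratic resolvents exist and whose norm is given by the
spectral radius formula has its norm, up to sign, in its real spectrum; here the algebra is
embedded isometrically in a complex one. -/
lemma exists_abs_eq_norm_not_isUnit_of_embedding {B : Type*} [NormedRing B] [NormedAlgebra ℂ B]
    [CompleteSpace B] [Nontrivial B] (T : E →+* B) (hnorm : ∀ c, ‖T c‖ = ‖c‖)
    (hT' : ∀ s : ℝ, T (algebraMap ℝ E s) = (s : ℂ) • (1 : B)) (c : E)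
    (hpow : ∀ n : ℕ, ‖c ^ (2 ^ n)‖ = ‖c‖ ^ (2 ^ n))
    (hinv : ∀ x y : ℝ, y ≠ 0 →
      IsUnit ((c - algebraMap ℝ E x) * (c - algebraMap ℝ E x) + algebraMap ℝ E (y ^ 2))) :
    ∃ s : ℝ, |s| = ‖c‖ ∧ ¬ IsUnit (c - algebraMap ℝ E s) := by
  have hT : ∀ s : ℝ, T (algebraMap ℝ E s) = algebraMap ℂ B (s : ℂ) := fun s => by
    rw [hT', Algebra.algebraMap_eq_smul_one]
  -- Along the exponents `2 ^ n` the sequence in Gelfand's formula is constant, equal to `‖c‖`.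
  have hrad : spectralRadius ℂ (T c) = ‖c‖₊ := by
    refine tendsto_nhds_unique ((spectrum.pow_nnnorm_pow_one_div_tendsto_nhds_spectralRadius
      (T c)).comp (tendsto_pow_atTop_atTop_of_one_lt (r := 2) one_lt_two)) ?_
    refine tendsto_const_nhds.congr fun n => ?_
    rw [Function.comp_apply, ← map_pow]
    have h2 : ‖T (c ^ (2 ^ n))‖₊ = ‖c‖₊ ^ (2 ^ n) := by
      apply NNReal.eq
      rw [NNReal.coe_pow, coe_nnnorm, coe_nnnorm, hnorm, hpow]
    rw [h2, ENNReal.coe_pow, ← ENNReal.rpow_natCast, ← ENNReal.rpow_mul]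
    simp
  obtain ⟨z, hz, hzn⟩ := spectrum.exists_nnnorm_eq_spectralRadius (T c)
  rw [hrad] at hzn
  have hzn' : ‖z‖ = ‖c‖ := congrArg NNReal.toReal (by exact_mod_cast hzn : ‖z‖₊ = ‖c‖₊)
  have hzu : ¬ IsUnit (algebraMap ℂ B z - T c) := hz
  -- If `z = x + iy` with `y ≠ 0`, the invertible `(c - x)² + y²` is mapped to the product of the
  -- commuting elements `z - T c` and `z̄ - T c`, so `z` would lie outside the spectrum.
  have him : z.im = 0 := by
    by_contra him
    have hu := (hinv z.re z.im him).map T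
    rw [map_add, map_mul, map_sub, hT, hT] at hu
    have hfac : (T c - algebraMap ℂ B (z.re : ℂ)) * (T c - algebraMap ℂ B (z.re : ℂ)) +
        algebraMap ℂ B ((z.im ^ 2 : ℝ) : ℂ) =
        (algebraMap ℂ B z - T c) * (algebraMap ℂ B (starRingEnd ℂ z) - T c) := by
      have hzz : starRingEnd ℂ z = 2 * (z.re : ℂ) - z := by
        rw [eq_sub_iff_add_eq, add_comm, Complex.add_conj]; simp
      have hzz2 : ((z.im ^ 2 : ℝ) : ℂ) = z * (2 * (z.re : ℂ) - z) - (z.re : ℂ) * (z.re : ℂ) := by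
        rw [← hzz, Complex.mul_conj, Complex.normSq_apply]
        push_cast; ring
      rw [hzz2, hzz]
      have hc1 := Algebra.commutes (z.re : ℂ) (T c)
      have hc2 := Algebra.commutes z (T c)
      simp only [map_sub, map_mul, map_add, sub_mul, mul_sub, two_mul, mul_add]
      rw [hc1, hc2]
      abel
    rw [hfac] at hu
    have hcomm : Commute (algebraMap ℂ B z - T c) (algebraMap ℂ B (starRingEnd ℂ z) - T c) :=
      Commute.sub_left (Algebra.commute_algebraMap_left _ _)
        (Commute.sub_right (Algebra.commute_algebraMap_right _ _) (Commute.refl _))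
    exact hzu ((hcomm.isUnit_mul_iff.1 hu).1)
  have hzr : z = (z.re : ℂ) := Complex.ext rfl (by simpa using him)
  refine ⟨z.re, ?_, fun hu => hzu ?_⟩
  · rw [← hzn', hzr]; simp
  · have := (hu.map T).neg
    rwa [map_sub, neg_sub, hT, ← hzr] at this

/-- Operators on the complex-valued dual are a complete complex algebra containing `E`
isometrically, so no norm has to be constructed on a complexification of `E`. -/
lemma exists_abs_eq_norm_not_isUnit [CompleteSpace E] [Nontrivial E] (h1 : ‖(1 : E)‖ ≤ 1) (c : E)
    (hpow : ∀ n : ℕ, ‖c ^ (2 ^ n)‖ = ‖c‖ ^ (2 ^ n))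
    (hinv : ∀ x y : ℝ, y ≠ 0 →
      IsUnit ((c - algebraMap ℝ E x) * (c - algebraMap ℝ E x) + algebraMap ℝ E (y ^ 2))) :
    ∃ s : ℝ, |s| = ‖c‖ ∧ ¬ IsUnit (c - algebraMap ℝ E s) := by
  have hnt : Nontrivial (ComplexDualOp E) := by
    refine ⟨dualRightMul (1 : E), 0, fun h => ?_⟩
    have h2 : ‖dualRightMul (1 : E)‖ = ‖(1 : E)‖ := norm_dualRightMulOp h1 1
    rw [h] at h2
    have h3 : ‖(0 : ComplexDualOp E)‖ = 0 := ContinuousLinearMap.opNorm_zero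
    exact one_ne_zero (norm_eq_zero.1 (h2.symm.trans h3))
  exact exists_abs_eq_norm_not_isUnit_of_embedding (B := ComplexDualOp E) (dualRightMul (E := E))
    (norm_dualRightMulOp h1) dualRightMul_algebraMap c hpow hinv

end Analysis

/-! ### Positivity from a norm inequality -/

/-- The data of a `CStarCat`, without the positivity axiom. -/
structure BanachStarCat (𝕜 : Type) [RCLike 𝕜] : Type (u + 1) where
  /-- The set of objects. -/
  carrier : Type u
  [category : Category.{u} carrier]
  [normedAddCommGroup (x y : carrier) : NormedAddCommGroup (x ⟶ y)]
  [normedSpace (x y : carrier) : NormedSpace 𝕜 (x ⟶ y)]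
  [completeSpace (x y : carrier) : CompleteSpace (x ⟶ y)]
  add_comp {x y z : carrier} (a b : x ⟶ y) (c : y ⟶ z) : (a + b) ≫ c = a ≫ c + b ≫ c
  comp_add {x y z : carrier} (a : x ⟶ y) (b c : y ⟶ z) : a ≫ (b + c) = a ≫ b + a ≫ c
  smul_comp {x y z : carrier} (k : 𝕜) (a : x ⟶ y) (b : y ⟶ z) : (k • a) ≫ b = k • (a ≫ b)
  comp_smul {x y z : carrier} (a : x ⟶ y) (k : 𝕜) (b : y ⟶ z) : a ≫ (k • b) = k • (a ≫ b)
  norm_comp_le {x y z : carrier} (a : x ⟶ y) (b : y ⟶ z) : ‖a ≫ b‖ ≤ ‖a‖ * ‖b‖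
  /-- The involution. -/
  adj {x y : carrier} (a : x ⟶ y) : y ⟶ x
  adj_add {x y : carrier} (a b : x ⟶ y) : adj (a + b) = adj a + adj b
  adj_smul {x y : carrier} (k : 𝕜) (a : x ⟶ y) : adj (k • a) = (starRingEnd 𝕜 k) • adj a
  adj_comp {x y z : carrier} (a : x ⟶ y) (b : y ⟶ z) : adj (a ≫ b) = adj b ≫ adj a
  adj_adj {x y : carrier} (a : x ⟶ y) : adj (adj a) = a
  norm_comp_adj {x y : carrier} (a : x ⟶ y) : ‖a ≫ adj a‖ = ‖a‖ ^ 2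

namespace BanachStarCat

variable {𝕜 : Type} [RCLike 𝕜] (A : BanachStarCat.{u} 𝕜)

attribute [instance] BanachStarCat.category BanachStarCat.normedAddCommGroup
  BanachStarCat.normedSpace BanachStarCat.completeSpace

variable {A}

instance : Preadditive A.carrier where
  homGroup x y := (A.normedAddCommGroup x y).toAddCommGroup
  add_comp _ _ _ := A.add_comp
  comp_add _ _ _ := A.comp_add

instance : Linear 𝕜 A.carrier where
  homModule x y := (A.normedSpace x y).toModule
  smul_comp _ _ _ := A.smul_comp
  comp_smul _ _ _ := A.comp_smul

lemma adj_id (x : A.carrier) : A.adj (𝟙 x) = 𝟙 x := by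
  have h1 := A.adj_comp (A.adj (𝟙 x)) (𝟙 x)
  rw [Category.comp_id, A.adj_adj, Category.comp_id] at h1
  exact h1.symm

/-- The involution as an additive map. -/
def adjHom (x y : A.carrier) : (x ⟶ y) →+ (y ⟶ x) := AddMonoidHom.mk' A.adj A.adj_add

lemma adj_sub {x y : A.carrier} (a b : x ⟶ y) : A.adj (a - b) = A.adj a - A.adj b :=
  (adjHom x y).map_sub a b

lemma norm_id_le (x : A.carrier) : ‖𝟙 x‖ ≤ 1 := by
  have h := A.norm_comp_adj (𝟙 x)
  rw [adj_id, Category.comp_id] at h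
  nlinarith [norm_nonneg (𝟙 x)]

lemma norm_adj {x y : A.carrier} (a : x ⟶ y) : ‖A.adj a‖ = ‖a‖ := by
  have key : ∀ {x y : A.carrier} (a : x ⟶ y), ‖a‖ ≤ ‖A.adj a‖ := by
    intro x y a
    rcases (norm_nonneg a).eq_or_lt with h | h
    · rw [← h]; exact norm_nonneg _
    · have := A.norm_comp_le a (A.adj a)
      rw [A.norm_comp_adj, sq] at this
      exact le_of_mul_le_mul_left this h
  refine le_antisymm ?_ (key a)
  simpa only [A.adj_adj] using key (A.adj a)

/-- The endomorphism algebra of an object, with the diagrammatic order of multiplication. -/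
def EndAlg (x : A.carrier) : Type u := x ⟶ x

namespace EndAlg

variable (x : A.carrier)

instance : NormedAddCommGroup (EndAlg x) := inferInstanceAs (NormedAddCommGroup (x ⟶ x))

instance : NormedRing (EndAlg x) :=
  { (inferInstance : NormedAddCommGroup (EndAlg x)) with
    mul := fun a b => (show x ⟶ x from a) ≫ (show x ⟶ x from b)
    one := 𝟙 x
    left_distrib := fun a b c => A.comp_add _ _ _
    right_distrib := fun a b c => A.add_comp _ _ _
    zero_mul := fun a => Limits.zero_comp (C := A.carrier)
    mul_zero := fun a => Limits.comp_zero (C := A.carrier)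
    mul_assoc := fun a b c => Category.assoc _ _ _
    one_mul := fun a => Category.id_comp _
    mul_one := fun a => Category.comp_id _
    norm_mul_le := fun a b => A.norm_comp_le _ _ }

instance : NormedSpace 𝕜 (EndAlg x) := inferInstanceAs (NormedSpace 𝕜 (x ⟶ x))

instance : CompleteSpace (EndAlg x) := inferInstanceAs (CompleteSpace (x ⟶ x))

noncomputable instance : NormedAlgebra 𝕜 (EndAlg x) :=
  { Algebra.ofModule (R := 𝕜) (A := EndAlg x) (fun k a b => A.smul_comp k a b)
      (fun k a b => A.comp_smul a k b) with
    norm_smul_le := norm_smul_le }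

/-- Restriction of scalars lets one real spectral argument serve both base fields. -/
noncomputable instance : NormedAlgebra ℝ (EndAlg x) := NormedAlgebra.restrictScalars ℝ 𝕜 (EndAlg x)

lemma algebraMap_real (s : ℝ) :
    algebraMap ℝ (EndAlg x) s = (show x ⟶ x from (s : 𝕜) • 𝟙 x) := by
  have h : algebraMap ℝ (EndAlg x) s = algebraMap 𝕜 (EndAlg x) (s : 𝕜) := rfl
  rw [h, Algebra.algebraMap_eq_smul_one]
  rfl

lemma isUnit_iff (a : x ⟶ x) : IsUnit (show EndAlg x from a) ↔ IsIso a := by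
  constructor
  · rintro ⟨u, hu⟩
    exact ⟨⟨u.inv, hu ▸ u.mul_inv, hu ▸ u.inv_mul⟩⟩
  · intro h
    exact ⟨⟨a, inv a, IsIso.hom_inv_id a, IsIso.inv_hom_id a⟩, rfl⟩

end EndAlg

lemma isIso_id_sub {x : A.carrier} (q : x ⟶ x) (hq : ‖q‖ < 1) : IsIso (𝟙 x - q) :=
  (EndAlg.isUnit_iff x _).1 (isUnit_one_sub_of_norm_lt_one (R := EndAlg x) (x := q) hq)

lemma isIso_smul {x y : A.carrier} {k : 𝕜} (hk : k ≠ 0) (a : x ⟶ y) (_ : IsIso a) :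
    IsIso (k • a) :=
  ⟨⟨k⁻¹ • inv a, by simp [smul_smul, hk], by simp [smul_smul, hk]⟩⟩

lemma isIso_smul_id_sub {x : A.carrier} {k : 𝕜} (q : x ⟶ x) (hq : ‖q‖ < ‖k‖) :
    IsIso (q - k • 𝟙 x) := by
  have hk : k ≠ 0 := by
    rintro rfl
    exact absurd hq (by simp)
  have h := isIso_id_sub (k⁻¹ • q) (by
    rw [norm_smul, norm_inv, inv_mul_lt_iff₀ (norm_pos_iff.2 hk)]; simpa using hq)
  have h2 : q - k • 𝟙 x = (-k) • (𝟙 x - k⁻¹ • q) := by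
    rw [smul_sub, smul_smul, neg_mul, mul_inv_cancel₀ hk]
    simp
    abel
  rw [h2]
  exact isIso_smul (neg_ne_zero.2 hk) _ h

lemma isIso_of_comp_comm {x : A.carrier} (a b : x ⟶ x) (hab : a ≫ b = b ≫ a) (h : IsIso (a ≫ b)) :
    IsIso a := by
  rw [← EndAlg.isUnit_iff] at h ⊢
  exact ((Commute.isUnit_mul_iff (M := EndAlg x) (a := a) (b := b)
    (show Commute (show EndAlg x from a) (show EndAlg x from b) from hab)).1 h).1

/-- With `N = ‖a‖ ^ 2` and `d = a ≫ A.adj a`, one has `d + t = (N + t) - (N - d)`, and `‖N - d‖ ≤ N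
< N + t`, so the Neumann series applies. -/
lemma isIso_add_of_norm_sub_le
    (hb : ∀ {x y : A.carrier} (a : x ⟶ y),
      ‖((‖a‖ ^ 2 : ℝ) : 𝕜) • 𝟙 x - a ≫ A.adj a‖ ≤ ‖a‖ ^ 2)
    {x y : A.carrier} (a : x ⟶ y) {t : ℝ} (ht : 0 < t) :
    IsIso (a ≫ A.adj a + (t : 𝕜) • 𝟙 x) := by
  have h := isIso_smul_id_sub (k := ((‖a‖ ^ 2 + t : ℝ) : 𝕜))
    (((‖a‖ ^ 2 : ℝ) : 𝕜) • 𝟙 x - a ≫ A.adj a) (by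
      refine (hb a).trans_lt ?_
      rw [RCLike.norm_ofReal]
      exact (lt_add_of_pos_right _ ht).trans_le (le_abs_self _))
  have h2 : a ≫ A.adj a + (t : 𝕜) • 𝟙 x = (-1 : 𝕜) • (((‖a‖ ^ 2 : ℝ) : 𝕜) • 𝟙 x - a ≫ A.adj a -
      ((‖a‖ ^ 2 + t : ℝ) : 𝕜) • 𝟙 x) := by
    push_cast
    rw [add_smul]
    simp
    abel
  rw [h2]
  exact isIso_smul (neg_ne_zero.2 one_ne_zero) _ h

/-- The previous lemma excludes each way in which a spectral point `k` of `d = a ≫ A.adj a` could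
leave `[0, ∞)`: a negative real `k` directly, and a nonreal `k` because `(d - k)(d - k̄) = e e* +
(im k)²` with `e = d - re k` self-adjoint. -/
lemma positivity_of_norm_sub_le
    (hb : ∀ {x y : A.carrier} (a : x ⟶ y),
      ‖((‖a‖ ^ 2 : ℝ) : 𝕜) • 𝟙 x - a ≫ A.adj a‖ ≤ ‖a‖ ^ 2)
    {x y : A.carrier} (a : x ⟶ y) (k : 𝕜) (hk : ¬ IsIso (a ≫ A.adj a - k • 𝟙 x)) :
    ∃ r : ℝ, 0 ≤ r ∧ (r : 𝕜) = k := by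
  have him : RCLike.im k = 0 := by
    by_contra him
    apply hk
    set d := a ≫ A.adj a with hd
    have hdd : A.adj d = d := by rw [hd, A.adj_comp, A.adj_adj]
    set e := d - (RCLike.re k : 𝕜) • 𝟙 x with he
    have hee : A.adj e = e := by
      rw [he, adj_sub, hdd, A.adj_smul, adj_id, RCLike.conj_ofReal]
    have h := isIso_add_of_norm_sub_le hb e (t := RCLike.im k ^ 2) (by positivity)
    have hconj : starRingEnd 𝕜 k = 2 * (RCLike.re k : 𝕜) - k := by
      rw [eq_sub_iff_add_eq, add_comm, RCLike.add_conj]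
    have hmul : ((RCLike.im k ^ 2 : ℝ) : 𝕜) =
        k * (2 * (RCLike.re k : 𝕜) - k) - (RCLike.re k : 𝕜) * (RCLike.re k : 𝕜) := by
      rw [← hconj, RCLike.mul_conj, ← RCLike.ofReal_pow, RCLike.norm_sq_eq_def]
      push_cast; ring
    refine isIso_of_comp_comm _ (d - (starRingEnd 𝕜 k) • 𝟙 x) ?_ ?_
    · simp only [Preadditive.sub_comp, Preadditive.comp_sub, Linear.smul_comp, Linear.comp_smul,
        Category.id_comp, Category.comp_id, smul_sub]
      rw [smul_comm]
      abel
    · convert h using 1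
      rw [hee, hmul, hconj, he]
      simp only [Preadditive.sub_comp, Preadditive.comp_sub, Linear.smul_comp, Linear.comp_smul,
        Category.id_comp, Category.comp_id, smul_sub, sub_smul, mul_smul, mul_sub, two_mul, add_smul,
        smul_add, Preadditive.comp_add]
      rw [smul_comm k (RCLike.re k : 𝕜)]
      abel
  have hre : ((RCLike.re k : ℝ) : 𝕜) = k := by
    conv_rhs => rw [← RCLike.re_add_im k]
    rw [him]; simp
  refine ⟨RCLike.re k, ?_, hre⟩
  by_contra hneg
  apply hk
  have h := isIso_add_of_norm_sub_le hb a (t := - RCLike.re k) (by linarith)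
  convert h using 1
  rw [RCLike.ofReal_neg, neg_smul, hre, sub_eq_add_neg]

/-- A Banach *-category satisfying a norm inequality that expresses positivity is a
C*-category. -/
def toCStarCat (A : BanachStarCat.{u} 𝕜) (hb : ∀ {x y : A.carrier} (a : x ⟶ y),
      ‖((‖a‖ ^ 2 : ℝ) : 𝕜) • 𝟙 x - a ≫ A.adj a‖ ≤ ‖a‖ ^ 2) : CStarCat.{u} 𝕜 :=
  { A with positivity := positivity_of_norm_sub_le hb }

end BanachStarCat

/-! ### Spectral estimates in C*-categories -/

namespace CStarCat

variable {𝕜 : Type} [RCLike 𝕜]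

/-- The underlying Banach *-category. -/
def toBanach (A : CStarCat.{u} 𝕜) : BanachStarCat.{u} 𝕜 := { A with }

variable {A B : CStarCat.{u} 𝕜}

instance : Preadditive A where
  homGroup x y := (A.normedAddCommGroup x y).toAddCommGroup
  add_comp _ _ _ := A.add_comp
  comp_add _ _ _ := A.comp_add

instance : Linear 𝕜 A where
  homModule x y := (A.normedSpace x y).toModule
  smul_comp _ _ _ := A.smul_comp
  comp_smul _ _ _ := A.comp_smul

lemma adj_id (x : A) : A.adj (𝟙 x) = 𝟙 x := BanachStarCat.adj_id (A := A.toBanach) x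

lemma adj_sub {x y : A} (a b : x ⟶ y) : A.adj (a - b) = A.adj a - A.adj b :=
  BanachStarCat.adj_sub (A := A.toBanach) a b

lemma norm_id_le (x : A) : ‖𝟙 x‖ ≤ 1 := BanachStarCat.norm_id_le (A := A.toBanach) x

lemma norm_adj {x y : A} (a : x ⟶ y) : ‖A.adj a‖ = ‖a‖ :=
  BanachStarCat.norm_adj (A := A.toBanach) a

lemma isIso_sub_smul_id {x : A} {k : 𝕜} (q : x ⟶ x) (hq : ‖q‖ < ‖k‖) :
    IsIso (q - k • 𝟙 x) := BanachStarCat.isIso_smul_id_sub (A := A.toBanach) q hq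

lemma norm_comp_self {x : A} {c : x ⟶ x} (hc : A.adj c = c) : ‖c ≫ c‖ = ‖c‖ ^ 2 := by
  conv_lhs => rw [← hc]
  conv_lhs => rw [hc]
  conv_lhs => arg 1; arg 2; rw [← hc]
  exact A.norm_comp_adj c

/-- The norm of a self-adjoint endomorphism is, up to sign, in its real spectrum. -/
lemma exists_abs_eq_norm_not_isIso {x : A} (hx : 𝟙 x ≠ 0) {c : x ⟶ x} (hc : A.adj c = c) :
    ∃ s : ℝ, |s| = ‖c‖ ∧ ¬ IsIso (c - (s : 𝕜) • 𝟙 x) := by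
  let x' : A.toBanach.carrier := x
  have : Nontrivial (BanachStarCat.EndAlg x') := ⟨1, 0, hx⟩
  let c' : BanachStarCat.EndAlg x' := c
  -- Self-adjointness is carried through the induction, because `‖e²‖ = ‖e‖²` needs it at each
  -- squaring.
  have hpow : ∀ n : ℕ, ∃ e : BanachStarCat.EndAlg x',
      c' ^ (2 ^ n) = e ∧ A.adj (x := x) (y := x) e = e ∧ ‖e‖ = ‖c'‖ ^ (2 ^ n) := by
    intro n
    induction n with
    | zero => exact ⟨c, pow_one c', hc, (pow_one _).symm⟩
    | succ n ih =>
      obtain ⟨e, he, hadj, hnorm⟩ := ih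
      refine ⟨e * e, ?_, ?_, ?_⟩
      · rw [pow_succ 2 n, pow_mul, sq, he]
      · exact (A.adj_comp (x := x) (y := x) (z := x) e e).trans (by rw [hadj]; rfl)
      · refine (norm_comp_self hadj).trans ?_
        rw [pow_succ 2 n, pow_mul]
        exact congrArg (· ^ 2) hnorm
  obtain ⟨s, hs, hu⟩ := exists_abs_eq_norm_not_isUnit (E := BanachStarCat.EndAlg x')
    (norm_id_le x) c' (fun n => by
      obtain ⟨e, he, -, hnorm⟩ := hpow n
      rw [← he] at hnorm; exact hnorm) (fun r t ht => by
      rw [BanachStarCat.EndAlg.algebraMap_real, BanachStarCat.EndAlg.algebraMap_real]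
      refine (BanachStarCat.EndAlg.isUnit_iff x' _).2 ?_
      by_contra hn
      have hadj : A.adj (c - (r : 𝕜) • 𝟙 x) = c - (r : 𝕜) • 𝟙 x := by
        rw [adj_sub, hc, A.adj_smul, adj_id, RCLike.conj_ofReal]
      -- With `e = c - r` self-adjoint, non-invertibility of `e² + t²` would put `-t²` in the
      -- spectrum of `e e*`, against positivity.
      obtain ⟨v, hv, hv'⟩ := A.positivity (c - (r : 𝕜) • 𝟙 x) (-((t ^ 2 : ℝ) : 𝕜)) (by
        rw [hadj, neg_smul, sub_neg_eq_add]
        exact hn)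
      have : v = - t ^ 2 := by
        rw [← RCLike.ofReal_neg] at hv'
        exact RCLike.ofReal_inj.1 hv'
      have := sq_pos_of_ne_zero ht
      linarith)
  refine ⟨s, hs, fun h => hu ?_⟩
  rw [BanachStarCat.EndAlg.algebraMap_real]
  exact (BanachStarCat.EndAlg.isUnit_iff x' _).2 h

/-- Reduces norm estimates to invertibility, which functors preserve. An object with vanishing
identity has no spectral points and is treated apart. -/
lemma norm_le_of_forall_isIso {x : A} {c : x ⟶ x} (hc : A.adj c = c) {r : ℝ} (hr : 0 ≤ r)
    (h : ∀ s : ℝ, r < |s| → IsIso (c - (s : 𝕜) • 𝟙 x)) : ‖c‖ ≤ r := by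
  by_cases hx : 𝟙 x = 0
  · rw [← Category.comp_id c, hx, Limits.comp_zero, norm_zero]
    exact hr
  · obtain ⟨s, hs, hn⟩ := exists_abs_eq_norm_not_isIso hx hc
    rw [← hs]
    exact not_lt.1 fun hlt => hn (h s hlt)

lemma adj_comp_adj {x y : A} (a : x ⟶ y) : A.adj (a ≫ A.adj a) = a ≫ A.adj a := by
  rw [A.adj_comp, A.adj_adj]

/-- If `s` is a real spectral point of `N - d`, with `d = a ≫ A.adj a`, then `N - s` is one of `d`,
hence lies in `[0, ‖a‖²]`, inside `[0, N]`; so `|s| ≤ N`. The freedom to enlarge `N` is used for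
products, where `N` comes from a supremum. -/
lemma norm_smul_id_sub_le {x y : A} (a : x ⟶ y) {N : ℝ} (hN : ‖a‖ ^ 2 ≤ N) :
    ‖(N : 𝕜) • 𝟙 x - a ≫ A.adj a‖ ≤ N := by
  have hN0 : 0 ≤ N := (sq_nonneg _).trans hN
  refine norm_le_of_forall_isIso ?_ hN0 fun s hs => ?_
  · rw [adj_sub, A.adj_smul, adj_id, RCLike.conj_ofReal, adj_comp_adj]
  · have h2 : (N : 𝕜) • 𝟙 x - a ≫ A.adj a - (s : 𝕜) • 𝟙 x =
        (-1 : 𝕜) • (a ≫ A.adj a - ((N - s : ℝ) : 𝕜) • 𝟙 x) := by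
      push_cast
      rw [sub_smul]
      simp
      abel
    rw [h2]
    have : IsIso (a ≫ A.adj a - ((N - s : ℝ) : 𝕜) • 𝟙 x) := by
      by_cases hlt : ‖a‖ ^ 2 < |N - s|
      · refine isIso_sub_smul_id _ ?_
        rwa [A.norm_comp_adj, RCLike.norm_ofReal]
      · by_contra hn
        obtain ⟨r, hr, hr'⟩ := A.positivity _ _ hn
        rw [RCLike.ofReal_inj] at hr'
        rw [not_lt, abs_le] at hlt
        rw [lt_abs] at hs
        rcases hs with hs | hs <;> linarith
    exact BanachStarCat.isIso_smul (A := A.toBanach) (k := (-1 : 𝕜)) (neg_ne_zero.2 one_ne_zero)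
      (a ≫ A.adj a - ((N - s : ℝ) : 𝕜) • 𝟙 x) this

lemma functor_map_zero (F : A ⟶ B) {x y : A} : (functor F).map (0 : x ⟶ y) = 0 := by
  have := StarFunctor.map_smul F (0 : 𝕜) (0 : x ⟶ y)
  rwa [zero_smul, zero_smul] at this

lemma functor_map_sub (F : A ⟶ B) {x y : A} (a b : x ⟶ y) :
    (functor F).map (a - b) = (functor F).map a - (functor F).map b :=
  (AddMonoidHom.mk' (fun a : x ⟶ y => (functor F).map a) (StarFunctor.map_add F)).map_sub a b

lemma functor_map_sub_smul_id (F : A ⟶ B) {x : A} (c : x ⟶ x) (k : 𝕜) :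
    (functor F).map (c - k • 𝟙 x) = (functor F).map c - k • 𝟙 _ := by
  rw [functor_map_sub, StarFunctor.map_smul, (functor F).map_id]

/-- *-functors are contractive. -/
lemma norm_map_le (F : A ⟶ B) {x y : A} (a : x ⟶ y) : ‖(functor F).map a‖ ≤ ‖a‖ := by
  refine le_of_sq_le_sq ?_ (norm_nonneg _)
  rw [← B.norm_comp_adj, ← StarFunctor.map_adj, ← (functor F).map_comp]
  refine norm_le_of_forall_isIso ?_ (sq_nonneg _) fun s hs => ?_
  · rw [← StarFunctor.map_adj, adj_comp_adj]
  · rw [← functor_map_sub_smul_id]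
    -- Invertibility beyond the norm comes from the Neumann series in the source and is preserved by
    -- `F`.
    have : IsIso (a ≫ A.adj a - (s : 𝕜) • 𝟙 x) :=
      isIso_sub_smul_id _ (by rwa [A.norm_comp_adj, RCLike.norm_ofReal])
    infer_instance

/-- Fully faithful *-functors are isometric. -/
lemma norm_map_of_fullyFaithful (F : A ⟶ B) [(functor F).Full] [(functor F).Faithful] {x y : A}
    (a : x ⟶ y) : ‖(functor F).map a‖ = ‖a‖ := by
  refine le_antisymm (norm_map_le F a) (le_of_sq_le_sq ?_ (norm_nonneg _))
  rw [← A.norm_comp_adj, ← B.norm_comp_adj]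
  refine norm_le_of_forall_isIso (adj_comp_adj a) (norm_nonneg _) fun s hs => ?_
  rw [← StarFunctor.map_adj, ← (functor F).map_comp] at hs
  -- Now the Neumann series is used in the target, and full faithfulness reflects invertibility
  -- back.
  have : IsIso ((functor F).map (a ≫ A.adj a - (s : 𝕜) • 𝟙 x)) := by
    rw [functor_map_sub_smul_id]
    exact isIso_sub_smul_id _ (by rwa [RCLike.norm_ofReal])
  exact isIso_of_reflects_iso _ (functor F)

end CStarCat

/-! ### Constructions of C*-categories: pullback of objects, closed subspaces, products, limits -/

namespace CStarCat

variable {𝕜 : Type} [RCLike 𝕜] {A B C : CStarCat.{u} 𝕜}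

/-- The Banach *-category underlying `CStarCat.pull`. -/
def pullBanach (A : CStarCat.{u} 𝕜) {X : Type u} (o : X → A) : BanachStarCat.{u} 𝕜 where
  carrier := X
  category :=
    { Hom := fun x y => o x ⟶ o y
      id := fun x => 𝟙 (o x)
      comp := fun a b => a ≫ b
      id_comp := fun a => Category.id_comp a
      comp_id := fun a => Category.comp_id a
      assoc := fun a b c => Category.assoc a b c }
  normedAddCommGroup x y := A.normedAddCommGroup (o x) (o y)
  normedSpace x y := A.normedSpace (o x) (o y)
  completeSpace x y := A.completeSpace (o x) (o y)
  add_comp := A.add_comp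
  comp_add := A.comp_add
  smul_comp := A.smul_comp
  comp_smul := A.comp_smul
  norm_comp_le := A.norm_comp_le
  adj := A.adj
  adj_add := A.adj_add
  adj_smul := A.adj_smul
  adj_comp := A.adj_comp
  adj_adj := A.adj_adj
  norm_comp_adj := A.norm_comp_adj

/-- The C*-category with prescribed objects `X` and homs those of `A` between the images of the
objects under `o`. -/
def pull (A : CStarCat.{u} 𝕜) {X : Type u} (o : X → A) : CStarCat.{u} 𝕜 :=
  (A.pullBanach o).toCStarCat fun {x y} a =>
    norm_smul_id_sub_le (A := A) (x := o x) (y := o y) a le_rfl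

/-- The forgetful fully faithful *-functor. -/
def pullForget (A : CStarCat.{u} 𝕜) {X : Type u} (o : X → A) : A.pull o ⟶ A :=
  show StarFunctor (A.pull o) A from
  { obj := o
    map := fun a => a
    map_id := fun _ => rfl
    map_comp := fun _ _ => rfl
    map_add := fun _ _ => rfl
    map_smul := fun _ _ => rfl
    map_adj := fun _ => rfl }

/-- A family of closed subspaces of homs, closed under the operations of a C*-category. -/
structure ClosedSub (A : CStarCat.{u} 𝕜) {X : Type u} (o : X → A) where
  /-- The subspaces. -/
  hom (x y : X) : Submodule 𝕜 (o x ⟶ o y)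
  isClosed (x y : X) : IsClosed (hom x y : Set (o x ⟶ o y))
  id_mem (x : X) : 𝟙 (o x) ∈ hom x x
  comp_mem {x y z : X} {a : o x ⟶ o y} {b : o y ⟶ o z} :
    a ∈ hom x y → b ∈ hom y z → a ≫ b ∈ hom x z
  adj_mem {x y : X} {a : o x ⟶ o y} : a ∈ hom x y → A.adj a ∈ hom y x

namespace ClosedSub

variable {X : Type u} {o : X → A} (S : ClosedSub A o)

/-- The Banach *-category on a closed family of subspaces. -/
def toBanachStarCat : BanachStarCat.{u} 𝕜 where
  carrier := X
  category :=
    { Hom := fun x y => S.hom x y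
      id := fun x => ⟨𝟙 (o x), S.id_mem x⟩
      comp := fun a b => ⟨a.1 ≫ b.1, S.comp_mem a.2 b.2⟩
      id_comp := fun a => Subtype.ext (Category.id_comp a.1)
      comp_id := fun a => Subtype.ext (Category.comp_id a.1)
      assoc := fun a b c => Subtype.ext (Category.assoc a.1 b.1 c.1) }
  normedAddCommGroup x y := inferInstanceAs (NormedAddCommGroup (S.hom x y))
  normedSpace x y := inferInstanceAs (NormedSpace 𝕜 (S.hom x y))
  completeSpace x y := (S.isClosed x y).completeSpace_coe
  add_comp a b c := Subtype.ext (A.add_comp a.1 b.1 c.1)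
  comp_add a b c := Subtype.ext (A.comp_add a.1 b.1 c.1)
  smul_comp k a b := Subtype.ext (A.smul_comp k a.1 b.1)
  comp_smul a k b := Subtype.ext (A.comp_smul a.1 k b.1)
  norm_comp_le a b := A.norm_comp_le a.1 b.1
  adj a := ⟨A.adj a.1, S.adj_mem a.2⟩
  adj_add a b := Subtype.ext (A.adj_add a.1 b.1)
  adj_smul k a := Subtype.ext (A.adj_smul k a.1)
  adj_comp a b := Subtype.ext (A.adj_comp a.1 b.1)
  adj_adj a := Subtype.ext (A.adj_adj a.1)
  norm_comp_adj a := A.norm_comp_adj a.1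

/-- The C*-category on a closed family of subspaces. -/
def toCStarCat : CStarCat.{u} 𝕜 :=
  -- The norm inequality is inherited from `A` at once, whereas an inverse found in `A` would still
  -- have to be shown to lie in the subspace.
  S.toBanachStarCat.toCStarCat fun a => norm_smul_id_sub_le (A := A)
    (show o _ ⟶ o _ from Subtype.val (p := fun b => b ∈ S.hom _ _) a) le_rfl

/-- The inclusion of a closed family of subspaces. -/
def incl : S.toCStarCat ⟶ A :=
  show StarFunctor S.toCStarCat A from
  { obj := o
    map := fun {x y} a => Subtype.val (p := fun b => b ∈ S.hom x y) a
    map_id := fun _ => rfl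
    map_comp := fun _ _ => rfl
    map_add := fun _ _ => rfl
    map_smul := fun _ _ => rfl
    map_adj := fun _ => rfl }

/-- Factor a *-functor through a closed family of subspaces. -/
def lift (F : B ⟶ A) (l : B → X) (hl : ∀ b, o (l b) = (functor F).obj b)
    (h : ∀ {x y : B} (a : x ⟶ y), eqToHom (hl x) ≫ (functor F).map a ≫ eqToHom (hl y).symm ∈
      S.hom (l x) (l y)) : B ⟶ S.toCStarCat :=
  show StarFunctor B S.toCStarCat from
  { obj := l
    map := fun a => ⟨_, h a⟩
    map_id := fun x => Subtype.ext (show _ = 𝟙 (o (l x)) by simp)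
    map_comp := fun a b => Subtype.ext (show _ = (_ ≫ _ ≫ _) ≫ (_ ≫ _ ≫ _) by simp)
    map_add := fun a b => Subtype.ext (show eqToHom _ ≫ (functor F).map (a + b) ≫ eqToHom _ =
        (_ ≫ _ ≫ _) + (_ ≫ _ ≫ _) by
      rw [StarFunctor.map_add, A.add_comp, A.comp_add])
    map_smul := fun k a => Subtype.ext (show eqToHom _ ≫ (functor F).map (k • a) ≫ eqToHom _ =
        k • (_ ≫ _ ≫ _) by
      rw [StarFunctor.map_smul, A.smul_comp, A.comp_smul])
    map_adj := fun {x y} a => Subtype.ext (show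
        eqToHom _ ≫ (functor F).map (B.adj a) ≫ eqToHom _ = A.adj (_ ≫ _ ≫ _) by
      rw [A.adj_comp, A.adj_comp, StarFunctor.map_adj]
      have key : ∀ {x y : A} (h : x = y), A.adj (eqToHom h) = eqToHom h.symm := by
        rintro x _ rfl; exact adj_id x
      rw [key, key, Category.assoc]) }

end ClosedSub

/-! ### Products -/

section Pi

variable {ι : Type u} (A : ι → CStarCat.{u} 𝕜)

/-- Bounded families of arrows. -/
abbrev PiHom (x y : ∀ i, A i) : Type u := lp (fun i => x i ⟶ y i) ⊤

variable {A}

/-- Construct a bounded family of arrows. -/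
def PiHom.mk {x y : ∀ i, A i} (a : ∀ i, x i ⟶ y i) (r : ℝ) (h : ∀ i, ‖a i‖ ≤ r) : PiHom A x y :=
  ⟨a, memℓp_infty ⟨r, by rintro _ ⟨i, rfl⟩; exact h i⟩⟩

lemma PiHom.norm_apply_le {x y : ∀ i, A i} (a : PiHom A x y) (i : ι) : ‖a i‖ ≤ ‖a‖ :=
  lp.norm_apply_le_norm ENNReal.top_ne_zero a i

lemma PiHom.norm_le {x y : ∀ i, A i} (a : PiHom A x y) {r : ℝ} (hr : 0 ≤ r) (h : ∀ i, ‖a i‖ ≤ r) :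
    ‖a‖ ≤ r := lp.norm_le_of_forall_le hr h

lemma PiHom.ext {x y : ∀ i, A i} {a b : PiHom A x y} (h : ∀ i, a i = b i) : a = b :=
  Subtype.ext (funext h)

/-- The componentwise adjoint. -/
noncomputable def PiHom.adj {x y : ∀ i, A i} (a : PiHom A x y) : PiHom A y x :=
  PiHom.mk (fun i => (A i).adj (a i)) ‖a‖ fun i =>
    (norm_adj (a i)).trans_le (PiHom.norm_apply_le a i)

/-- The componentwise composition. -/
noncomputable def PiHom.comp {x y z : ∀ i, A i} (a : PiHom A x y) (b : PiHom A y z) : PiHom A x z :=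
  PiHom.mk (fun i => a i ≫ b i) (‖a‖ * ‖b‖) fun i =>
        ((A i).norm_comp_le _ _).trans (mul_le_mul (PiHom.norm_apply_le a i)
          (PiHom.norm_apply_le b i) (norm_nonneg _) (norm_nonneg _))

/-- Squaring is monotone on nonnegative reals, so the supremum of the squares of the component norms
is the square of their supremum. -/
lemma PiHom.norm_comp_adj {x y : ∀ i, A i} (a : PiHom A x y) : ‖a.comp a.adj‖ = ‖a‖ ^ 2 := by
  refine le_antisymm (PiHom.norm_le _ (sq_nonneg _) fun i => ?_) ?_
  · exact ((A i).norm_comp_adj (a i)).trans_le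
      (pow_le_pow_left₀ (norm_nonneg _) (PiHom.norm_apply_le a i) 2)
  · rw [← Real.le_sqrt (norm_nonneg _) (norm_nonneg _)]
    refine PiHom.norm_le _ (Real.sqrt_nonneg _) fun i => ?_
    refine Real.le_sqrt_of_sq_le ?_
    rw [← (A i).norm_comp_adj]
    exact PiHom.norm_apply_le (a.comp a.adj) i

variable (A)

/-- The product of a family of C*-categories as a Banach *-category. -/
noncomputable def piBanach : BanachStarCat.{u} 𝕜 where
  carrier := ∀ i, A i
  category :=
    { Hom := fun x y => PiHom A x y
      id := fun x => PiHom.mk (fun i => 𝟙 (x i)) 1 fun i => norm_id_le (x i)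
      comp := fun a b => PiHom.comp a b
      id_comp := fun a => PiHom.ext fun i => Category.id_comp (a i)
      comp_id := fun a => PiHom.ext fun i => Category.comp_id (a i)
      assoc := fun a b c => PiHom.ext fun i => Category.assoc (a i) (b i) (c i) }
  normedAddCommGroup x y := (inferInstance : NormedAddCommGroup (PiHom A x y))
  normedSpace x y := (inferInstance : NormedSpace 𝕜 (PiHom A x y))
  completeSpace x y := (inferInstance : CompleteSpace (PiHom A x y))
  add_comp a b c := PiHom.ext fun i => (A i).add_comp (a.1 i) (b.1 i) (c.1 i)
  comp_add a b c := PiHom.ext fun i => (A i).comp_add (a.1 i) (b.1 i) (c.1 i)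
  smul_comp k a b := PiHom.ext fun i => (A i).smul_comp k (a.1 i) (b.1 i)
  comp_smul a k b := PiHom.ext fun i => (A i).comp_smul (a.1 i) k (b.1 i)
  norm_comp_le a b := PiHom.norm_le (A := A) _
      (mul_nonneg (norm_nonneg (show PiHom A _ _ from a)) (norm_nonneg (show PiHom A _ _ from b)))
      fun i =>
        ((A i).norm_comp_le _ _).trans (mul_le_mul (PiHom.norm_apply_le a i)
          (PiHom.norm_apply_le b i) (norm_nonneg _) (norm_nonneg (show PiHom A _ _ from a)))
  adj a := PiHom.adj a
  adj_add a b := PiHom.ext fun i => (A i).adj_add (a.1 i) (b.1 i)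
  adj_smul k a := PiHom.ext fun i => (A i).adj_smul k (a.1 i)
  adj_comp a b := PiHom.ext fun i => (A i).adj_comp (a.1 i) (b.1 i)
  adj_adj a := PiHom.ext fun i => (A i).adj_adj (a.1 i)
  norm_comp_adj a := PiHom.norm_comp_adj a

/-- The product of a family of C*-categories. -/
noncomputable def pi : CStarCat.{u} 𝕜 :=
  (piBanach A).toCStarCat fun {x y} a => by
    refine PiHom.norm_le (A := A) (x := x) (y := x) _ (sq_nonneg _) fun i => ?_
    -- The scalar `‖a‖ ^ 2` belongs to the whole family and only dominates the squared norm of the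
    -- component.
    exact norm_smul_id_sub_le (A := A i) (Subtype.val (show PiHom A x y from a) i)
      (pow_le_pow_left₀ (norm_nonneg _) (PiHom.norm_apply_le (A := A) a i) 2)

/-- The projections from a product. -/
def piProj (i : ι) : pi A ⟶ A i :=
  show StarFunctor (pi A) (A i) from
  { obj := fun x => x i
    map := fun {x y} a => Subtype.val (show PiHom A x y from a) i
    map_id := fun _ => rfl
    map_comp := fun _ _ => rfl
    map_add := fun _ _ => rfl
    map_smul := fun _ _ => rfl
    map_adj := fun _ => rfl }

variable {A}

lemma pi_hom_ext {x y : pi A} {a b : x ⟶ y}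
    (h : ∀ i, (functor (piProj A i)).map a = (functor (piProj A i)).map b) : a = b :=
  PiHom.ext h

lemma pi_norm_le {x y : pi A} (a : x ⟶ y) {r : ℝ} (hr : 0 ≤ r)
    (h : ∀ i, ‖(functor (piProj A i)).map a‖ ≤ r) : ‖a‖ ≤ r := PiHom.norm_le _ hr h

/-- The *-functor to a product with given components. -/
def piLift (F : ∀ i, B ⟶ A i) : B ⟶ pi A :=
  show StarFunctor B (pi A) from
  { obj := fun x i => (functor (F i)).obj x
    map := fun a => PiHom.mk (fun i => (functor (F i)).map a) ‖a‖ fun _ => norm_map_le _ _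
    map_id := fun _ => PiHom.ext fun i => (functor (F i)).map_id _
    map_comp := fun _ _ => PiHom.ext fun i => (functor (F i)).map_comp _ _
    map_add := fun _ _ => PiHom.ext fun i => StarFunctor.map_add (F i) _ _
    map_smul := fun _ _ => PiHom.ext fun i => StarFunctor.map_smul (F i) _ _
    map_adj := fun _ => PiHom.ext fun i => StarFunctor.map_adj (F i) _ }

end Pi

/-! ### Equality of arrows with different endpoints -/

/-- Equality of `Arrow.mk` serves throughout as equality of arrows whose endpoints agree only
propositionally; this returns to plain equality once the endpoints coincide. -/
lemma arrow_mk_eq_iff {D : Type*} [Category D] {x y : D} (a b : x ⟶ y) :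
    Arrow.mk a = Arrow.mk b ↔ a = b := by
  refine ⟨fun h => ?_, fun h => h ▸ rfl⟩
  have := Arrow.mk_inj x y (f := a) (g := b)
  exact this.1 h

lemma arrow_mk_conj_eqToHom {D : Type*} [Category D] {x y x' y' : D} (hx : x' = x) (hy : y = y')
    (a : x ⟶ y) : Arrow.mk (eqToHom hx ≫ a ≫ eqToHom hy) = Arrow.mk a := by
  subst hx hy; simp

lemma eq_conj_eqToHom_iff {D : Type*} [Category D] {x y x' y' : D} (hx : x' = x) (hy : y = y')
    (a : x ⟶ y) (b : x' ⟶ y') : b = eqToHom hx ≫ a ≫ eqToHom hy ↔ Arrow.mk b = Arrow.mk a := by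
  rw [← arrow_mk_eq_iff, arrow_mk_conj_eqToHom]

lemma hom_ext {F G : A ⟶ B} (h : ∀ {x y : A} (a : x ⟶ y),
    Arrow.mk ((functor F).map a) = Arrow.mk ((functor G).map a)) : F = G := by
  refine StarFunctor.ext ?_ ?_
  · exact funext fun x => congrArg Comma.left (h (𝟙 x))
  · refine Function.hfunext rfl fun x x' hx => ?_
    cases hx
    refine Function.hfunext rfl fun y y' hy => ?_
    cases hy
    refine Function.hfunext rfl fun a a' ha => ?_
    cases ha
    have h2 : ∀ {p q p' q' : B} (a : p ⟶ q) (b : p' ⟶ q'), Arrow.mk a = Arrow.mk b → HEq a b := by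
      rintro p q p' q' a b hab
      cases hab
      rfl
    exact h2 _ _ (h a)

lemma arrow_mk_map_congr {F G : A ⟶ B} (h : F = G) {x y : A} (a : x ⟶ y) :
    Arrow.mk ((functor F).map a) = Arrow.mk ((functor G).map a) := by rw [h]

lemma map_arrow_congr (F : A ⟶ B) {x y x' y' : A} {a : x ⟶ y} {b : x' ⟶ y'}
    (h : Arrow.mk a = Arrow.mk b) :
    Arrow.mk ((functor F).map a) = Arrow.mk ((functor F).map b) := by
  cases h; rfl

lemma obj_congr {F G : A ⟶ B} (h : F = G) (x : A) : (functor F).obj x = (functor G).obj x := by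
  rw [h]

lemma continuous_map (F : A ⟶ B) (x y : A) :
    Continuous fun a : x ⟶ y => (functor F).map a :=
  (AddMonoidHomClass.continuous_of_bound
    (AddMonoidHom.mk' (fun a : x ⟶ y => (functor F).map a) (StarFunctor.map_add F)) 1
    fun a => by rw [one_mul]; exact norm_map_le F a)

lemma continuous_comp (x y z : A) : Continuous fun p : (x ⟶ y) × (y ⟶ z) => p.1 ≫ p.2 := by
  let f : (x ⟶ y) →ₗ[𝕜] (y ⟶ z) →ₗ[𝕜] (x ⟶ z) := LinearMap.mk₂ 𝕜 (fun a b => a ≫ b)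
    (fun a b c => A.add_comp a b c) (fun k a b => A.smul_comp k a b)
    (fun a b c => A.comp_add a b c) (fun k a b => A.comp_smul a k b)
  exact (f.mkContinuous₂ 1 fun a b => by
    rw [one_mul]; exact A.norm_comp_le a b).continuous₂

lemma continuous_adj (x y : A) : Continuous fun a : x ⟶ y => A.adj a :=
  (AddMonoidHomClass.continuous_of_bound (AddMonoidHom.mk' (fun a : x ⟶ y => A.adj a) A.adj_add) 1
    fun a => by rw [one_mul]; exact (norm_adj a).le)

lemma adj_eqToHom {x y : A} (h : x = y) : A.adj (eqToHom h) = eqToHom h.symm := by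
  subst h; exact adj_id x

/-! ### Limits -/

section Limits

variable {J : Type u} [SmallCategory J] (F : J ⥤ CStarCat.{u} 𝕜)

/-- The objects of the limit. -/
def LimObj : Type u :=
  {x : pi F.obj // ∀ {j j' : J} (f : j ⟶ j'),
    (functor (F.map f)).obj ((functor (piProj F.obj j)).obj x) = (functor (piProj F.obj j')).obj x}

/-- Two parallel functors out of a product, up to a prescribed identification of the values on
objects, agree on a closed subspace. -/
def equalizerSub {P : CStarCat.{u} 𝕜} (G H : P ⟶ B) (x y : P)
    (hx : (functor G).obj x = (functor H).obj x) (hy : (functor G).obj y = (functor H).obj y) :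
    Submodule 𝕜 (x ⟶ y) where
  carrier := {a | (functor G).map a = eqToHom hx ≫ (functor H).map a ≫ eqToHom hy.symm}
  add_mem' {a b} ha hb := by
    simp only [Set.mem_ofPred_eq] at ha hb ⊢
    rw [StarFunctor.map_add, StarFunctor.map_add, ha, hb, B.add_comp, B.comp_add]
  zero_mem' := by
    simp only [Set.mem_ofPred_eq]
    rw [functor_map_zero, functor_map_zero, Limits.zero_comp, Limits.comp_zero]
  smul_mem' k a ha := by
    simp only [Set.mem_ofPred_eq] at ha ⊢
    rw [StarFunctor.map_smul, StarFunctor.map_smul, ha, B.smul_comp, B.comp_smul]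

lemma mem_equalizerSub_iff {P : CStarCat.{u} 𝕜} {G H : P ⟶ B} {x y : P}
    {hx : (functor G).obj x = (functor H).obj x} {hy : (functor G).obj y = (functor H).obj y}
    {a : x ⟶ y} : a ∈ equalizerSub G H x y hx hy ↔
      Arrow.mk ((functor G).map a) = Arrow.mk ((functor H).map a) :=
  eq_conj_eqToHom_iff _ _ _ _

lemma isClosed_equalizerSub {P : CStarCat.{u} 𝕜} (G H : P ⟶ B) (x y : P)
    (hx : (functor G).obj x = (functor H).obj x) (hy : (functor G).obj y = (functor H).obj y) :
    IsClosed (equalizerSub G H x y hx hy : Set (x ⟶ y)) :=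
  isClosed_eq (continuous_map G x y) ((continuous_comp _ _ _).comp (continuous_const.prodMk
      ((continuous_comp _ _ _).comp ((continuous_map H x y).prodMk continuous_const))))

/-- The limit of a diagram of C*-categories as a family of closed subspaces of the product. -/
noncomputable def limSub :
    ClosedSub (pi F.obj) (X := LimObj F) Subtype.val where
  hom x y := ⨅ (j : J) (j' : J) (f : j ⟶ j'),
    equalizerSub (piProj F.obj j ≫ F.map f) (piProj F.obj j') x.1 y.1 (x.2 f) (y.2 f)
  isClosed x y := by
    simp only [Submodule.coe_iInf]
    exact isClosed_iInter fun j => isClosed_iInter fun j' => isClosed_iInter fun f =>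
      isClosed_equalizerSub _ _ _ _ _ _
  id_mem x := by
    simp only [Submodule.mem_iInf]
    intro j j' f
    refine (((functor (piProj F.obj j ≫ F.map f))).map_id _).trans ?_
    rw [(functor (piProj F.obj j')).map_id, Category.id_comp, eqToHom_trans, eqToHom_refl]
  comp_mem {x y z a b} ha hb := by
    simp only [Submodule.mem_iInf] at ha hb ⊢
    intro j j' f
    refine ((functor (piProj F.obj j ≫ F.map f)).map_comp _ _).trans ?_
    rw [ha j j' f, hb j j' f, (functor (piProj F.obj j')).map_comp]
    simp
  adj_mem {x y a} ha := by
    simp only [Submodule.mem_iInf] at ha ⊢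
    intro j j' f
    refine (StarFunctor.map_adj (piProj F.obj j ≫ F.map f) _).trans ?_
    rw [ha j j' f, CStarCat.adj_comp, CStarCat.adj_comp, adj_eqToHom, adj_eqToHom, Category.assoc,
      StarFunctor.map_adj]

lemma mem_limSub_iff {x y : LimObj F} {a : x.1 ⟶ y.1} :
    a ∈ (limSub F).hom x y ↔ ∀ {j j' : J} (f : j ⟶ j'),
      Arrow.mk ((functor (piProj F.obj j ≫ F.map f)).map a) =
        Arrow.mk ((functor (piProj F.obj j')).map a) := by
  simp only [limSub, Submodule.mem_iInf, mem_equalizerSub_iff]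

/-- The limit projections. -/
noncomputable def limProj (j : J) : (limSub F).toCStarCat ⟶ F.obj j :=
  (limSub F).incl ≫ piProj F.obj j

/-- The limit cone of a diagram of C*-categories. -/
noncomputable def limCone : Cone F where
  pt := (limSub F).toCStarCat
  π :=
    { app := limProj F
      naturality := fun j j' f => by
        refine (Category.id_comp _).trans (hom_ext fun {x y} a => ?_)
        exact ((mem_limSub_iff F).1 (Subtype.property (p := fun b => b ∈ (limSub F).hom x y) a)
          f).symm }

lemma limCone_hom_ext {m m' : B ⟶ (limSub F).toCStarCat}
    (h : ∀ j, m ≫ limProj F j = m' ≫ limProj F j) : m = m' := by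
  have hobj : ∀ x, (functor m).obj x = (functor m').obj x := fun x =>
    Subtype.ext (funext fun j => obj_congr (h j) x)
  -- The endpoints are made variables so that their equality can be substituted before the arrows
  -- are compared componentwise.
  have key : ∀ {p q p' q' : (limSub F).toCStarCat} (a : p ⟶ q) (b : p' ⟶ q'), p = p' → q = q' →
      (∀ j, Arrow.mk ((functor (limProj F j)).map a) = Arrow.mk ((functor (limProj F j)).map b)) →
      Arrow.mk a = Arrow.mk b := by
    rintro p q p' q' a b rfl rfl hab
    rw [arrow_mk_eq_iff]
    exact Subtype.ext (PiHom.ext fun j => (arrow_mk_eq_iff _ _).1 (hab j))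
  exact hom_ext fun a => key _ _ (hobj _) (hobj _) fun j => arrow_mk_map_congr (h j) a

/-- The *-functor to the limit induced by a cone. -/
noncomputable def limLift (s : Cone F) : s.pt ⟶ (limSub F).toCStarCat :=
  (limSub F).lift (piLift s.π.app)
    (fun b => ⟨(functor (piLift s.π.app)).obj b, fun f => obj_congr (s.w f) b⟩)
    (fun _ => rfl) fun {x y} a => by
      refine (mem_limSub_iff F).2 fun {j j'} f => ?_
      exact (map_arrow_congr _ (arrow_mk_conj_eqToHom _ _ _)).trans
        ((arrow_mk_map_congr (s.w f) a).trans
          (map_arrow_congr (piProj F.obj j') (arrow_mk_conj_eqToHom (D := pi F.obj) rfl rfl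
            ((functor (piLift s.π.app)).map a))).symm)

lemma limLift_limProj (s : Cone F) (j : J) : limLift F s ≫ limProj F j = s.π.app j := by
  refine hom_ext fun {x y} a => ?_
  exact (map_arrow_congr (piProj F.obj j) (arrow_mk_conj_eqToHom (D := pi F.obj) rfl rfl
    ((functor (piLift s.π.app)).map a)))

/-- The limit cone is a limit. -/
noncomputable def limConeIsLimit : IsLimit (limCone F) where
  lift := limLift F
  fac := limLift_limProj F
  uniq s _ hm := limCone_hom_ext F fun j => (hm j).trans (limLift_limProj F s j).symm

end Limits

instance : HasLimitsOfSize.{u, u} (CStarCat.{u} 𝕜) where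
  has_limits_of_shape _ _ := { has_limit := fun F => ⟨⟨⟨_, limConeIsLimit F⟩⟩⟩ }

end CStarCat

namespace CStarCat

variable {𝕜 : Type} [RCLike 𝕜] {A B C : CStarCat.{u} 𝕜}

/-! ### Presentations by generators and relations -/

/-- Formal expressions in generators `g` with prescribed endpoints. -/
inductive Term (𝕜 : Type) {X : Type u} (g : X → X → Type u) : X → X → Type u
  | of {x y : X} (e : g x y) : Term 𝕜 g x y
  | id (x : X) : Term 𝕜 g x x
  | zero (x y : X) : Term 𝕜 g x y
  | add {x y : X} (s t : Term 𝕜 g x y) : Term 𝕜 g x y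
  | smul {x y : X} (k : 𝕜) (t : Term 𝕜 g x y) : Term 𝕜 g x y
  | comp {x y z : X} (s : Term 𝕜 g x y) (t : Term 𝕜 g y z) : Term 𝕜 g x z
  | adj {x y : X} (t : Term 𝕜 g x y) : Term 𝕜 g y x

variable {X : Type u} {g : X → X → Type u}

/-- An interpretation of generators in a C*-category. -/
structure Rep (𝕜 : Type) [RCLike 𝕜] {X : Type u} (g : X → X → Type u) : Type (u + 1) where
  /-- The target of the interpretation. -/
  cat : CStarCat.{u} 𝕜
  /-- The interpretation of objects. -/
  obj : X → cat
  /-- The interpretation of generators. -/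
  map {x y : X} (e : g x y) : obj x ⟶ obj y

namespace Rep

/-- The value of a formal expression. -/
def eval (ρ : Rep 𝕜 g) : ∀ {x y : X}, Term 𝕜 g x y → (ρ.obj x ⟶ ρ.obj y)
  | _, _, .of e => ρ.map e
  | _, _, .id x => 𝟙 (ρ.obj x)
  | _, _, .zero _ _ => 0
  | _, _, .add s t => ρ.eval s + ρ.eval t
  | _, _, .smul k t => k • ρ.eval t
  | _, _, .comp s t => ρ.eval s ≫ ρ.eval t
  | _, _, .adj t => ρ.cat.adj (ρ.eval t)

/-- Postcomposition of an interpretation with a *-functor. -/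
def push (ρ : Rep 𝕜 g) (F : ρ.cat ⟶ B) : Rep 𝕜 g where
  cat := B
  obj x := (functor F).obj (ρ.obj x)
  map e := (functor F).map (ρ.map e)

lemma eval_push (ρ : Rep 𝕜 g) (F : ρ.cat ⟶ B) {x y : X} (t : Term 𝕜 g x y) :
    (ρ.push F).eval t = (functor F).map (ρ.eval t) := by
  induction t with
  | of e => rfl
  | id x => exact ((functor F).map_id _).symm
  | zero x y => exact (functor_map_zero F).symm
  | add s t hs ht => exact (congrArg₂ (· + ·) hs ht).trans (StarFunctor.map_add F _ _).symm
  | smul k t ht => exact (congrArg (k • ·) ht).trans (StarFunctor.map_smul F _ _).symm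
  | comp s t hs ht => exact (congrArg₂ (· ≫ ·) hs ht).trans ((functor F).map_comp _ _).symm
  | adj t ht => exact (congrArg B.adj ht).trans (StarFunctor.map_adj F _).symm

lemma arrow_mk_eval_congr {o o' : X → B} {m : ∀ {x y : X}, g x y → (o x ⟶ o y)}
    {m' : ∀ {x y : X}, g x y → (o' x ⟶ o' y)} (ho : ∀ x, o x = o' x)
    (hm : ∀ {x y : X} (e : g x y), Arrow.mk (m e) = Arrow.mk (m' e)) {x y : X}
    (t : Term 𝕜 g x y) :
    Arrow.mk ((Rep.mk B o m).eval t) = Arrow.mk ((Rep.mk B o' m').eval t) := by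
  obtain rfl : o = o' := funext ho
  obtain rfl : @m = @m' :=
    funext fun x => funext fun y => funext fun e => (arrow_mk_eq_iff _ _).1 (hm e)
  rfl

/-- The subspace of values of formal expressions. -/
def range (ρ : Rep 𝕜 g) (x y : X) : Submodule 𝕜 (ρ.obj x ⟶ ρ.obj y) where
  carrier := Set.range fun t : Term 𝕜 g x y => ρ.eval t
  add_mem' := by
    rintro _ _ ⟨s, rfl⟩ ⟨t, rfl⟩
    exact ⟨.add s t, rfl⟩
  zero_mem' := ⟨.zero x y, rfl⟩
  smul_mem' := by
    rintro k _ ⟨t, rfl⟩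
    exact ⟨.smul k t, rfl⟩

/-- The closed family of subspaces generated by an interpretation. -/
def gen (ρ : Rep 𝕜 g) : ClosedSub ρ.cat ρ.obj where
  hom x y := (ρ.range x y).topologicalClosure
  isClosed x y := Submodule.isClosed_topologicalClosure _
  id_mem x := subset_closure ⟨.id x, rfl⟩
  comp_mem ha hb := map_mem_closure₂ (continuous_comp _ _ _) ha hb (by
    rintro _ ⟨s, rfl⟩ _ ⟨t, rfl⟩
    exact ⟨.comp s t, rfl⟩)
  adj_mem ha := map_mem_closure (continuous_adj _ _) ha (by
    rintro _ ⟨t, rfl⟩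
    exact ⟨.adj t, rfl⟩)

/-- An interpretation takes values in the C*-category that it generates. -/
def toGen (ρ : Rep 𝕜 g) : Rep 𝕜 g where
  cat := ρ.gen.toCStarCat
  obj x := x
  map e := ⟨ρ.map e, subset_closure ⟨.of e, rfl⟩⟩

lemma map_incl_eval_toGen (ρ : Rep 𝕜 g) {x y : X} (t : Term 𝕜 g x y) :
    (functor ρ.gen.incl).map (ρ.toGen.eval t) = ρ.eval t :=
  (ρ.toGen.eval_push ρ.gen.incl t).symm

lemma gen_hom_ext (ρ : Rep 𝕜 g) {x y : ρ.toGen.cat} {a b : x ⟶ y}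
    (h : (functor ρ.gen.incl).map a = (functor ρ.gen.incl).map b) : a = b := Subtype.ext h

lemma exists_tendsto_eval_toGen (ρ : Rep 𝕜 g) {x y : X} (a : ρ.toGen.obj x ⟶ ρ.toGen.obj y) :
    ∃ t : ℕ → Term 𝕜 g x y,
      Filter.Tendsto (fun n => ρ.toGen.eval (t n)) Filter.atTop (nhds a) := by
  obtain ⟨s, hs, hlim⟩ := mem_closure_iff_seq_limit (X := ρ.obj x ⟶ ρ.obj y).1
    (Subtype.property (p := fun b => b ∈ ρ.gen.hom x y) a)
  choose t ht using hs
  refine ⟨t, tendsto_subtype_rng.2 (hlim.congr fun n => ?_)⟩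
  exact (ht n).symm.trans (ρ.map_incl_eval_toGen (t n)).symm

/-- Two *-functors out of the C*-category generated by an interpretation are equal if they agree
on generators. -/
lemma toGen_hom_ext (ρ : Rep 𝕜 g) {F G : ρ.toGen.cat ⟶ B}
    (hobj : ∀ x, (functor F).obj (ρ.toGen.obj x) = (functor G).obj (ρ.toGen.obj x))
    (hmap : ∀ {x y : X} (e : g x y), Arrow.mk ((functor F).map (ρ.toGen.map e)) =
      Arrow.mk ((functor G).map (ρ.toGen.map e))) : F = G := by
  refine hom_ext fun {x y} a => ?_
  refine mem_equalizerSub_iff (hx := hobj x) (hy := hobj y) |>.1 ?_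
  obtain ⟨t, ht⟩ := ρ.exists_tendsto_eval_toGen a
  refine (isClosed_equalizerSub F G x y (hobj x) (hobj y)).mem_of_tendsto ht
    (Filter.Eventually.of_forall fun n => ?_)
  refine mem_equalizerSub_iff (hx := hobj x) (hy := hobj y) |>.2 ?_
  refine (congrArg Arrow.mk (ρ.toGen.eval_push F (t n))).symm.trans ?_
  refine Eq.trans ?_ (congrArg Arrow.mk (ρ.toGen.eval_push G (t n)))
  exact arrow_mk_eval_congr hobj hmap (t n)

variable {ρ σ : Rep 𝕜 g}

/-- `b` is a value in `σ` of the same limit of formal expressions whose value in `ρ` is `a`. -/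
def LimRel (ρ σ : Rep 𝕜 g) {x y : X} (a : ρ.obj x ⟶ ρ.obj y) (b : σ.obj x ⟶ σ.obj y) : Prop :=
  ∃ t : ℕ → Term 𝕜 g x y, Filter.Tendsto (fun n => ρ.eval (t n)) Filter.atTop (nhds a) ∧
    Filter.Tendsto (fun n => σ.eval (t n)) Filter.atTop (nhds b)

/-- A difference of formal expressions is again a formal expression, so comparing norms of single
values already gives a Lipschitz estimate. -/
lemma norm_eval_sub_le (h : ∀ {x y : X} (t : Term 𝕜 g x y), ‖σ.eval t‖ ≤ ‖ρ.eval t‖) {x y : X}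
    (s t : Term 𝕜 g x y) : ‖σ.eval s - σ.eval t‖ ≤ ‖ρ.eval s - ρ.eval t‖ := by
  have := h (.add s (.smul (-1) t))
  simpa only [eval, neg_smul, one_smul, ← sub_eq_add_neg] using this

/-- Makes the extension by continuity well defined. Every functor law of `genDesc` is an instance of
this uniqueness, with approximating sequences combined term by term. -/
lemma LimRel.eq (h : ∀ {x y : X} (t : Term 𝕜 g x y), ‖σ.eval t‖ ≤ ‖ρ.eval t‖) {x y : X}
    {a : ρ.obj x ⟶ ρ.obj y} {b b' : σ.obj x ⟶ σ.obj y} (hb : LimRel ρ σ a b)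
    (hb' : LimRel ρ σ a b') : b = b' := by
  obtain ⟨s, hs, hs'⟩ := hb
  obtain ⟨t, ht, ht'⟩ := hb'
  have h1 := (hs.sub ht).norm
  rw [sub_self, norm_zero] at h1
  have h2 := squeeze_zero_norm (fun n => norm_eval_sub_le h (s n) (t n)) h1
  exact sub_eq_zero.1 (tendsto_nhds_unique (hs'.sub ht') h2)

/-- Under the Lipschitz estimate, expressions whose values converge in `ρ` have Cauchy values in
`σ`, and the homs of `σ.cat` are complete. -/
lemma exists_limRel (h : ∀ {x y : X} (t : Term 𝕜 g x y), ‖σ.eval t‖ ≤ ‖ρ.eval t‖) {x y : X}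
    {a : ρ.obj x ⟶ ρ.obj y} (ha : a ∈ ρ.gen.hom x y) : ∃ b, LimRel ρ σ a b := by
  obtain ⟨s, hs, hlim⟩ := mem_closure_iff_seq_limit.1 ha
  choose t ht using hs
  have hlim' : Filter.Tendsto (fun n => ρ.eval (t n)) Filter.atTop (nhds a) := hlim.congr fun n =>
    (ht n).symm
  have hc : CauchySeq fun n => σ.eval (t n) := by
    have := hlim'.cauchySeq
    rw [Metric.cauchySeq_iff] at this ⊢
    intro ε hε
    obtain ⟨N, hN⟩ := this ε hε
    refine ⟨N, fun m hm n hn => lt_of_le_of_lt ?_ (hN m hm n hn)⟩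
    rw [dist_eq_norm, dist_eq_norm]
    exact norm_eval_sub_le h _ _
  obtain ⟨b, hb⟩ := cauchySeq_tendsto_of_complete hc
  exact ⟨b, t, hlim', hb⟩

/-- The *-functor induced by a norm-decreasing comparison of interpretations. -/
noncomputable def genDesc (h : ∀ {x y : X} (t : Term 𝕜 g x y), ‖σ.eval t‖ ≤ ‖ρ.eval t‖) :
    ρ.toGen.cat ⟶ σ.cat :=
  have spec {x y : X} (a : ρ.gen.hom x y) := (exists_limRel (σ := σ) h a.2).choose_spec
  show StarFunctor ρ.gen.toCStarCat σ.cat from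
  { obj := σ.obj
    map := fun {x y} a => (exists_limRel (σ := σ) h (Subtype.property
      (p := fun b => b ∈ ρ.gen.hom x y) a)).choose
    map_id := fun x => (spec _).eq h ⟨fun _ => .id x, tendsto_const_nhds, tendsto_const_nhds⟩
    map_comp := fun a b => (spec _).eq h (by
      obtain ⟨s, hs, hs'⟩ := spec a
      obtain ⟨t, ht, ht'⟩ := spec b
      exact ⟨fun n => .comp (s n) (t n),
        ((continuous_comp _ _ _).tendsto (_, _)).comp (hs.prodMk_nhds ht),
        ((continuous_comp _ _ _).tendsto (_, _)).comp (hs'.prodMk_nhds ht')⟩)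
    map_add := fun a b => (spec _).eq h (by
      obtain ⟨s, hs, hs'⟩ := spec a
      obtain ⟨t, ht, ht'⟩ := spec b
      exact ⟨fun n => .add (s n) (t n), hs.add ht, hs'.add ht'⟩)
    map_smul := fun k a => (spec _).eq h (by
      obtain ⟨s, hs, hs'⟩ := spec a
      exact ⟨fun n => .smul k (s n), hs.const_smul k, hs'.const_smul k⟩)
    map_adj := fun a => (spec _).eq h (by
      obtain ⟨s, hs, hs'⟩ := spec a
      exact ⟨fun n => .adj (s n), ((continuous_adj _ _).tendsto _).comp hs,
        ((continuous_adj _ _).tendsto _).comp hs'⟩) }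

lemma genDesc_map (h : ∀ {x y : X} (t : Term 𝕜 g x y), ‖σ.eval t‖ ≤ ‖ρ.eval t‖) {x y : X}
    (e : g x y) : (functor (genDesc h)).map (ρ.toGen.map e) = σ.map e :=
  (exists_limRel (σ := σ) h (subset_closure ⟨.of e, rfl⟩)).choose_spec.eq h
    ⟨fun _ => .of e, tendsto_const_nhds, tendsto_const_nhds⟩

end Rep

/-- A presentation of a C*-category by objects, norm-bounded generators, and relations. -/
structure Presentation (𝕜 : Type) [RCLike 𝕜] : Type (u + 1) where
  /-- The objects. -/
  X : Type u
  /-- The generators. -/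
  g : X → X → Type u
  /-- The bounds on the norms of the generators. -/
  bound {x y : X} (e : g x y) : NNReal
  /-- The relations. -/
  rel {x y : X} (s t : Term 𝕜 g x y) : Prop

namespace Presentation

variable (P : Presentation.{u} 𝕜)

/-- An interpretation is a model if it satisfies the bounds and the relations. -/
structure IsModel (ρ : Rep 𝕜 P.g) : Prop where
  norm_le {x y : P.X} (e : P.g x y) : ‖ρ.map e‖ ≤ P.bound e
  eval_eq {x y : P.X} {s t : Term 𝕜 P.g x y} (h : P.rel s t) : ρ.eval s = ρ.eval t

/-- The norms of the values of the formal expressions. -/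
def normFun (ρ : Rep 𝕜 P.g) (t : Σ x y : P.X, Term 𝕜 P.g x y) : ℝ := ‖ρ.eval t.2.2‖

/-- The set of norm functions of models; unlike the class of models, it is small. -/
def Index : Type u := Set.range fun ρ : {ρ : Rep 𝕜 P.g // P.IsModel ρ} => P.normFun ρ.1

/-- A model realizing a norm function. -/
noncomputable def model (i : P.Index) : {ρ : Rep 𝕜 P.g // P.IsModel ρ} := i.2.choose

lemma exists_normFun_model_eq {σ : Rep 𝕜 P.g} (hσ : P.IsModel σ) :
    ∃ i : P.Index, P.normFun (P.model i).1 = P.normFun σ :=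
  ⟨⟨_, ⟨σ, hσ⟩, rfl⟩, Exists.choose_spec (⟨⟨σ, hσ⟩, rfl⟩ :
    ∃ ρ : {ρ : Rep 𝕜 P.g // P.IsModel ρ}, P.normFun ρ.1 = P.normFun σ)⟩

/-- The product of models that realize all norm functions. -/
noncomputable def piRep : Rep 𝕜 P.g where
  cat := pi fun i => (P.model i).1.cat
  obj x := fun i => (P.model i).1.obj x
  map e := PiHom.mk (fun i => (P.model i).1.map e) (P.bound e) fun i => (P.model i).2.norm_le e

lemma piProj_eval_piRep (i : P.Index) {x y : P.X} (t : Term 𝕜 P.g x y) :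
    (functor (piProj _ i)).map (P.piRep.eval t) = (P.model i).1.eval t :=
  (P.piRep.eval_push (piProj _ i) t).symm

/-- Some factor of the product has the same norm function as `σ`, and projections contract.
`genDesc` asks only for this bound, so `σ` need not itself be a factor. -/
lemma norm_eval_le_piRep {σ : Rep 𝕜 P.g} (hσ : P.IsModel σ) {x y : P.X} (t : Term 𝕜 P.g x y) :
    ‖σ.eval t‖ ≤ ‖P.piRep.eval t‖ := by
  obtain ⟨i, hi⟩ := P.exists_normFun_model_eq hσ
  have h : ‖(P.model i).1.eval t‖ = ‖σ.eval t‖ := congrFun hi ⟨x, y, t⟩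
  rw [← h, ← P.piProj_eval_piRep i t]
  exact norm_map_le (piProj (fun i => (P.model i).1.cat) i) (P.piRep.eval t)

/-- The universal model of a presentation. -/
noncomputable def univ : Rep 𝕜 P.g := P.piRep.toGen

lemma isModel_univ : P.IsModel P.univ where
  norm_le {x y} e :=
    pi_norm_le (x := P.piRep.obj x) (y := P.piRep.obj y) (P.piRep.map e) (P.bound e).2
      fun i => (P.model i).2.norm_le e
  eval_eq {x y s t} h := by
    refine P.piRep.gen_hom_ext ?_
    erw [Rep.map_incl_eval_toGen, Rep.map_incl_eval_toGen]
    refine pi_hom_ext fun i => ?_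
    exact (P.piProj_eval_piRep i s).trans (((P.model i).2.eval_eq h).trans
      (P.piProj_eval_piRep i t).symm)

/-- The *-functor from the universal model to an arbitrary model. -/
noncomputable def desc {σ : Rep 𝕜 P.g} (hσ : P.IsModel σ) : P.univ.cat ⟶ σ.cat :=
  Rep.genDesc (P.norm_eval_le_piRep hσ)

lemma desc_map {σ : Rep 𝕜 P.g} (hσ : P.IsModel σ) {x y : P.X} (e : P.g x y) :
    (functor (P.desc hσ)).map (P.univ.map e) = σ.map e :=
  Rep.genDesc_map _ e

end Presentation

end CStarCat

namespace CStarCat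

variable {𝕜 : Type} [RCLike 𝕜] {A B C : CStarCat.{u} 𝕜}

/-! ### Colimits -/

section Colimits

variable {J : Type u} [SmallCategory J] (F : J ⥤ CStarCat.{u} 𝕜)

/-- The objects of the colimit. -/
def ColimObj : Type u :=
  Quot fun p q : Σ j, F.obj j => ∃ f : p.1 ⟶ q.1, (functor (F.map f)).obj p.2 = q.2

/-- The object of the colimit represented by an object of a term of the diagram. -/
def ColimObj.mk {j : J} (x : F.obj j) : ColimObj F := Quot.mk _ ⟨j, x⟩

lemma ColimObj.mk_map {j j' : J} (f : j ⟶ j') (x : F.obj j) :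
    ColimObj.mk F ((functor (F.map f)).obj x) = ColimObj.mk F x :=
  (Quot.sound ⟨f, rfl⟩).symm

/-- The generating arrows of the colimit. -/
inductive ColimGen : ColimObj F → ColimObj F → Type u
  | mk {j : J} {x y : F.obj j} (a : x ⟶ y) : ColimGen (ColimObj.mk F x) (ColimObj.mk F y)

/-- The norm bounds on the generating arrows of the colimit. -/
def ColimGen.bound : ∀ {x y : ColimObj F}, ColimGen F x y → NNReal
  | _, _, .mk a => ‖a‖₊

/-- The relations between the generating arrows of the colimit. -/
inductive ColimRel : ∀ {x y : ColimObj F}, Term 𝕜 (ColimGen F) x y → Term 𝕜 (ColimGen F) x y → Prop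
  | id {j : J} (x : F.obj j) : ColimRel (.of (.mk (𝟙 x))) (.id (ColimObj.mk F x))
  | comp {j : J} {x y z : F.obj j} (a : x ⟶ y) (b : y ⟶ z) :
      ColimRel (.of (.mk (a ≫ b))) (.comp (.of (.mk a)) (.of (.mk b)))
  | add {j : J} {x y : F.obj j} (a b : x ⟶ y) :
      ColimRel (.of (.mk (a + b))) (.add (.of (.mk a)) (.of (.mk b)))
  | smul {j : J} {x y : F.obj j} (k : 𝕜) (a : x ⟶ y) :
      ColimRel (.of (.mk (k • a))) (.smul k (.of (.mk a)))
  | adj {j : J} {x y : F.obj j} (a : x ⟶ y) :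
      ColimRel (.of (.mk ((F.obj j).adj a))) (.adj (.of (.mk a)))
  | map {j j' : J} (f : j ⟶ j') {x y : F.obj j} (a : x ⟶ y)
      (t : Term 𝕜 (ColimGen F) (ColimObj.mk F x) (ColimObj.mk F y))
      (ht : HEq t (Term.of (𝕜 := 𝕜) (ColimGen.mk (F := F) ((functor (F.map f)).map a)))) :
      ColimRel (.of (.mk a)) t

/-- The presentation of the colimit. -/
def colimPres : Presentation.{u} 𝕜 where
  X := ColimObj F
  g := ColimGen F
  bound := ColimGen.bound F
  rel := ColimRel F

/-- The interpretation of the generators of the colimit given by a cocone. -/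
def coconeRep (s : Cocone F) : Rep 𝕜 (ColimGen F) where
  cat := s.pt
  obj := Quot.lift (fun p => (functor (s.ι.app p.1)).obj p.2) (by
    rintro ⟨j, x⟩ ⟨j', x'⟩ ⟨f, hf⟩
    exact (obj_congr (s.w f) x).symm.trans (congrArg (functor (s.ι.app j')).obj hf))
  map := fun
    | .mk a => (functor (s.ι.app _)).map a

lemma Rep.arrow_mk_eval_of_heq {X : Type u} {g : X → X → Type u} (ρ : Rep 𝕜 g) {x y x' y' : X}
    (hx : x = x') (hy : y = y') {t : Term 𝕜 g x y} {t' : Term 𝕜 g x' y'} (h : HEq t t') :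
    Arrow.mk (ρ.eval t) = Arrow.mk (ρ.eval t') := by
  subst hx hy
  cases h
  rfl

lemma isModel_coconeRep (s : Cocone F) : (colimPres F).IsModel (coconeRep F s) where
  norm_le := by
    rintro _ _ ⟨a⟩
    exact norm_map_le _ a
  eval_eq := by
    intro x y t t' h
    cases h with
    | id x => exact (functor (s.ι.app _)).map_id x
    | comp a b => exact (functor (s.ι.app _)).map_comp a b
    | add a b => exact StarFunctor.map_add (s.ι.app _) a b
    | smul k a => exact StarFunctor.map_smul (s.ι.app _) k a
    | adj a => exact StarFunctor.map_adj (s.ι.app _) a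
    | map f a t ht =>
      rw [← arrow_mk_eq_iff]
      refine Eq.trans ?_ ((coconeRep F s).arrow_mk_eval_of_heq (ColimObj.mk_map F f _).symm
        (ColimObj.mk_map F f _).symm ht).symm
      exact (arrow_mk_map_congr (s.w f) a).symm

/-- The inclusions of the terms of a diagram in the colimit. -/
noncomputable def colimIn (j : J) : F.obj j ⟶ (colimPres F).univ.cat :=
  show StarFunctor (F.obj j) (colimPres F).univ.cat from
  { obj := fun x => (colimPres F).univ.obj (ColimObj.mk F x)
    map := fun a => (colimPres F).univ.map (ColimGen.mk a)
    map_id := fun x => (colimPres F).isModel_univ.eval_eq (ColimRel.id x)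
    map_comp := fun a b => (colimPres F).isModel_univ.eval_eq (ColimRel.comp a b)
    map_add := fun a b => (colimPres F).isModel_univ.eval_eq (ColimRel.add a b)
    map_smul := fun k a => (colimPres F).isModel_univ.eval_eq (ColimRel.smul k a)
    map_adj := fun a => (colimPres F).isModel_univ.eval_eq (ColimRel.adj a) }

lemma map_colimIn {j j' : J} (f : j ⟶ j') : F.map f ≫ colimIn F j' = colimIn F j := by
  refine hom_ext fun {x y} a => ?_
  have hx : ColimObj.mk F ((functor (F.map f)).obj x) = ColimObj.mk F x := ColimObj.mk_map F f x
  have hy : ColimObj.mk F ((functor (F.map f)).obj y) = ColimObj.mk F y := ColimObj.mk_map F f y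
  -- The two generators have endpoints that are equal only in the quotient; the relation
  -- `ColimRel.map` is therefore fed a transported copy of the second one.
  have key : ∀ {p q p' q' : ColimObj F} (hp : p = p') (hq : q = q') (t : Term 𝕜 (ColimGen F) p q),
      ∃ t' : Term 𝕜 (ColimGen F) p' q', HEq t' t := by
    rintro p q _ _ rfl rfl t
    exact ⟨t, HEq.rfl⟩
  obtain ⟨t', ht'⟩ := key hx hy (.of (.mk ((functor (F.map f)).map a)))
  have h1 := (colimPres F).isModel_univ.eval_eq (ColimRel.map f a t' ht')
  have h2 := (colimPres F).univ.arrow_mk_eval_of_heq hx.symm hy.symm ht'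
  exact h2.symm.trans (congrArg Arrow.mk h1.symm)

/-- The colimit cocone of a diagram of C*-categories. -/
noncomputable def colimCocone : Cocone F where
  pt := (colimPres F).univ.cat
  ι :=
    { app := colimIn F
      naturality := fun _ _ f => (map_colimIn F f).trans (Category.comp_id _).symm }

/-- The colimit cocone is a colimit. -/
noncomputable def colimCoconeIsColimit : IsColimit (colimCocone F) where
  desc s := (colimPres F).desc (isModel_coconeRep F s)
  fac s j := hom_ext fun a => congrArg Arrow.mk
    ((colimPres F).desc_map (isModel_coconeRep F s) (ColimGen.mk a))
  uniq s m hm := by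
    refine Rep.toGen_hom_ext (colimPres F).piRep ?_ ?_
    · rintro ⟨j, x⟩
      exact obj_congr (hm j) x
    · rintro _ _ ⟨a⟩
      exact (arrow_mk_map_congr (hm _) a).trans (congrArg Arrow.mk
        ((colimPres F).desc_map (isModel_coconeRep F s) (ColimGen.mk a)).symm)

end Colimits

instance : HasColimitsOfSize.{u, u} (CStarCat.{u} 𝕜) where
  has_colimits_of_shape _ _ := { has_colimit := fun F => ⟨⟨⟨_, colimCoconeIsColimit F⟩⟩⟩ }

/-! ### The universal contraction and the universal unitary -/

/-- The generating arrow of the universal C*-category on a contraction. -/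
inductive ContractionGen : ULift.{u} Bool → ULift.{u} Bool → Type u
  | mk : ContractionGen ⟨false⟩ ⟨true⟩

/-- The presentation of the universal C*-category on a contraction. -/
def contractionPres (𝕜 : Type) [RCLike 𝕜] : Presentation.{u} 𝕜 where
  X := ULift Bool
  g := ContractionGen
  bound _ := 1
  rel _ _ := False

/-- The interpretation of the generator given by an arrow. -/
def contractionRep {x y : B} (b : x ⟶ y) : Rep 𝕜 ContractionGen.{u} where
  cat := B
  obj := fun i => match i with
    | ⟨false⟩ => x
    | ⟨true⟩ => y
  map := fun
    | .mk => b

lemma isModel_contractionRep {x y : B} (b : x ⟶ y) (hb : ‖b‖ ≤ 1) :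
    (contractionPres 𝕜).IsModel (contractionRep b) where
  norm_le := by
    rintro _ _ ⟨⟩
    exact hb
  eval_eq := False.elim

lemma isUniversalContraction_univ :
    IsUniversalContraction (A := (contractionPres.{u} 𝕜).univ.cat)
      ((contractionPres.{u} 𝕜).univ.map ContractionGen.mk) where
  norm_le := (contractionPres 𝕜).isModel_univ.norm_le ContractionGen.mk
  existsUnique B {x y} b hb := by
    refine ⟨(contractionPres 𝕜).desc (isModel_contractionRep b hb),
      congrArg Arrow.mk ((contractionPres 𝕜).desc_map (isModel_contractionRep b hb) .mk), ?_⟩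
    intro F hF
    refine Rep.toGen_hom_ext (contractionPres 𝕜).piRep ?_ ?_
    · rintro ⟨_ | _⟩
      · exact congrArg Comma.left hF
      · exact congrArg Comma.right hF
    · rintro _ _ ⟨⟩
      exact hF.trans (congrArg Arrow.mk
        ((contractionPres 𝕜).desc_map (isModel_contractionRep b hb) .mk).symm)

/-- The C*-category with two objects and a unitary isomorphism between them. -/
def intervalCat (𝕜 : Type) [RCLike 𝕜] : CStarCat.{u} 𝕜 :=
  (base 𝕜).pull fun _ : ULift.{u} Bool => (.pt : Pt.{u} 𝕜)

/-- An object of `intervalCat`. -/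
def intervalObj (𝕜 : Type) [RCLike 𝕜] (i : Bool) : intervalCat.{u} 𝕜 :=
  (ULift.up i : ULift.{u} Bool)

/-- The canonical arrows of `intervalCat`. -/
def intervalArr (i j : Bool) : intervalObj.{u} 𝕜 i ⟶ intervalObj.{u} 𝕜 j := 𝟙 (.pt : Pt.{u} 𝕜)

lemma arrow_mk_adj_congr {x y x' y' : A} {a : x ⟶ y} {b : x' ⟶ y'}
    (h : Arrow.mk a = Arrow.mk b) : Arrow.mk (A.adj a) = Arrow.mk (A.adj b) := by
  cases h; rfl

lemma arrow_mk_map_smul_congr {F G : A ⟶ B} {x y : A} {a : x ⟶ y} (k : 𝕜)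
    (h : Arrow.mk ((functor F).map a) = Arrow.mk ((functor G).map a)) :
    Arrow.mk ((functor F).map (k • a)) = Arrow.mk ((functor G).map (k • a)) :=
  (mem_equalizerSub_iff (hx := congrArg Comma.left h) (hy := congrArg Comma.right h)).1
    (Submodule.smul_mem _ k (mem_equalizerSub_iff.2 h))

/-- Every arrow is a scalar multiple of an identity, of the unitary or of its adjoint, and
*-functors are linear and preserve identities and adjoints. -/
lemma intervalArr_hom_ext {F G : intervalCat.{u} 𝕜 ⟶ B}
    (h : Arrow.mk ((functor F).map (intervalArr (𝕜 := 𝕜) false true)) =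
      Arrow.mk ((functor G).map (intervalArr (𝕜 := 𝕜) false true))) : F = G := by
  have hobj : ∀ i, (functor F).obj (intervalObj 𝕜 i) = (functor G).obj (intervalObj 𝕜 i) := by
    rintro (_ | _)
    · exact congrArg Comma.left h
    · exact congrArg Comma.right h
  have hid : ∀ i, Arrow.mk ((functor F).map (𝟙 (intervalObj 𝕜 i))) =
      Arrow.mk ((functor G).map (𝟙 (intervalObj 𝕜 i))) := fun i => by
    rw [(functor F).map_id, (functor G).map_id, hobj]
  have harr : ∀ i j, Arrow.mk ((functor F).map (intervalArr (𝕜 := 𝕜) i j)) =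
      Arrow.mk ((functor G).map (intervalArr (𝕜 := 𝕜) i j)) := by
    rintro (_ | _) (_ | _)
    · exact hid _
    · exact h
    · have hadj : intervalArr (𝕜 := 𝕜) true false =
          (intervalCat.{u} 𝕜).adj (intervalArr (𝕜 := 𝕜) false true) :=
        (CStarCat.adj_id (A := base.{u} 𝕜) .pt).symm
      rw [hadj, StarFunctor.map_adj, StarFunctor.map_adj]
      exact arrow_mk_adj_congr h
    · exact hid _
  refine hom_ext fun {x y} a => ?_
  have ha : a = ULift.down (α := 𝕜) a • intervalArr (𝕜 := 𝕜) x.down y.down :=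
    ULift.ext _ _ (mul_one _).symm
  rw [ha]
  exact arrow_mk_map_smul_congr _ (harr _ _)

/-- The endpoints of an arrow. -/
def endpoint (x y : B) : Bool → B
  | false => x
  | true => y

/-- The arrows generated by a unitary. -/
def unitaryArr {x y : B} (b : x ⟶ y) : ∀ i j : Bool, endpoint x y i ⟶ endpoint x y j
  | false, false => 𝟙 x
  | false, true => b
  | true, false => B.adj b
  | true, true => 𝟙 y

lemma unitaryArr_comp {x y : B} {b : x ⟶ y} (hb : IsUnitary b) (i j k : Bool) :
    unitaryArr b i j ≫ unitaryArr b j k = unitaryArr b i k := by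
  cases i <;> cases j <;> cases k <;>
  first
  | exact Category.id_comp _
  | exact Category.comp_id _
  | exact hb.1
  | exact hb.2

lemma unitaryArr_adj {x y : B} (b : x ⟶ y) (i j : Bool) :
    B.adj (unitaryArr b i j) = unitaryArr b j i := by
  cases i <;> cases j <;>
  first
  | exact CStarCat.adj_id _
  | exact B.adj_adj b
  | rfl

lemma unitaryArr_self {x y : B} (b : x ⟶ y) (i : Bool) :
    unitaryArr b i i = 𝟙 _ := by
  cases i <;> rfl

/-- The *-functor out of `intervalCat` given by a unitary. -/
def intervalDesc {x y : B} (b : x ⟶ y) (hb : IsUnitary b) : intervalCat.{u} 𝕜 ⟶ B :=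
  show StarFunctor (intervalCat.{u} 𝕜) B from
  { obj := fun i => endpoint x y (ULift.down i)
    map := fun {i j} a => ULift.down (α := 𝕜) a • unitaryArr b (ULift.down i) (ULift.down j)
    map_id := fun i => (one_smul 𝕜 _).trans (unitaryArr_self b _)
    map_comp := fun c d => by
      rw [B.smul_comp, B.comp_smul, smul_smul, unitaryArr_comp hb]
      exact congrArg (· • _) (mul_comm _ _)
    map_add := fun c d => add_smul (ULift.down (α := 𝕜) c) (ULift.down d) _
    map_smul := fun k c => mul_smul k (ULift.down (α := 𝕜) c) _
    map_adj := fun c => by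
      rw [B.adj_smul, unitaryArr_adj]
      rfl }

lemma isUniversalUnitary_intervalArr :
    IsUniversalUnitary (A := intervalCat.{u} 𝕜) (intervalArr (𝕜 := 𝕜) false true) where
  isUnitary := ⟨ULift.ext _ _ (show (starRingEnd 𝕜 1 * 1 : 𝕜) = 1 by simp),
    ULift.ext _ _ (show (1 * starRingEnd 𝕜 1 : 𝕜) = 1 by simp)⟩
  existsUnique B {x y} b hb := by
    have h : Sends (intervalDesc b hb) (intervalArr (𝕜 := 𝕜) false true) b :=
      congrArg Arrow.mk (one_smul 𝕜 b)
    exact ⟨intervalDesc b hb, h, fun F hF => intervalArr_hom_ext (hF.trans h.symm)⟩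

lemma ofObj_comp {x : A} (F : A ⟶ B) : ofObj x ≫ F = ofObj ((functor F).obj x) := by
  refine hom_ext fun {p q} a => ?_
  exact congrArg Arrow.mk ((StarFunctor.map_smul F _ _).trans
    (congrArg (ULift.down (α := 𝕜) a • ·) ((functor F).map_id x)))

lemma ofObj_injective {x y : A} (h : ofObj x = ofObj y) : x = y := obj_congr h .pt

/-- The identity of `base 𝕜` is itself of the form `ofObj`, and `ofObj` is compatible with
composition. -/
lemma base_hom_eq (F : base.{u} 𝕜 ⟶ A) : F = ofObj ((functor F).obj .pt) := by
  have h : ofObj (A := base.{u} 𝕜) .pt = 𝟙 _ :=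
    hom_ext fun {p q} a => congrArg Arrow.mk (ULift.ext _ _ (mul_one _))
  exact ((Category.id_comp F).symm.trans (congrArg (· ≫ F) h.symm)).trans
    (ofObj_comp (A := base.{u} 𝕜) (x := .pt) F)

open Limits in
lemma nonempty_generators : Nonempty (Generators.{u} 𝕜) := by
  let s : (contractionPres.{u} 𝕜).univ.cat := (contractionPres.{u} 𝕜).univ.obj ⟨false⟩
  let t : (contractionPres.{u} 𝕜).univ.cat := (contractionPres.{u} 𝕜).univ.obj ⟨true⟩
  let V : base.{u} 𝕜 ⨿ base.{u} 𝕜 ⟶ (contractionPres.{u} 𝕜).univ.cat :=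
    coprod.desc (ofObj s) (ofObj t)
  exact ⟨{
    one := (contractionPres.{u} 𝕜).univ.cat
    s := s
    t := t
    arr := (contractionPres.{u} 𝕜).univ.map ContractionGen.mk
    isUniversal_arr := isUniversalContraction_univ
    two := base.{u} 𝕜 ⨿ base.{u} 𝕜
    inl := coprod.inl
    inr := coprod.inr
    isCoproduct := ⟨coprodIsCoprod _ _⟩
    V := V
    inl_V := coprod.inl_desc _ _
    inr_V := coprod.inr_desc _ _
    P := pushout V V
    in₁ := pushout.inl V V
    in₂ := pushout.inr V V
    isPushout := IsPushout.of_hasPushout V V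
    W := pushout.desc (𝟙 _) (𝟙 _) rfl
    in₁_W := pushout.inl_desc _ _ _
    in₂_W := pushout.inr_desc _ _ _
    interval := intervalCat.{u} 𝕜
    i₀ := intervalObj 𝕜 false
    i₁ := intervalObj 𝕜 true
    unitary := intervalArr false true
    isUniversal_unitary := isUniversalUnitary_intervalArr }⟩

end CStarCat

namespace CStarCat

variable {𝕜 : Type} [RCLike 𝕜] {A B C D : CStarCat.{u} 𝕜}

/-! ### Unitary arrows and unitary natural isomorphisms -/

lemma isUnitary_id (x : A) : IsUnitary (𝟙 x) := by
  constructor <;> rw [adj_id, Category.comp_id]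

lemma IsUnitary.adj {x y : A} {a : x ⟶ y} (h : IsUnitary a) : IsUnitary (A.adj a) := by
  constructor
  · rw [A.adj_adj]; exact h.2
  · rw [A.adj_adj]; exact h.1

lemma IsUnitary.comp {x y z : A} {a : x ⟶ y} {b : y ⟶ z} (ha : IsUnitary a) (hb : IsUnitary b) :
    IsUnitary (a ≫ b) := by
  constructor
  · rw [A.adj_comp, Category.assoc, ← Category.assoc b, hb.1, Category.id_comp, ha.1]
  · rw [A.adj_comp, Category.assoc, ← Category.assoc _ a, ha.2, Category.id_comp, hb.2]

lemma isUnitary_eqToHom {x y : A} (h : x = y) : IsUnitary (eqToHom h) := by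
  subst h; exact isUnitary_id x

lemma IsUnitary.map {x y : A} {a : x ⟶ y} (h : IsUnitary a) (F : A ⟶ B) :
    IsUnitary ((functor F).map a) := by
  constructor
  · rw [← StarFunctor.map_adj, ← (functor F).map_comp, h.1, (functor F).map_id]
  · rw [← StarFunctor.map_adj, ← (functor F).map_comp, h.2, (functor F).map_id]

/-- A unitary arrow as an isomorphism. -/
def IsUnitary.iso {x y : A} {a : x ⟶ y} (h : IsUnitary a) : x ≅ y where
  hom := a
  inv := A.adj a
  hom_inv_id := h.1
  inv_hom_id := h.2

lemma IsUnitary.inv_eq {x y : A} {e : x ≅ y} (h : IsUnitary e.hom) : e.inv = A.adj e.hom :=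
  (Iso.inv_eq_inv (f := e) (g := h.iso)).2 rfl

/-- Two *-functors are homotopic if they are related by a natural isomorphism with unitary
components. -/
def unitaryHomotopic (𝕜 : Type) [RCLike 𝕜] : HomRel (CStarCat.{u} 𝕜) := fun _ _ F G =>
  ∃ α : functor F ≅ functor G, ∀ x, IsUnitary (α.hom.app x)

instance : Congruence (unitaryHomotopic.{u} 𝕜) where
  equivalence :=
    { refl := fun F => ⟨Iso.refl _, fun x => isUnitary_id _⟩
      symm := by
        rintro F G ⟨α, hα⟩
        refine ⟨α.symm, fun x => ?_⟩
        have h : IsUnitary (α.app x).inv := by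
          rw [IsUnitary.inv_eq (e := α.app x) (hα x)]
          exact (hα x).adj
        exact h
      trans := by
        rintro F G H ⟨α, hα⟩ ⟨β, hβ⟩
        exact ⟨α ≪≫ β, fun x => (hα x).comp (hβ x)⟩ }
  comp_left F := by
    rintro G G' ⟨α, hα⟩
    exact ⟨Functor.isoWhiskerLeft (functor F) α, fun x => hα _⟩
  comp_right G := by
    rintro ⟨α, hα⟩
    exact ⟨Functor.isoWhiskerRight α (functor G), fun x => (hα x).map G⟩

/-- Unitary equivalences are the *-functors that become invertible in the homotopy category. -/
lemma unitaryEquivalences_eq : unitaryEquivalences.{u} 𝕜 =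
    (MorphismProperty.isomorphisms _).inverseImage
      (Quotient.functor (unitaryHomotopic.{u} 𝕜)) := by
  ext A B F
  constructor
  · rintro ⟨G, α, β, hα, hβ⟩
    refine ⟨(Quotient.functor _).map G, ?_, ?_⟩
    · rw [← Functor.map_comp, ← CategoryTheory.Functor.map_id]
      exact (Quotient.functor_map_eq_iff _ _ _).2 ⟨α, hα⟩
    · rw [← Functor.map_comp, ← CategoryTheory.Functor.map_id]
      exact (Quotient.functor_map_eq_iff _ _ _).2 ⟨β, hβ⟩
  · rintro ⟨G', h1, h2⟩
    obtain ⟨G, rfl⟩ := (Quotient.functor (unitaryHomotopic.{u} 𝕜)).map_surjective G'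
    rw [← Functor.map_comp, ← CategoryTheory.Functor.map_id] at h1 h2
    obtain ⟨α, hα⟩ := (Quotient.functor_map_eq_iff (unitaryHomotopic.{u} 𝕜) _ _).1 h1
    obtain ⟨β, hβ⟩ := (Quotient.functor_map_eq_iff (unitaryHomotopic.{u} 𝕜) _ _).1 h2
    exact ⟨G, α, β, hα, hβ⟩

/-- Isomorphisms satisfy two-out-of-three, are stable under retracts and contain identities; these
properties pass to the inverse image along the functor to the homotopy category. -/
instance : (unitaryEquivalences.{u} 𝕜).HasTwoOutOfThreeProperty := by
  rw [unitaryEquivalences_eq]; infer_instance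

instance : (unitaryEquivalences.{u} 𝕜).IsStableUnderRetracts := by
  rw [unitaryEquivalences_eq]; infer_instance

instance : (unitaryEquivalences.{u} 𝕜).ContainsIdentities := by
  rw [unitaryEquivalences_eq]; infer_instance

/-- The inclusion of the retract has a left inverse, hence is injective on objects, and injectivity
of `g` restricts along it. -/
instance : (objInjective.{u} 𝕜).IsStableUnderRetracts where
  of_retract {X Y Z W f g} h hg := by
    intro x x' hx
    have h1 : f ≫ h.i.right = h.i.left ≫ g := h.i.w.symm
    have h2 : h.i.left ≫ h.r.left = 𝟙 _ := h.retract_left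
    have h3 : (functor h.i.left).obj x = (functor h.i.left).obj x' := hg (by
      exact (obj_congr h1 x).symm.trans
        ((congrArg (functor h.i.right).obj hx).trans (obj_congr h1 x')))
    exact (obj_congr h2 x).symm.trans ((congrArg (functor h.r.left).obj h3).trans (obj_congr h2 x'))

/-! ### Conjugating *-functors by unitaries and lifting along fully faithful ones -/

/-- The conjugate of a *-functor by a family of unitaries. -/
def conj (F : A ⟶ B) (l : A → B) (v : ∀ x, (functor F).obj x ⟶ l x) (hv : ∀ x, IsUnitary (v x)) :
    A ⟶ B :=
  show StarFunctor A B from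
  { obj := l
    map := fun {x y} a => B.adj (v x) ≫ (functor F).map a ≫ v y
    map_id := fun x => by
      rw [(functor F).map_id, Category.id_comp, (hv x).2]
    map_comp := fun {x y z} a b => by
      rw [(functor F).map_comp, Category.assoc, Category.assoc, Category.assoc,
        ← Category.assoc (v y), (hv y).1, Category.id_comp]
    map_add := fun a b => by rw [StarFunctor.map_add, B.add_comp, B.comp_add]
    map_smul := fun k a => by rw [StarFunctor.map_smul, B.smul_comp, B.comp_smul]
    map_adj := fun a => by
      rw [B.adj_comp, B.adj_comp, B.adj_adj, StarFunctor.map_adj, Category.assoc] }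

/-- Lift a *-functor along a fully faithful one, with prescribed lifts of objects. -/
noncomputable def liftFF (p : C ⟶ D) [(functor p).Full] [(functor p).Faithful] (G : B ⟶ D)
    (l : B → C) (w : ∀ b, (functor G).obj b ⟶ (functor p).obj (l b))
    (hw : ∀ b, IsUnitary (w b)) : B ⟶ C :=
  show StarFunctor B C from
  { obj := l
    map := fun {x y} a => (functor p).preimage (D.adj (w x) ≫ (functor G).map a ≫ w y)
    map_id := fun x => (functor p).map_injective ((Functor.map_preimage _ _).trans
      (((functor (conj G _ w hw)).map_id x).trans ((functor p).map_id _).symm))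
    map_comp := fun a b => (functor p).map_injective ((Functor.map_preimage _ _).trans
      (((functor (conj G _ w hw)).map_comp a b).trans (((functor p).map_comp _ _).trans
        (congrArg₂ (· ≫ ·) (Functor.map_preimage _ _) (Functor.map_preimage _ _))).symm))
    map_add := fun a b => (functor p).map_injective ((Functor.map_preimage _ _).trans
      ((StarFunctor.map_add (conj G _ w hw) a b).trans ((StarFunctor.map_add p _ _).trans
        (congrArg₂ (· + ·) (Functor.map_preimage _ _) (Functor.map_preimage _ _))).symm))
    map_smul := fun k a => (functor p).map_injective ((Functor.map_preimage _ _).trans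
      ((StarFunctor.map_smul (conj G _ w hw) k a).trans ((StarFunctor.map_smul p _ _).trans
        (congrArg (k • ·) (Functor.map_preimage _ _))).symm))
    map_adj := fun a => (functor p).map_injective ((Functor.map_preimage _ _).trans
      ((StarFunctor.map_adj (conj G _ w hw) a).trans ((StarFunctor.map_adj p _).trans
        (congrArg D.adj (Functor.map_preimage _ _))).symm)) }

section liftFF

variable (p : C ⟶ D) [(functor p).Full] [(functor p).Faithful] (G : B ⟶ D)
    (l : B → C) (w : ∀ b, (functor G).obj b ⟶ (functor p).obj (l b))
    (hw : ∀ b, IsUnitary (w b))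

lemma map_liftFF_map {x y : B} (a : x ⟶ y) :
    (functor p).map ((functor (liftFF p G l w hw)).map a) =
      D.adj (w x) ≫ (functor G).map a ≫ w y := Functor.map_preimage (functor p) _

end liftFF

/-- Lift a *-functor strictly along a fully faithful one, with prescribed lifts of objects. -/
noncomputable def strictLift (p : C ⟶ D) [(functor p).Full] [(functor p).Faithful] (G : B ⟶ D)
    (l : B → C) (h : ∀ b, (functor G).obj b = (functor p).obj (l b)) : B ⟶ C :=
  liftFF p G l (fun b => eqToHom (h b)) fun b => isUnitary_eqToHom (h b)

lemma strictLift_comp (p : C ⟶ D) [(functor p).Full] [(functor p).Faithful] (G : B ⟶ D)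
    (l : B → C) (h : ∀ b, (functor G).obj b = (functor p).obj (l b)) :
    strictLift p G l h ≫ p = G := by
  refine hom_ext fun {x y} a => ?_
  refine (congrArg Arrow.mk (map_liftFF_map p G l _ _ a)).trans ?_
  rw [adj_eqToHom]
  exact arrow_mk_conj_eqToHom _ _ _

lemma arrow_mk_eq_of_faithful (p : C ⟶ D) [(functor p).Faithful] {x y x' y' : C}
    (hx : x = x') (hy : y = y') {a : x ⟶ y} {b : x' ⟶ y'}
    (h : Arrow.mk ((functor p).map a) = Arrow.mk ((functor p).map b)) :
    Arrow.mk a = Arrow.mk b := by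
  subst hx hy
  exact congrArg Arrow.mk ((functor p).map_injective ((arrow_mk_eq_iff _ _).1 h))

/-- *-functors into the source of a faithful *-functor are determined by their values on objects
and their composites with the faithful one. -/
lemma hom_ext_of_faithful (p : C ⟶ D) [(functor p).Faithful] {F G : B ⟶ C}
    (hobj : ∀ x, (functor F).obj x = (functor G).obj x) (h : F ≫ p = G ≫ p) : F = G :=
  hom_ext fun a => arrow_mk_eq_of_faithful p (hobj _) (hobj _) (arrow_mk_map_congr h a)

/-- Conjugation by chosen unitaries `w` carries the identity of `B` into the image of `F` and yields
the quasi-inverse; unitarity makes it commute with the involution. The adjoints of `w`, and their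
preimages under `F`, are the components of the two isomorphisms. -/
lemma unitaryEquivalences_of_fullyFaithful (F : A ⟶ B) [(functor F).Full] [(functor F).Faithful]
    (h : ∀ y : B, ∃ (x : A) (v : y ⟶ (functor F).obj x), IsUnitary v) :
    unitaryEquivalences 𝕜 F := by
  choose l w hw using h
  let G : B ⟶ A := liftFF F (𝟙 B) l w hw
  have hG {x y : B} (b : x ⟶ y) : (functor F).map ((functor G).map b) = B.adj (w x) ≫ b ≫ w y :=
    map_liftFF_map F (𝟙 B) l w hw b
  have hu (x : A) : IsUnitary ((functor F).preimage (B.adj (w ((functor F).obj x)))) := by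
    constructor <;> refine (functor F).map_injective ?_ <;>
      rw [(functor F).map_comp, StarFunctor.map_adj F, (functor F).map_id, Functor.map_preimage]
    · exact (hw _).adj.1
    · exact (hw _).adj.2
  refine ⟨G, NatIso.ofComponents (fun x => (hu x).iso) ?_,
    NatIso.ofComponents (fun y => (hw y).adj.iso) ?_, hu, fun y => (hw y).adj⟩
  · intro x y a
    refine (functor F).map_injective ?_
    rw [(functor F).map_comp, (functor F).map_comp]
    refine (congrArg₂ (· ≫ ·) (hG ((functor F).map a)) (Functor.map_preimage (functor F) _)).trans
      (Eq.trans ?_ (congrArg (· ≫ _) (Functor.map_preimage (functor F) _).symm))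
    change (B.adj (w _) ≫ (functor F).map a ≫ w _) ≫ B.adj (w _) = B.adj (w _) ≫ (functor F).map a
    rw [Category.assoc, Category.assoc, (hw _).1, Category.comp_id]
  · intro x y b
    refine (congrArg (· ≫ _) (hG b)).trans ?_
    have : (B.adj (w x) ≫ b ≫ w y) ≫ B.adj (w y) = B.adj (w x) ≫ b := by
      rw [Category.assoc, Category.assoc, (hw y).1, Category.comp_id]
    exact this

lemma isEquivalence_of_unitaryEquivalences {F : A ⟶ B} (h : unitaryEquivalences 𝕜 F) :
    (functor F).IsEquivalence := by
  obtain ⟨G, α, β, -, -⟩ := h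
  exact (CategoryTheory.Equivalence.mk (functor F) (functor G) α.symm β).isEquivalence_functor

/-- The trivial fibrations are the fully faithful *-functors that are surjective on objects. -/
lemma trivialFibration_iff (F : A ⟶ B) :
    unitaryFibrations 𝕜 F ∧ unitaryEquivalences 𝕜 F ↔
      (functor F).Full ∧ (functor F).Faithful ∧ Function.Surjective (functor F).obj := by
  constructor
  · rintro ⟨hF, hE⟩
    have := isEquivalence_of_unitaryEquivalences hE
    refine ⟨inferInstance, inferInstance, fun y => ?_⟩
    obtain ⟨G, α, β, -, hβ⟩ := hE
    -- Lifting the unitary `F G y ⟶ y` moves `G y` to an object lying strictly over `y`.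
    obtain ⟨x', u, -, hu⟩ := hF _ _ (β.hom.app y) (hβ y)
    exact ⟨x', congrArg Comma.right hu⟩
  · rintro ⟨_, _, hs⟩
    refine ⟨fun x y v hv => ?_, unitaryEquivalences_of_fullyFaithful F fun y => ?_⟩
    · obtain ⟨x', rfl⟩ := hs y
      refine ⟨x', (functor F).preimage v, ?_, by rw [Functor.map_preimage]⟩
      constructor <;> refine (functor F).map_injective ?_ <;>
        rw [(functor F).map_comp, StarFunctor.map_adj F, (functor F).map_id, Functor.map_preimage]
      · exact hv.1
      · exact hv.2
    · obtain ⟨x, rfl⟩ := hs y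
      exact ⟨x, 𝟙 _, isUnitary_id _⟩

end CStarCat

namespace CStarCat

variable {𝕜 : Type} [RCLike 𝕜] {A B C D : CStarCat.{u} 𝕜}

/-! ### Lifting properties -/

/-- Only objects are chosen: their lifts are forced by `f` on the image of `i` and supplied by
surjectivity elsewhere. Full faithfulness then defines the arrows, and the upper triangle commutes
because it does so on objects and after composition with `p`. -/
lemma hasLiftingProperty_of_fullyFaithful (i : A ⟶ B) (hi : objInjective 𝕜 i) (p : C ⟶ D)
    [(functor p).Full] [(functor p).Faithful] (hp : Function.Surjective (functor p).obj) :
    HasLiftingProperty i p := by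
  refine ⟨fun {f g} sq => ?_⟩
  have key : ∀ b : B, ∃ c : C, (functor g).obj b = (functor p).obj c ∧
      ∀ a, (functor i).obj a = b → c = (functor f).obj a := by
    intro b
    by_cases hb : ∃ a, (functor i).obj a = b
    · obtain ⟨a, rfl⟩ := hb
      exact ⟨(functor f).obj a, (obj_congr sq.w a).symm, fun a' ha' => by rw [hi ha']⟩
    · obtain ⟨c, hc⟩ := hp ((functor g).obj b)
      exact ⟨c, hc.symm, fun a ha => (hb ⟨a, ha⟩).elim⟩
  choose l hl hl' using key
  have hfac : strictLift p g l hl ≫ p = g := strictLift_comp p g l hl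
  refine ⟨⟨⟨strictLift p g l hl, ?_, hfac⟩⟩⟩
  refine hom_ext_of_faithful p (fun a => hl' _ a rfl) ?_
  rw [Category.assoc, hfac, sq.w]

lemma arrow_mk_comp_congr {E : Type*} [Category E] {x y z x' y' z' : E} {a : x ⟶ y} {b : y ⟶ z}
    {a' : x' ⟶ y'} {b' : y' ⟶ z'} (ha : Arrow.mk a = Arrow.mk a') (hb : Arrow.mk b = Arrow.mk b') :
    Arrow.mk (a ≫ b) = Arrow.mk (a' ≫ b') := by
  cases ha
  cases hb
  rfl

lemma arrow_mk_eqToHom_comp {E : Type*} [Category E] {x y z : E} (h : x = y) (a : y ⟶ z) :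
    Arrow.mk (eqToHom h ≫ a) = Arrow.mk a := by
  subst h
  rw [eqToHom_refl, Category.id_comp]

lemma map_adj_comp_comp (F : A ⟶ B) {x y x' y' : A} (v : x ⟶ x') (a : x ⟶ y) (w : y ⟶ y') :
    (functor F).map (A.adj v ≫ a ≫ w) =
      B.adj ((functor F).map v) ≫ (functor F).map a ≫ (functor F).map w := by
  rw [(functor F).map_comp, (functor F).map_comp, StarFunctor.map_adj]

lemma IsUnitary.adj_conj_conj {x y x' y' : A} {v : x ⟶ x'} (hv : IsUnitary v) {w : y ⟶ y'}
    (hw : IsUnitary w) (a : x ⟶ y) :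
    A.adj (A.adj v) ≫ (A.adj v ≫ a ≫ w) ≫ A.adj w = a := by
  rw [A.adj_adj, Category.assoc, Category.assoc, hw.1, Category.comp_id, ← Category.assoc, hv.1,
    Category.id_comp]

lemma IsUnitary.adj_comp_self_comp {x y z : A} {v : x ⟶ y} (hv : IsUnitary v) (a : y ⟶ z) :
    A.adj v ≫ v ≫ a = a := by
  rw [← Category.assoc, hv.2, Category.id_comp]

/-- The equivalence `i` has a retraction `r` up to unitaries `w`, normalized to be identities on the
image of `i`. Then `r ≫ f` solves the problem up to the unitaries `g(w*)`; the fibration lifts these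
to unitaries `v` in `C`, and conjugation by `v` makes the solution strict. -/
lemma hasLiftingProperty_of_unitaryEquivalence (i : A ⟶ B) (hi : objInjective 𝕜 i)
    (hi' : unitaryEquivalences 𝕜 i) (p : C ⟶ D) (hp : unitaryFibrations 𝕜 p) :
    HasLiftingProperty i p := by
  refine ⟨fun {f g} sq => ?_⟩
  have := isEquivalence_of_unitaryEquivalences hi'
  -- All the data at `b` are chosen together. The last clause is the normalization on the image of
  -- `i`; it uses `Arrow.mk` because the object chosen for `i a'` is equal to `a'` only
  -- propositionally.
  have key : ∀ b : B, ∃ (a : A) (w : b ⟶ (functor i).obj a) (c : C) (v : (functor f).obj a ⟶ c),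
      IsUnitary w ∧ IsUnitary v ∧
      Arrow.mk ((functor p).map v) = Arrow.mk ((functor g).map (B.adj w)) ∧
      ∀ a', (functor i).obj a' = b → a = a' ∧ Arrow.mk w = Arrow.mk (𝟙 ((functor i).obj a')) ∧
        Arrow.mk v = Arrow.mk (𝟙 ((functor f).obj a')) := by
    intro b
    by_cases hb : ∃ a, (functor i).obj a = b
    · obtain ⟨a, rfl⟩ := hb
      refine ⟨a, 𝟙 _, _, 𝟙 _, isUnitary_id _, isUnitary_id _, ?_, fun a' ha' => ?_⟩
      · rw [(functor p).map_id, adj_id, (functor g).map_id]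
        exact congrArg (fun x : D => Arrow.mk (𝟙 x)) (obj_congr sq.w a)
      · obtain rfl := hi ha'
        exact ⟨rfl, rfl, rfl⟩
    · obtain ⟨r, -, β, -, hβ⟩ := hi'
      have hw : IsUnitary (β.hom.app b) := hβ b
      have ho : (functor p).obj ((functor f).obj ((functor r).obj b)) =
        (functor g).obj ((functor i).obj ((functor r).obj b)) := obj_congr sq.w _
      obtain ⟨c, v, hv, hpv⟩ := hp _ _ (eqToHom ho ≫ (functor g).map (β.hom.app b))
        ((isUnitary_eqToHom _).comp (hw.map g))
      refine ⟨(functor r).obj b, B.adj (β.hom.app b), c, v, hw.adj, hv, ?_,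
        fun a' ha' => (hb ⟨a', ha'⟩).elim⟩
      rw [hpv, B.adj_adj]
      exact arrow_mk_eqToHom_comp ho _
  choose s w l v hw hv hpv hl using key
  let r : B ⟶ A := liftFF i (𝟙 B) s w hw
  have hr {x y : B} (b : x ⟶ y) : (functor i).map ((functor r).map b) = B.adj (w x) ≫ b ≫ w y :=
    map_liftFF_map i (𝟙 B) s w hw b
  let L : B ⟶ C := conj (r ≫ f) l v hv
  refine ⟨⟨⟨L, hom_ext fun {x y} a => ?_, hom_ext fun {x y} b => ?_⟩⟩⟩
  · have aux : ∀ {s₁ s₂ : A} (h₁ : s₁ = x) (h₂ : s₂ = y)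
        {w₁ : (functor i).obj x ⟶ (functor i).obj s₁} {w₂ : (functor i).obj y ⟶ (functor i).obj s₂}
        {l₁ l₂ : C} {v₁ : (functor f).obj s₁ ⟶ l₁} {v₂ : (functor f).obj s₂ ⟶ l₂} {m : s₁ ⟶ s₂},
        Arrow.mk w₁ = Arrow.mk (𝟙 ((functor i).obj x)) →
        Arrow.mk w₂ = Arrow.mk (𝟙 ((functor i).obj y)) →
        Arrow.mk v₁ = Arrow.mk (𝟙 ((functor f).obj x)) →
        Arrow.mk v₂ = Arrow.mk (𝟙 ((functor f).obj y)) →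
        (functor i).map m = B.adj w₁ ≫ (functor i).map a ≫ w₂ →
        Arrow.mk (C.adj v₁ ≫ (functor f).map m ≫ v₂) = Arrow.mk ((functor f).map a) := by
      rintro s₁ s₂ rfl rfl w₁ w₂ l₁ l₂ v₁ v₂ m hw₁ hw₂ hv₁ hv₂ hm
      rw [arrow_mk_eq_iff] at hw₁ hw₂
      subst hw₁ hw₂
      rw [adj_id, Category.id_comp, Category.comp_id] at hm
      obtain rfl := (functor i).map_injective hm
      have h := arrow_mk_comp_congr (arrow_mk_adj_congr hv₁)
        (arrow_mk_comp_congr (a := (functor f).map m) rfl hv₂)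
      rw [adj_id, Category.id_comp, Category.comp_id] at h
      exact h
    obtain ⟨h₁, hw₁, hv₁⟩ := hl _ x rfl
    obtain ⟨h₂, hw₂, hv₂⟩ := hl _ y rfl
    exact aux h₁ h₂ hw₁ hw₂ hv₁ hv₂ (hr _)
  · have h1 : (functor (L ≫ p)).map b = D.adj ((functor p).map (v x)) ≫
        (functor p).map ((functor f).map ((functor r).map b)) ≫ (functor p).map (v y) :=
      map_adj_comp_comp p (v x) ((functor f).map ((functor r).map b)) (v y)
    refine (congrArg Arrow.mk h1).trans ?_
    refine (arrow_mk_comp_congr (arrow_mk_adj_congr (hpv x)) (arrow_mk_comp_congr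
      (arrow_mk_map_congr sq.w ((functor r).map b)) (hpv y))).trans ?_
    have h2 : (functor (i ≫ g)).map ((functor r).map b) =
        (functor g).map (B.adj (w x) ≫ b ≫ w y) := congrArg (functor g).map (hr b)
    -- Conjugation by `g(w*)` undoes the conjugation by `w` built into `r`.
    have h3 := (map_adj_comp_comp g (B.adj (w x)) (B.adj (w x) ≫ b ≫ w y) (B.adj (w y))).symm.trans
      (congrArg (functor g).map ((hw x).adj_conj_conj (hw y) b))
    exact congrArg Arrow.mk ((congrArg (fun m => D.adj ((functor g).map (B.adj (w x))) ≫ m ≫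
      (functor g).map (B.adj (w y))) h2).trans h3)

/-! ### Pulled back C*-categories -/

section Pull

variable {X : Type u} (o : X → A)

instance : (functor (A.pullForget o)).Full where
  map_surjective a := ⟨a, rfl⟩

instance : (functor (A.pullForget o)).Faithful where
  map_injective h := h

end Pull

/-! ### The two functorial factorizations -/

section Factorization

/-- The mapping cylinder of a *-functor: objects of both categories, and homs of the target. -/
def cyl (F : A ⟶ B) : CStarCat.{u} 𝕜 := B.pull (Sum.elim (functor F).obj id)

/-- The fully faithful *-functor from the mapping cylinder to the target. -/
def cylProj (F : A ⟶ B) : cyl F ⟶ B := B.pullForget _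

instance (F : A ⟶ B) : (functor (cylProj F)).Full :=
  inferInstanceAs (functor (B.pullForget _)).Full

instance (F : A ⟶ B) : (functor (cylProj F)).Faithful :=
  inferInstanceAs (functor (B.pullForget _)).Faithful

lemma cylProj_surjective (F : A ⟶ B) : Function.Surjective (functor (cylProj F)).obj := fun y =>
  ⟨(Sum.inr y : A ⊕ B), rfl⟩

lemma trivialFibration_cylProj (F : A ⟶ B) :
    unitaryFibrations 𝕜 (cylProj F) ∧ unitaryEquivalences 𝕜 (cylProj F) :=
  (trivialFibration_iff (cylProj F)).2 ⟨inferInstance, inferInstance, cylProj_surjective F⟩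

/-- The inclusion of the source in the mapping cylinder. -/
noncomputable def cylIncl (F : A ⟶ B) : A ⟶ cyl F :=
  strictLift (cylProj F) F (fun x => (Sum.inl x : A ⊕ B)) fun _ => rfl

lemma objInjective_cylIncl (F : A ⟶ B) : objInjective 𝕜 (cylIncl F) := fun _ _ h =>
  Sum.inl_injective h

/-- Functoriality of the mapping cylinder. -/
noncomputable def cylMap {F G : Arrow (CStarCat.{u} 𝕜)} (φ : F ⟶ G) : cyl F.hom ⟶ cyl G.hom :=
  strictLift (cylProj G.hom) (cylProj F.hom ≫ φ.right)
    (fun x : F.left ⊕ F.right => (Sum.map (functor φ.left).obj (functor φ.right).obj x :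
      G.left ⊕ G.right)) (by
    rintro (x | y)
    · exact (obj_congr φ.w x).symm
    · rfl)

lemma cylMap_cylProj {F G : Arrow (CStarCat.{u} 𝕜)} (φ : F ⟶ G) :
    cylMap φ ≫ cylProj G.hom = cylProj F.hom ≫ φ.right := strictLift_comp _ _ _ _

/-- The functorial factorization through the mapping cylinder. -/
noncomputable def cylFactorization : MorphismProperty.FunctorialFactorizationData
    (objInjective.{u} 𝕜) (unitaryFibrations.{u} 𝕜 ⊓ unitaryEquivalences.{u} 𝕜) where
  Z :=
    { obj := fun F => cyl F.hom
      map := cylMap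
      map_id := fun F => by
        refine hom_ext_of_faithful (cylProj F.hom) ?_ ?_
        · rintro (x | y) <;> rfl
        · exact (cylMap_cylProj _).trans ((Category.comp_id _).trans (Category.id_comp _).symm)
      map_comp := fun {F G H} φ ψ => by
        refine hom_ext_of_faithful (cylProj H.hom) ?_ ?_
        · rintro (x | y) <;> rfl
        · rw [cylMap_cylProj, Category.assoc, cylMap_cylProj, ← Category.assoc, cylMap_cylProj,
            Category.assoc]
          rfl }
  i :=
    { app := fun F => cylIncl F.hom
      naturality := fun F G φ => by
        refine hom_ext_of_faithful (cylProj G.hom) (fun x => rfl) ?_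
        refine (Category.assoc _ _ _).trans (Eq.trans ?_ (Category.assoc _ _ _).symm)
        refine (congrArg (φ.left ≫ ·) (strictLift_comp _ _ _ _)).trans ?_
        refine Eq.trans ?_ (congrArg (cylIncl F.hom ≫ ·) (cylMap_cylProj φ).symm)
        refine Eq.trans ?_ (Category.assoc _ _ _)
        exact φ.w.trans (congrArg (· ≫ φ.right) (strictLift_comp _ _ _ _).symm) }
  p :=
    { app := fun F => cylProj F.hom
      naturality := fun F G φ => cylMap_cylProj φ }
  fac := by
    ext F : 2
    exact strictLift_comp (cylProj F.hom) F.hom _ _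
  hi F := objInjective_cylIncl F.hom
  hp F := trivialFibration_cylProj F.hom

/-- The objects of the path construction of a *-functor. -/
structure PathObj (F : A ⟶ B) : Type u where
  /-- The source component. -/
  x : A
  /-- The target component. -/
  y : B
  /-- The connecting unitary. -/
  v : (functor F).obj x ⟶ y
  isUnitary : IsUnitary v

lemma PathObj.ext' {F : A ⟶ B} {p q : PathObj F} (hx : p.x = q.x)
    (hv : Arrow.mk p.v = Arrow.mk q.v) : p = q := by
  obtain ⟨x, y, v, h⟩ := p
  obtain ⟨x', y', v', h'⟩ := q
  dsimp only at hx
  subst hx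
  have hy : y = y' := congrArg Comma.right hv
  subst hy
  obtain rfl := (arrow_mk_eq_iff _ _).1 hv
  rfl

/-- The path construction of a *-functor: homs are those of the source. -/
def path (F : A ⟶ B) : CStarCat.{u} 𝕜 := A.pull (PathObj.x (F := F))

/-- The projection of the path construction to the source. -/
def pathForget (F : A ⟶ B) : path F ⟶ A := A.pullForget _

instance (F : A ⟶ B) : (functor (pathForget F)).Full :=
  inferInstanceAs (functor (A.pullForget _)).Full

instance (F : A ⟶ B) : (functor (pathForget F)).Faithful :=
  inferInstanceAs (functor (A.pullForget _)).Faithful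

/-- The inclusion of the source in the path construction. -/
noncomputable def pathIncl (F : A ⟶ B) : A ⟶ path F :=
  strictLift (pathForget F) (𝟙 A) (fun x => (⟨x, _, 𝟙 _, isUnitary_id _⟩ : PathObj F)) fun _ => rfl

lemma pathIncl_pathForget (F : A ⟶ B) : pathIncl F ≫ pathForget F = 𝟙 A :=
  strictLift_comp _ _ _ _

lemma objInjective_pathIncl (F : A ⟶ B) : objInjective 𝕜 (pathIncl F) := fun _ _ h =>
  congrArg PathObj.x h

/-- `pathIncl` is a section of `pathForget`, which is fully faithful and surjective on objects;
two-out-of-three concludes. -/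
lemma unitaryEquivalences_pathIncl (F : A ⟶ B) : unitaryEquivalences 𝕜 (pathIncl F) := by
  have h1 : unitaryEquivalences 𝕜 (pathForget F) :=
    ((trivialFibration_iff (pathForget F)).2 ⟨inferInstance, inferInstance, fun x =>
      ⟨(⟨x, _, 𝟙 _, isUnitary_id _⟩ : PathObj F), rfl⟩⟩).2
  refine (unitaryEquivalences 𝕜).of_postcomp _ _ h1 ?_
  rw [pathIncl_pathForget]
  exact (unitaryEquivalences 𝕜).id_mem A

/-- The projection of the path construction to the target. -/
def pathProj (F : A ⟶ B) : path F ⟶ B :=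
  conj (pathForget F ≫ F) (PathObj.y (F := F)) (PathObj.v (F := F)) (PathObj.isUnitary (F := F))

/-- A unitary `u : y ⟶ z` is absorbed into the connecting unitary: `(x, y, v)` becomes `(x, z, v ≫
u)`, and the identity of `x` lies over `u`. -/
lemma unitaryFibrations_pathProj (F : A ⟶ B) : unitaryFibrations 𝕜 (pathProj F) := by
  intro q z u hu
  let q' : PathObj F := ⟨PathObj.x (F := F) q, z, PathObj.v (F := F) q ≫ u,
    (PathObj.isUnitary (F := F) q).comp hu⟩
  refine ⟨q', (𝟙 (PathObj.x (F := F) q) : _), isUnitary_id (A := A) _, congrArg Arrow.mk ?_⟩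
  have h : B.adj (PathObj.v (F := F) q) ≫ (functor F).map (𝟙 (PathObj.x (F := F) q)) ≫
      PathObj.v (F := F) q ≫ u = u := by
    rw [(functor F).map_id, Category.id_comp]
    exact (PathObj.isUnitary (F := F) q).adj_comp_self_comp u
  exact h

/-- Functoriality of the objects of the path construction. -/
def pathMapObj {F G : Arrow (CStarCat.{u} 𝕜)} (φ : F ⟶ G) (q : PathObj F.hom) : PathObj G.hom where
  x := (functor φ.left).obj q.x
  y := (functor φ.right).obj q.y
  v := eqToHom (obj_congr φ.w q.x) ≫ (functor φ.right).map q.v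
  isUnitary := (isUnitary_eqToHom _).comp (q.isUnitary.map φ.right)

lemma arrow_mk_pathMapObj_v {F G : Arrow (CStarCat.{u} 𝕜)} (φ : F ⟶ G) (q : PathObj F.hom) :
    Arrow.mk (pathMapObj φ q).v = Arrow.mk ((functor φ.right).map q.v) :=
  arrow_mk_eqToHom_comp _ _

/-- Functoriality of the path construction. -/
noncomputable def pathMap {F G : Arrow (CStarCat.{u} 𝕜)} (φ : F ⟶ G) : path F.hom ⟶ path G.hom :=
  strictLift (pathForget G.hom) (pathForget F.hom ≫ φ.left) (pathMapObj φ) fun _ => rfl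

lemma pathMap_pathForget {F G : Arrow (CStarCat.{u} 𝕜)} (φ : F ⟶ G) :
    pathMap φ ≫ pathForget G.hom = pathForget F.hom ≫ φ.left := strictLift_comp _ _ _ _

lemma pathMap_pathProj {F G : Arrow (CStarCat.{u} 𝕜)} (φ : F ⟶ G) :
    pathMap φ ≫ pathProj G.hom = pathProj F.hom ≫ φ.right := by
  refine hom_ext fun {p q} a => ?_
  have h1 : Arrow.mk ((functor (pathMap φ ≫ pathForget G.hom ≫ G.hom)).map a) =
      Arrow.mk ((functor (pathForget F.hom ≫ F.hom ≫ φ.right)).map a) := by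
    refine arrow_mk_map_congr ?_ a
    rw [← Category.assoc, pathMap_pathForget, Category.assoc]
    exact congrArg (pathForget F.hom ≫ ·) φ.w
  have h2 := arrow_mk_comp_congr (arrow_mk_adj_congr (arrow_mk_pathMapObj_v φ p))
    (arrow_mk_comp_congr h1 (arrow_mk_pathMapObj_v φ q))
  refine h2.trans (congrArg Arrow.mk ?_)
  rw [← StarFunctor.map_adj]
  exact ((congrArg (_ ≫ ·) ((functor φ.right).map_comp _ _).symm).trans
    ((functor φ.right).map_comp _ _).symm)

/-- The functorial factorization through the path construction. -/
noncomputable def pathFactorization : MorphismProperty.FunctorialFactorizationData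
    (objInjective.{u} 𝕜 ⊓ unitaryEquivalences.{u} 𝕜) (unitaryFibrations.{u} 𝕜) where
  Z :=
    { obj := fun F => path F.hom
      map := pathMap
      map_id := fun F => by
        refine hom_ext_of_faithful (pathForget F.hom) (fun q => ?_) ?_
        · exact PathObj.ext' rfl (arrow_mk_pathMapObj_v (𝟙 F) q)
        · exact (pathMap_pathForget _).trans ((Category.comp_id _).trans (Category.id_comp _).symm)
      map_comp := fun {F G H} φ ψ => by
        refine hom_ext_of_faithful (pathForget H.hom) (fun q => ?_) ?_
        · refine PathObj.ext' rfl ((arrow_mk_pathMapObj_v _ q).trans ?_)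
          exact ((arrow_mk_pathMapObj_v ψ _).trans
            (map_arrow_congr ψ.right (arrow_mk_pathMapObj_v φ q))).symm
        · rw [pathMap_pathForget, Category.assoc, pathMap_pathForget, ← Category.assoc,
            pathMap_pathForget, Category.assoc]
          rfl }
  i :=
    { app := fun F => pathIncl F.hom
      naturality := fun F G φ => by
        refine hom_ext_of_faithful (pathForget G.hom) (fun x => ?_) ?_
        · refine PathObj.ext' rfl (Eq.trans ?_ (arrow_mk_pathMapObj_v φ _).symm)
          refine Eq.trans ?_ (congrArg Arrow.mk ((functor φ.right).map_id _).symm)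
          exact congrArg (fun x => Arrow.mk (𝟙 x)) (obj_congr φ.w x)
        · refine (Category.assoc _ _ _).trans (Eq.trans ?_ (Category.assoc _ _ _).symm)
          refine (congrArg (φ.left ≫ ·) (pathIncl_pathForget _)).trans ?_
          refine Eq.trans ?_ (congrArg (pathIncl F.hom ≫ ·) (pathMap_pathForget φ).symm)
          refine Eq.trans ?_ (Category.assoc _ _ _)
          refine (Category.comp_id _).trans ((Category.id_comp _).symm.trans ?_)
          exact congrArg (· ≫ φ.left) (pathIncl_pathForget _).symm }
  p :=
    { app := fun F => pathProj F.hom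
      naturality := fun F G φ => pathMap_pathProj φ }
  fac := by
    ext F : 2
    refine hom_ext fun {x y} a => congrArg Arrow.mk ?_
    have h : F.right.adj (𝟙 ((functor F.hom).obj x)) ≫ (functor F.hom).map a ≫ 𝟙 _ =
        (functor F.hom).map a := by
      rw [adj_id, Category.id_comp, Category.comp_id]
    refine Eq.trans ?_ h
    refine congrArg (fun b => F.right.adj (𝟙 ((functor F.hom).obj x)) ≫ b ≫ 𝟙 _) ?_
    refine congrArg (functor F.hom).map ?_
    exact (arrow_mk_eq_iff _ _).1 (arrow_mk_map_congr (pathIncl_pathForget F.hom) a)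
  hi F := ⟨objInjective_pathIncl F.hom, unitaryEquivalences_pathIncl F.hom⟩
  hp F := unitaryFibrations_pathProj F.hom

end Factorization

end CStarCat

namespace CStarCat

variable {𝕜 : Type} [RCLike 𝕜] {A B C D : CStarCat.{u} 𝕜}

/-! ### Mapping properties of the generators -/

lemma Sends.src {F : A ⟶ B} {x y : A} {a : x ⟶ y} {x' y' : B} {b : x' ⟶ y'} (h : Sends F a b) :
    (functor F).obj x = x' := congrArg Comma.left h

lemma Sends.tgt {F : A ⟶ B} {x y : A} {a : x ⟶ y} {x' y' : B} {b : x' ⟶ y'} (h : Sends F a b) :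
    (functor F).obj y = y' := congrArg Comma.right h

lemma Sends.comp {F : A ⟶ B} {G : B ⟶ C} {x y : A} {a : x ⟶ y} {x' y' : B} {b : x' ⟶ y'}
    (h : Sends F a b) : Sends (F ≫ G) a ((functor G).map b) := map_arrow_congr G h

lemma exists_arrow_lift (p : C ⟶ D) [(functor p).Full] {x y : C} {x' y' : D} (b : x' ⟶ y')
    (hx : (functor p).obj x = x') (hy : (functor p).obj y = y') :
    ∃ c : x ⟶ y, Sends p c b := by
  subst hx hy
  obtain ⟨c, hc⟩ := (functor p).map_surjective b
  exact ⟨c, congrArg Arrow.mk hc⟩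

lemma norm_eq_of_arrow_mk_eq {x y x' y' : A} {a : x ⟶ y} {b : x' ⟶ y'}
    (h : Arrow.mk a = Arrow.mk b) : ‖a‖ = ‖b‖ := by
  cases h
  rfl

lemma empty_hom_ext (F G : empty.{u} 𝕜 ⟶ A) : F = G :=
  hom_ext fun {x} => PEmpty.elim x

namespace Generators

variable (G : Generators.{u} 𝕜)

lemma two_hom_ext {F F' : G.two ⟶ A} (h₁ : G.inl ≫ F = G.inl ≫ F')
    (h₂ : G.inr ≫ F = G.inr ≫ F') : F = F' :=
  BinaryCofan.IsColimit.hom_ext G.isCoproduct.some h₁ h₂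

lemma exists_two_hom (x y : A) : ∃ F : G.two ⟶ A, G.inl ≫ F = ofObj x ∧ G.inr ≫ F = ofObj y :=
  ⟨_, (BinaryCofan.IsColimit.desc' G.isCoproduct.some (ofObj x) (ofObj y)).2⟩

lemma one_hom_ext {F F' : G.one ⟶ A}
    (h : Arrow.mk ((functor F).map G.arr) = Arrow.mk ((functor F').map G.arr)) : F = F' :=
  (G.isUniversal_arr.existsUnique A ((functor F').map G.arr)
    ((norm_map_le F' _).trans G.isUniversal_arr.norm_le)).unique h rfl

lemma exists_one_hom {x y : A} (a : x ⟶ y) (ha : ‖a‖ ≤ 1) : ∃ F : G.one ⟶ A, Sends F G.arr a :=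
  (G.isUniversal_arr.existsUnique A a ha).exists

lemma norm_map_arr_le (F : G.one ⟶ A) : ‖(functor F).map G.arr‖ ≤ 1 :=
  (norm_map_le F _).trans G.isUniversal_arr.norm_le

lemma inl_V_comp (F : G.one ⟶ A) : G.inl ≫ G.V ≫ F = ofObj ((functor F).obj G.s) := by
  rw [← Category.assoc, G.inl_V, ofObj_comp]

lemma inr_V_comp (F : G.one ⟶ A) : G.inr ≫ G.V ≫ F = ofObj ((functor F).obj G.t) := by
  rw [← Category.assoc, G.inr_V, ofObj_comp]

lemma V_comp_eq {F : G.two ⟶ A} {F' : G.one ⟶ A} {x y : A} (h₁ : G.inl ≫ F = ofObj x)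
    (h₂ : G.inr ≫ F = ofObj y) (hx : (functor F').obj G.s = x) (hy : (functor F').obj G.t = y) :
    F = G.V ≫ F' := by
  subst hx hy
  exact G.two_hom_ext (h₁.trans (G.inl_V_comp F').symm) (h₂.trans (G.inr_V_comp F').symm)

lemma V_comp_eq_V_comp_iff {F F' : G.one ⟶ A} : G.V ≫ F = G.V ≫ F' ↔
    (functor F).obj G.s = (functor F').obj G.s ∧ (functor F).obj G.t = (functor F').obj G.t := by
  refine ⟨fun h => ⟨?_, ?_⟩, fun h => G.V_comp_eq (G.inl_V_comp F) (G.inr_V_comp F) h.1.symm h.2.symm⟩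
  · exact ofObj_injective (((G.inl_V_comp F).symm.trans (congrArg (G.inl ≫ ·) h)).trans
      (G.inl_V_comp F'))
  · exact ofObj_injective (((G.inr_V_comp F).symm.trans (congrArg (G.inr ≫ ·) h)).trans
      (G.inr_V_comp F'))

lemma exists_interval_hom {x y : A} {a : x ⟶ y} (ha : IsUnitary a) :
    ∃ F : G.interval ⟶ A, Sends F G.unitary a :=
  (G.isUniversal_unitary.existsUnique A a ha).exists

lemma interval_hom_ext {F F' : G.interval ⟶ A}
    (h : Arrow.mk ((functor F).map G.unitary) = Arrow.mk ((functor F').map G.unitary)) : F = F' :=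
  (G.isUniversal_unitary.existsUnique A ((functor F').map G.unitary)
    (G.isUniversal_unitary.isUnitary.map F')).unique h rfl

/-- The map out of `P` given by two parallel contractions. -/
lemma exists_P_hom (F F' : G.one ⟶ A) (hs : (functor F).obj G.s = (functor F').obj G.s)
    (ht : (functor F).obj G.t = (functor F').obj G.t) :
    ∃ H : G.P ⟶ A, G.in₁ ≫ H = F ∧ G.in₂ ≫ H = F' :=
  G.isPushout.exists_desc F F' (G.V_comp_eq_V_comp_iff.2 ⟨hs, ht⟩)

end Generators

/-! ### The generating maps detect the fibrations and the trivial fibrations -/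

variable (G : Generators.{u} 𝕜)

lemma rlp_J_iff (p : C ⟶ D) : G.J.rlp p ↔ HasLiftingProperty (ofObj G.i₀) p :=
  MorphismProperty.rlp_ofHoms_iff_hasLiftingProperty _ _ _

lemma rlp_I_iff (p : C ⟶ D) : G.I.rlp p ↔ HasLiftingProperty (fromEmpty (base.{u} 𝕜)) p ∧
    HasLiftingProperty G.V p ∧ HasLiftingProperty G.W p := by
  constructor
  · intro h
    exact ⟨h _ (Or.inl (Or.inl (MorphismProperty.prop_single _))),
      h _ (Or.inl (Or.inr (MorphismProperty.prop_single _))),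
      h _ (Or.inr (MorphismProperty.prop_single _))⟩
  · rintro ⟨h₁, h₂, h₃⟩ X Y f ((⟨⟨⟩⟩ | ⟨⟨⟩⟩) | ⟨⟨⟩⟩)
    exacts [h₁, h₂, h₃]

/-- A lifting problem against `ofObj G.i₀` is an object `x` of `C` with a unitary out of `p x`; a
solution is a unitary out of `x` above it. The `eqToHom` absorbs the commutativity of the square on
objects. -/
lemma unitaryFibrations_eq_rlp_J : unitaryFibrations.{u} 𝕜 = G.J.rlp := by
  ext C D p
  rw [rlp_J_iff]
  constructor
  · refine fun hp => ⟨fun {f g} sq => ?_⟩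
    have h₀ : (functor g).obj G.i₀ = (functor p).obj ((functor f).obj .pt) :=
      (obj_congr sq.w .pt).symm
    obtain ⟨y, u, hu, hpu⟩ := hp ((functor f).obj .pt) _
      (eqToHom h₀.symm ≫ (functor g).map G.unitary)
      ((isUnitary_eqToHom _).comp (G.isUniversal_unitary.isUnitary.map g))
    obtain ⟨l, hl⟩ := G.exists_interval_hom hu
    refine ⟨⟨l, ?_, G.interval_hom_ext ?_⟩⟩
    · rw [ofObj_comp, hl.src]
      exact (base_hom_eq f).symm
    · exact (hl.comp (G := p)).trans (hpu.trans (arrow_mk_eqToHom_comp _ _))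
  · intro hp x y v hv
    obtain ⟨g, hg⟩ := G.exists_interval_hom hv
    have sq : CommSq (ofObj x) (ofObj G.i₀) p g := ⟨by rw [ofObj_comp, ofObj_comp, hg.src]⟩
    have h₁ : (functor sq.lift).obj G.i₀ = x :=
      ofObj_injective ((ofObj_comp _).symm.trans sq.fac_left)
    have h₂ := (arrow_mk_map_congr sq.fac_right G.unitary).trans hg
    generalize sq.lift = l at h₁ h₂
    subst h₁
    exact ⟨_, (functor l).map G.unitary, G.isUniversal_unitary.isUnitary.map l, h₂⟩

/-- Parallel arrows with the same image, rescaled to contractions, form a map out of `P`. A lift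
factors it through `W`, which identifies its two components. -/
lemma faithful_of_hasLiftingProperty_W (p : C ⟶ D) [HasLiftingProperty G.W p] :
    (functor p).Faithful where
  map_injective {x y} a b hab := by
    obtain ⟨k, hk, hka, hkb⟩ : ∃ k : 𝕜, k ≠ 0 ∧ ‖k • a‖ ≤ 1 ∧ ‖k • b‖ ≤ 1 := by
      have ha := norm_nonneg a
      have hb := norm_nonneg b
      have hr : 0 < ‖a‖ + ‖b‖ + 1 := by positivity
      -- The summand `1` keeps the scalar nonzero when both arrows vanish.
      refine ⟨(((‖a‖ + ‖b‖ + 1)⁻¹ : ℝ) : 𝕜), ?_, ?_, ?_⟩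
      · exact_mod_cast (inv_pos.2 hr).ne'
      all_goals
        rw [norm_smul, RCLike.norm_ofReal, abs_of_pos (inv_pos.2 hr), inv_mul_le_one₀ hr]
        linarith
    obtain ⟨F, hF⟩ := G.exists_one_hom _ hka
    obtain ⟨F', hF'⟩ := G.exists_one_hom _ hkb
    obtain ⟨H, hH, hH'⟩ := G.exists_P_hom F F' (hF.src.trans hF'.src.symm)
      (hF.tgt.trans hF'.tgt.symm)
    have hp : F' ≫ p = F ≫ p := by
      refine G.one_hom_ext ((hF'.comp (G := p)).trans (Eq.trans ?_ (hF.comp (G := p)).symm))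
      rw [StarFunctor.map_smul, StarFunctor.map_smul, hab]
    have sq : CommSq H G.W p (F ≫ p) := ⟨G.isPushout.hom_ext
      (by rw [← Category.assoc, hH, ← Category.assoc, G.in₁_W, Category.id_comp])
      (by rw [← Category.assoc, hH', ← Category.assoc, G.in₂_W, Category.id_comp, hp])⟩
    have hW := sq.fac_left
    generalize sq.lift = l at hW
    have h₁ : F = F' := by
      rw [← hH, ← hH', ← hW, ← Category.assoc, G.in₁_W, ← Category.assoc, G.in₂_W]
    have h := hF.symm.trans ((arrow_mk_map_congr h₁ G.arr).trans hF')
    exact smul_right_injective _ hk ((arrow_mk_eq_iff _ _).1 h)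

/-- A rescaled arrow is a map out of `one`, and lifts of its endpoints are a map out of `two`; the
diagonal is a preimage, to be scaled back. -/
lemma full_of_hasLiftingProperty_V (p : C ⟶ D) [HasLiftingProperty G.V p] :
    (functor p).Full where
  map_surjective {x y} b := by
    obtain ⟨k, hk, hkb⟩ : ∃ k : 𝕜, k ≠ 0 ∧ ‖k • b‖ ≤ 1 := by
      have hb := norm_nonneg b
      have hr : 0 < ‖b‖ + 1 := by positivity
      refine ⟨(((‖b‖ + 1)⁻¹ : ℝ) : 𝕜), ?_, ?_⟩
      · exact_mod_cast (inv_pos.2 hr).ne'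
      · rw [norm_smul, RCLike.norm_ofReal, abs_of_pos (inv_pos.2 hr), inv_mul_le_one₀ hr]
        linarith
    obtain ⟨g, hg⟩ := G.exists_one_hom _ hkb
    obtain ⟨f, hf₁, hf₂⟩ := G.exists_two_hom x y
    have sq : CommSq f G.V p g := ⟨by
      refine G.V_comp_eq ?_ ?_ hg.src hg.tgt
      · rw [← Category.assoc, hf₁, ofObj_comp]
      · rw [← Category.assoc, hf₂, ofObj_comp]⟩
    have h₁ : (functor sq.lift).obj G.s = x := ofObj_injective
      ((G.inl_V_comp _).symm.trans ((congrArg (G.inl ≫ ·) sq.fac_left).trans hf₁))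
    have h₂ : (functor sq.lift).obj G.t = y := ofObj_injective
      ((G.inr_V_comp _).symm.trans ((congrArg (G.inr ≫ ·) sq.fac_left).trans hf₂))
    have h₃ := (arrow_mk_map_congr sq.fac_right G.arr).trans hg
    generalize sq.lift = l at h₁ h₂ h₃
    subst h₁ h₂
    refine ⟨k⁻¹ • (functor l).map G.arr, ?_⟩
    rw [StarFunctor.map_smul]
    have h₄ : (functor p).map ((functor l).map G.arr) = k • b := (arrow_mk_eq_iff _ _).1 h₃
    rw [h₄, smul_smul, inv_mul_cancel₀ hk, one_smul]

lemma surjective_of_hasLiftingProperty_fromEmpty (p : C ⟶ D)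
    [HasLiftingProperty (fromEmpty (base.{u} 𝕜)) p] : Function.Surjective (functor p).obj := by
  intro y
  have sq : CommSq (fromEmpty C) (fromEmpty (base 𝕜)) p (ofObj y) := ⟨empty_hom_ext _ _⟩
  exact ⟨(functor sq.lift).obj .pt, obj_congr sq.fac_right .pt⟩

lemma trivialFibrations_eq_rlp_I :
    unitaryFibrations.{u} 𝕜 ⊓ unitaryEquivalences.{u} 𝕜 = G.I.rlp := by
  ext C D p
  refine (trivialFibration_iff p).trans ?_
  rw [rlp_I_iff]
  constructor
  · rintro ⟨h₁, h₂, h₃⟩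
    refine ⟨⟨fun {f g} sq => ?_⟩, ⟨fun {f g} sq => ?_⟩, ⟨fun {f g} sq => ?_⟩⟩
    · obtain ⟨x, hx⟩ := h₃ ((functor g).obj .pt)
      refine ⟨⟨ofObj x, empty_hom_ext _ _, ?_⟩⟩
      rw [ofObj_comp, hx]
      exact (base_hom_eq g).symm
    · have hl : G.inl ≫ f = ofObj ((functor (G.inl ≫ f)).obj .pt) := base_hom_eq _
      have hr : G.inr ≫ f = ofObj ((functor (G.inr ≫ f)).obj .pt) := base_hom_eq _
      generalize (functor (G.inl ≫ f)).obj .pt = x at hl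
      generalize (functor (G.inr ≫ f)).obj .pt = y at hr
      have hx : (functor p).obj x = (functor g).obj G.s := by
        apply ofObj_injective
        rw [← ofObj_comp, ← hl, ← G.inl_V_comp, Category.assoc, sq.w]
      have hy : (functor p).obj y = (functor g).obj G.t := by
        apply ofObj_injective
        rw [← ofObj_comp, ← hr, ← G.inr_V_comp, Category.assoc, sq.w]
      obtain ⟨c, hc⟩ := exists_arrow_lift p ((functor g).map G.arr) hx hy
      -- The lifted arrow must again be a contraction, so it matters that fully faithful *-functors
      -- are isometric.
      obtain ⟨l, hl'⟩ := G.exists_one_hom c (by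
        rw [← norm_map_of_fullyFaithful p, norm_eq_of_arrow_mk_eq hc]
        exact G.norm_map_arr_le g)
      exact ⟨⟨l, (G.V_comp_eq hl hr hl'.src hl'.tgt).symm, G.one_hom_ext
        ((hl'.comp (G := p)).trans hc)⟩⟩
    · have hV : G.V ≫ G.in₂ ≫ f = G.V ≫ G.in₁ ≫ f := by
        rw [← Category.assoc, ← Category.assoc, G.isPushout.w]
      obtain ⟨hs, ht⟩ := G.V_comp_eq_V_comp_iff.1 hV
      have h₄ : (G.in₁ ≫ f) ≫ p = g := by
        rw [Category.assoc, sq.w, ← Category.assoc, G.in₁_W, Category.id_comp]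
      have h₅ : (G.in₂ ≫ f) ≫ p = g := by
        rw [Category.assoc, sq.w, ← Category.assoc, G.in₂_W, Category.id_comp]
      have h₆ : G.in₂ ≫ f = G.in₁ ≫ f := G.one_hom_ext (arrow_mk_eq_of_faithful p hs ht
        (arrow_mk_map_congr (h₅.trans h₄.symm) G.arr))
      refine ⟨⟨G.in₁ ≫ f, G.isPushout.hom_ext ?_ ?_, h₄⟩⟩
      · rw [← Category.assoc, G.in₁_W, Category.id_comp]
      · rw [← Category.assoc, G.in₂_W, Category.id_comp, h₆]
  · rintro ⟨h₁, h₂, h₃⟩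
    exact ⟨full_of_hasLiftingProperty_V G p, faithful_of_hasLiftingProperty_W G p,
      surjective_of_hasLiftingProperty_fromEmpty p⟩

/-! ### The model structure -/

/-- A class given by a right lifting property is stable under retracts; any choice of generators
will do. -/
instance : (unitaryFibrations.{u} 𝕜).IsStableUnderRetracts := by
  rw [unitaryFibrations_eq_rlp_J nonempty_generators.some]
  infer_instance

instance : MorphismProperty.HasFunctorialFactorization
    (objInjective.{u} 𝕜) (unitaryFibrations.{u} 𝕜 ⊓ unitaryEquivalences.{u} 𝕜) :=
  ⟨⟨cylFactorization⟩⟩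

instance : MorphismProperty.HasFunctorialFactorization
    (objInjective.{u} 𝕜 ⊓ unitaryEquivalences.{u} 𝕜) (unitaryFibrations.{u} 𝕜) :=
  ⟨⟨pathFactorization⟩⟩

/-- The unitary model structure. -/
@[reducible] def unitaryModelStructure (𝕜 : Type) [RCLike 𝕜] :
    ModelCategory (CStarCat.{u} 𝕜) where
  categoryWithFibrations := ⟨unitaryFibrations 𝕜⟩
  categoryWithCofibrations := ⟨objInjective 𝕜⟩
  categoryWithWeakEquivalences := ⟨unitaryEquivalences 𝕜⟩
  cm1a := inferInstance
  cm1b := inferInstance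
  cm2 := inferInstanceAs (unitaryEquivalences 𝕜).HasTwoOutOfThreeProperty
  cm3a := inferInstanceAs (unitaryEquivalences 𝕜).IsStableUnderRetracts
  cm3b := inferInstanceAs (unitaryFibrations 𝕜).IsStableUnderRetracts
  cm3c := inferInstanceAs (objInjective 𝕜).IsStableUnderRetracts
  cm4a i p hi hi' hp := hasLiftingProperty_of_unitaryEquivalence i hi.mem hi'.mem p hp.mem
  cm4b i p hi hp hp' := by
    obtain ⟨_, _, h⟩ := (trivialFibration_iff p).1 ⟨hp.mem, hp'.mem⟩
    exact hasLiftingProperty_of_fullyFaithful i hi.mem p h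
  cm5a := inferInstanceAs (MorphismProperty.HasFactorization
    (objInjective 𝕜 ⊓ unitaryEquivalences 𝕜) (unitaryFibrations 𝕜))
  cm5b := inferInstanceAs (MorphismProperty.HasFactorization
    (objInjective 𝕜) (unitaryFibrations 𝕜 ⊓ unitaryEquivalences 𝕜))

lemma isUnitaryModelStructure : IsUnitaryModelStructure (unitaryModelStructure.{u} 𝕜) where
  weakEquivalences_eq := rfl
  cofibrations_eq := rfl
  fibrations_eq := rfl
  hasLimits := inferInstance
  hasColimits := inferInstance
  functorial_trivialCofibration_fibration :=
    inferInstanceAs (MorphismProperty.HasFunctorialFactorization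
      (objInjective 𝕜 ⊓ unitaryEquivalences 𝕜) (unitaryFibrations 𝕜))
  functorial_cofibration_trivialFibration :=
    inferInstanceAs (MorphismProperty.HasFunctorialFactorization
      (objInjective 𝕜) (unitaryFibrations 𝕜 ⊓ unitaryEquivalences 𝕜))

/-- Cofibrations are the maps with the left lifting property against trivial fibrations, so the
lifting characterization suffices and the objects of `P` need not be computed. -/
lemma generators_I_le : letI := unitaryModelStructure.{u} 𝕜
    G.I ≤ cofibrations (CStarCat.{u} 𝕜) := by
  let _ := unitaryModelStructure.{u} 𝕜
  rw [← MorphismProperty.llp_eq_of_wfs (cofibrations (CStarCat.{u} 𝕜))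
    (trivialFibrations (CStarCat.{u} 𝕜)), MorphismProperty.le_llp_iff_le_rlp]
  exact (trivialFibrations_eq_rlp_I G).le

lemma generators_J_le : letI := unitaryModelStructure.{u} 𝕜
    G.J ≤ trivialCofibrations (CStarCat.{u} 𝕜) := by
  let _ := unitaryModelStructure.{u} 𝕜
  rw [← MorphismProperty.llp_eq_of_wfs (trivialCofibrations (CStarCat.{u} 𝕜))
    (fibrations (CStarCat.{u} 𝕜)), MorphismProperty.le_llp_iff_le_rlp]
  exact (unitaryFibrations_eq_rlp_J G).le

instance : MorphismProperty.IsSmall.{u} G.J := MorphismProperty.isSmall_ofHoms _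

instance : MorphismProperty.IsSmall.{u} G.I := by
  have h : ∀ W₁ W₂ : MorphismProperty (CStarCat.{u} 𝕜), MorphismProperty.IsSmall.{u} W₁ →
      MorphismProperty.IsSmall.{u} W₂ → MorphismProperty.IsSmall.{u} (W₁ ⊔ W₂) :=
    fun W₁ W₂ _ _ => ⟨inferInstanceAs (Small.{u} (W₁.toSet ∪ W₂.toSet : Set (Arrow _)))⟩
  exact h _ _ (h _ _ (MorphismProperty.isSmall_ofHoms _) (MorphismProperty.isSmall_ofHoms _))
    (MorphismProperty.isSmall_ofHoms _)

end CStarCat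

namespace CStarCat

variable {𝕜 : Type} [RCLike 𝕜] {A B C D : CStarCat.{u} 𝕜}

/-! ### Germs of arrows along a sequence of C*-categories -/

lemma arrow_mk_add_congr {x y x' y' : A} {a b : x ⟶ y} {a' b' : x' ⟶ y'}
    (ha : Arrow.mk a = Arrow.mk a') (hb : Arrow.mk b = Arrow.mk b') :
    Arrow.mk (a + b) = Arrow.mk (a' + b') := by
  cases ha
  cases hb
  rfl

lemma arrow_mk_neg_congr {x y x' y' : A} {a : x ⟶ y} {a' : x' ⟶ y'}
    (ha : Arrow.mk a = Arrow.mk a') : Arrow.mk (-a) = Arrow.mk (-a') := by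
  cases ha
  rfl

lemma arrow_mk_smul_congr (c : 𝕜) {x y x' y' : A} {a : x ⟶ y} {a' : x' ⟶ y'}
    (ha : Arrow.mk a = Arrow.mk a') : Arrow.mk (c • a) = Arrow.mk (c • a') := by
  cases ha
  rfl

lemma arrow_mk_zero_congr {x y x' y' : A} (hx : x = x') (hy : y = y') :
    Arrow.mk (0 : x ⟶ y) = Arrow.mk (0 : x' ⟶ y') := by
  subst hx hy
  rfl

lemma exists_arrow_mk_eq {x y x' y' : A} (hx : x = x') (hy : y = y') (a : x ⟶ y) :
    ∃ a' : x' ⟶ y', Arrow.mk a' = Arrow.mk a := by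
  subst hx hy
  exact ⟨a, rfl⟩

lemma functor_map_neg (F : A ⟶ B) {x y : A} (a : x ⟶ y) :
    (functor F).map (-a) = -(functor F).map a := by
  rw [← zero_sub, functor_map_sub, functor_map_zero, zero_sub]

section Sequence

open Filter

variable {J : Type u} [LinearOrder J] (X : J ⥤ CStarCat.{u} 𝕜)

/-- The transition *-functors of a sequence of C*-categories. -/
abbrev trans {j k : J} (h : j ≤ k) : X.obj j ⟶ X.obj k := X.map (homOfLE h)

lemma arrow_mk_map_map {j k l : J} (h : j ≤ k) (g : k ≤ l) {x y : X.obj j} (a : x ⟶ y) :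
    Arrow.mk ((functor (trans X g)).map ((functor (trans X h)).map a)) =
      Arrow.mk ((functor (trans X (h.trans g))).map a) :=
  (arrow_mk_map_congr (X.map_comp (homOfLE h) (homOfLE g)) a).symm

lemma obj_map_map {j k l : J} (h : j ≤ k) (g : k ≤ l) (x : X.obj j) :
    (functor (trans X g)).obj ((functor (trans X h)).obj x) = (functor (trans X (h.trans g))).obj x :=
  (obj_congr (X.map_comp (homOfLE h) (homOfLE g)) x).symm

lemma arrow_mk_map_id {j : J} {x y : X.obj j} (a : x ⟶ y) :
    Arrow.mk ((functor (trans X (le_refl j))).map a) = Arrow.mk a :=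
  arrow_mk_map_congr (X.map_id j) a

lemma ColimObj.exists_eq_mk (p : ColimObj X) : ∃ (j : J) (x : X.obj j), ColimObj.mk X x = p := by
  obtain ⟨⟨j, x⟩, rfl⟩ := Quot.exists_rep p
  exact ⟨j, x, rfl⟩

/-- Once two representatives agree they agree at all later stages, so agreement can be followed
through the finitely many steps of the generated equivalence relation. -/
lemma ColimObj.eventually_eq {j j' : J} {x : X.obj j} {x' : X.obj j'}
    (h : ColimObj.mk X x = ColimObj.mk X x') : ∀ᶠ k in atTop, ∃ (f : j ≤ k) (f' : j' ≤ k),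
      (functor (trans X f)).obj x = (functor (trans X f')).obj x' := by
  have key : ∀ p q : Σ j, X.obj j, Relation.EqvGen
      (fun p q : Σ j, X.obj j => ∃ f : p.1 ⟶ q.1, (functor (X.map f)).obj p.2 = q.2) p q →
      ∀ᶠ k in atTop, ∃ (f : p.1 ≤ k) (f' : q.1 ≤ k),
        (functor (trans X f)).obj p.2 = (functor (trans X f')).obj q.2 := by
    intro p q hpq
    induction hpq with
    | rel p q hpq =>
      obtain ⟨f, hf⟩ := hpq
      filter_upwards [eventually_ge_atTop q.1] with k hk
      exact ⟨(leOfHom f).trans hk, hk, (obj_map_map X (leOfHom f) hk _).symm.trans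
        (congrArg (functor (trans X hk)).obj hf)⟩
    | refl p =>
      filter_upwards [eventually_ge_atTop p.1] with k hk
      exact ⟨hk, hk, rfl⟩
    | symm p q _ ih =>
      filter_upwards [ih] with k ⟨f, f', h⟩
      exact ⟨f', f, h.symm⟩
    | trans p q r _ _ ih ih' =>
      filter_upwards [ih, ih'] with k ⟨f, f', h⟩ ⟨g, g', h'⟩
      exact ⟨f, g', h.trans h'⟩
  exact key ⟨j, x⟩ ⟨j', x'⟩ (Quot.eqvGen_exact h)

variable {X} in
/-- Two arrows of terms of the sequence have the same images at all late stages. -/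
def EventuallyEq {j j' : J} {x y : X.obj j} {x' y' : X.obj j'} (a : x ⟶ y) (a' : x' ⟶ y') : Prop :=
  ∀ᶠ k in atTop, ∃ (f : j ≤ k) (f' : j' ≤ k),
    Arrow.mk ((functor (trans X f)).map a) = Arrow.mk ((functor (trans X f')).map a')

lemma eventuallyEq_of_arrow_mk_eq {j j' k : J} (f : j ≤ k) (f' : j' ≤ k) {x y : X.obj j}
    {x' y' : X.obj j'} {a : x ⟶ y} {a' : x' ⟶ y'}
    (h : Arrow.mk ((functor (trans X f)).map a) = Arrow.mk ((functor (trans X f')).map a')) :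
    EventuallyEq a a' := by
  filter_upwards [eventually_ge_atTop k] with l hl
  exact ⟨f.trans hl, f'.trans hl, (arrow_mk_map_map X f hl _).symm.trans
    ((map_arrow_congr (trans X hl) h).trans (arrow_mk_map_map X f' hl _))⟩

/-- A representative of a germ of arrows. -/
structure GermRep (p q : ColimObj X) : Type u where
  /-- The stage at which the arrow is defined. -/
  stage : J
  /-- The source of the arrow. -/
  src : X.obj stage
  /-- The target of the arrow. -/
  tgt : X.obj stage
  /-- The arrow. -/
  arr : src ⟶ tgt
  mk_src : ColimObj.mk X src = p
  mk_tgt : ColimObj.mk X tgt = q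

instance germSetoid (p q : ColimObj X) : Setoid (GermRep X p q) where
  r r s := EventuallyEq r.arr s.arr
  iseqv :=
    { refl := fun r => by
        filter_upwards [eventually_ge_atTop r.stage] with k hk
        exact ⟨hk, hk, rfl⟩
      symm := fun h => by
        filter_upwards [h] with k ⟨f, f', e⟩
        exact ⟨f', f, e.symm⟩
      trans := fun h h' => by
        filter_upwards [h, h'] with k ⟨f, f', e⟩ ⟨g, g', e'⟩
        exact ⟨f, g', e.trans e'⟩ }

/-- Germs of arrows along the sequence. -/
def Germ (p q : ColimObj X) : Type u := Quotient (germSetoid X p q)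

variable {X}

/-- The germ of an arrow. -/
def germ {p q : ColimObj X} {j : J} {x y : X.obj j} (a : x ⟶ y) (hx : ColimObj.mk X x = p)
    (hy : ColimObj.mk X y = q) : Germ X p q :=
  Quotient.mk _ ⟨j, x, y, a, hx, hy⟩

variable {p q r s : ColimObj X}

lemma germ_eq_germ_iff {j j' : J} {x y : X.obj j} {x' y' : X.obj j'} {a : x ⟶ y} {a' : x' ⟶ y'}
    {hx : ColimObj.mk X x = p} {hy : ColimObj.mk X y = q} {hx' : ColimObj.mk X x' = p}
    {hy' : ColimObj.mk X y' = q} : germ a hx hy = germ a' hx' hy' ↔ EventuallyEq a a' :=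
  Quotient.eq

lemma germ_eq_of_arrow_mk_eq {j k : J} (f : j ≤ k) {x y : X.obj j} {x' y' : X.obj k} {a : x ⟶ y}
    {a' : x' ⟶ y'} {hx : ColimObj.mk X x = p} {hy : ColimObj.mk X y = q}
    {hx' : ColimObj.mk X x' = p} {hy' : ColimObj.mk X y' = q}
    (h : Arrow.mk a' = Arrow.mk ((functor (trans X f)).map a)) : germ a' hx' hy' = germ a hx hy :=
  germ_eq_germ_iff.2 (eventuallyEq_of_arrow_mk_eq X le_rfl f ((arrow_mk_map_id X a').trans h))

lemma exists_germ_eq (α : Germ X p q) : ∃ (j : J) (x y : X.obj j) (a : x ⟶ y)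
    (hx : ColimObj.mk X x = p) (hy : ColimObj.mk X y = q), germ a hx hy = α := by
  obtain ⟨⟨j, x, y, a, hx, hy⟩, rfl⟩ := Quotient.exists_rep α
  exact ⟨j, x, y, a, hx, hy, rfl⟩

/-- A germ of arrows is represented at all late stages by an arrow between given
representatives of its endpoints. -/
lemma eventually_exists_germ_eq {j : J} {x y : X.obj j} (hx : ColimObj.mk X x = p)
    (hy : ColimObj.mk X y = q) (α : Germ X p q) : ∀ᶠ k in atTop, ∃ (f : j ≤ k)
      (a : (functor (trans X f)).obj x ⟶ (functor (trans X f)).obj y),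
      germ a ((ColimObj.mk_map X (homOfLE f) x).trans hx) ((ColimObj.mk_map X (homOfLE f) y).trans hy) = α := by
  obtain ⟨j', x', y', a, hx', hy', rfl⟩ := exists_germ_eq α
  filter_upwards [ColimObj.eventually_eq X (hx'.trans hx.symm),
    ColimObj.eventually_eq X (hy'.trans hy.symm)] with k ⟨f', f, h⟩ ⟨_, _, h'⟩
  obtain ⟨a', ha'⟩ := exists_arrow_mk_eq h h' ((functor (trans X f')).map a)
  exact ⟨f, a', germ_eq_of_arrow_mk_eq f' ha'⟩

/-! #### The operations on germs -/

noncomputable instance : Neg (Germ X p q) where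
  neg α := germ (-(Quotient.out α).arr) (Quotient.out α).mk_src (Quotient.out α).mk_tgt

noncomputable instance : SMul 𝕜 (Germ X p q) where
  smul c α := germ (c • (Quotient.out α).arr) (Quotient.out α).mk_src (Quotient.out α).mk_tgt

/-- The involution on germs. -/
noncomputable def Germ.adj (α : Germ X p q) : Germ X q p :=
  germ ((X.obj _).adj (Quotient.out α).arr) (Quotient.out α).mk_tgt (Quotient.out α).mk_src

section Operations

variable {j : J} {x y : X.obj j} {hx : ColimObj.mk X x = p} {hy : ColimObj.mk X y = q}

lemma eventuallyEq_out (a : x ⟶ y) : EventuallyEq (Quotient.out (germ a hx hy)).arr a :=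
  Quotient.mk_out (s := germSetoid X p q) ⟨j, x, y, a, hx, hy⟩

lemma germ_neg (a : x ⟶ y) : -germ a hx hy = germ (-a) hx hy := by
  refine germ_eq_germ_iff.2 ?_
  filter_upwards [eventuallyEq_out (hx := hx) (hy := hy) a] with k ⟨f, f', h⟩
  refine ⟨f, f', ?_⟩
  rw [functor_map_neg, functor_map_neg]
  exact arrow_mk_neg_congr h

lemma germ_smul (c : 𝕜) (a : x ⟶ y) : c • germ a hx hy = germ (c • a) hx hy := by
  refine germ_eq_germ_iff.2 ?_
  filter_upwards [eventuallyEq_out (hx := hx) (hy := hy) a] with k ⟨f, f', h⟩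
  refine ⟨f, f', ?_⟩
  rw [StarFunctor.map_smul, StarFunctor.map_smul]
  exact arrow_mk_smul_congr c h

lemma germ_adj (a : x ⟶ y) : (germ a hx hy).adj = germ ((X.obj j).adj a) hy hx := by
  refine germ_eq_germ_iff.2 ?_
  filter_upwards [eventuallyEq_out (hx := hx) (hy := hy) a] with k ⟨f, f', h⟩
  refine ⟨f, f', ?_⟩
  rw [StarFunctor.map_adj, StarFunctor.map_adj]
  exact arrow_mk_adj_congr h

end Operations

variable [Nonempty J]

variable (p q r s) in
/-- Four objects of the colimit have representatives at a common stage. -/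
lemma exists_objects : ∃ (j : J) (x y z w : X.obj j), ColimObj.mk X x = p ∧
    ColimObj.mk X y = q ∧ ColimObj.mk X z = r ∧ ColimObj.mk X w = s := by
  obtain ⟨j₁, x, rfl⟩ := ColimObj.exists_eq_mk X p
  obtain ⟨j₂, y, rfl⟩ := ColimObj.exists_eq_mk X q
  obtain ⟨j₃, z, rfl⟩ := ColimObj.exists_eq_mk X r
  obtain ⟨j₄, w, rfl⟩ := ColimObj.exists_eq_mk X s
  obtain ⟨k, h₁, h₂, h₃, h₄⟩ := ((eventually_ge_atTop j₁).and ((eventually_ge_atTop j₂).and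
    ((eventually_ge_atTop j₃).and (eventually_ge_atTop j₄)))).exists
  exact ⟨k, _, _, _, _, ColimObj.mk_map X (homOfLE h₁) x, ColimObj.mk_map X (homOfLE h₂) y,
    ColimObj.mk_map X (homOfLE h₃) z, ColimObj.mk_map X (homOfLE h₄) w⟩

lemma exists_germ_eq₂ (α β : Germ X p q) : ∃ (R : GermRep X p q) (b : R.src ⟶ R.tgt),
    germ R.arr R.mk_src R.mk_tgt = α ∧ germ b R.mk_src R.mk_tgt = β := by
  obtain ⟨j, x, y, -, -, rfl, rfl, -, -⟩ := exists_objects p q p p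
  obtain ⟨k, ⟨f, a, ha⟩, ⟨_, b, hb⟩⟩ := ((eventually_exists_germ_eq rfl rfl α).and
    (eventually_exists_germ_eq rfl rfl β)).exists
  exact ⟨⟨k, _, _, a, ColimObj.mk_map X (homOfLE f) x, ColimObj.mk_map X (homOfLE f) y⟩, b, ha, hb⟩

lemma exists_germ_eq_comp (α : Germ X p q) (β : Germ X q r) : ∃ (R : GermRep X p q)
    (z : X.obj R.stage) (b : R.tgt ⟶ z) (hz : ColimObj.mk X z = r),
    germ R.arr R.mk_src R.mk_tgt = α ∧ germ b R.mk_tgt hz = β := by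
  obtain ⟨j, x, y, z, -, rfl, rfl, rfl, -⟩ := exists_objects p q r p
  obtain ⟨k, ⟨f, a, ha⟩, ⟨_, b, hb⟩⟩ := ((eventually_exists_germ_eq rfl rfl α).and
    (eventually_exists_germ_eq rfl rfl β)).exists
  exact ⟨⟨k, _, _, a, ColimObj.mk_map X (homOfLE f) x, ColimObj.mk_map X (homOfLE f) y⟩,
    _, b, ColimObj.mk_map X (homOfLE f) z, ha, hb⟩

variable (X) in
lemma exists_germRep (p q : ColimObj X) : Nonempty (GermRep X p q) := by
  obtain ⟨j, x, y, -, -, hx, hy, -, -⟩ := exists_objects p q p p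
  exact ⟨⟨j, x, y, 0, hx, hy⟩⟩

/-- Both germs are first represented at one stage with the same endpoints; `germ_add` removes the
dependence on the choice. -/
noncomputable instance : Add (Germ X p q) where
  add α β := germ ((exists_germ_eq₂ α β).choose.arr + (exists_germ_eq₂ α β).choose_spec.choose)
    (exists_germ_eq₂ α β).choose.mk_src (exists_germ_eq₂ α β).choose.mk_tgt

noncomputable instance : Zero (Germ X p q) where
  zero := germ (0 : (exists_germRep X p q).some.src ⟶ (exists_germRep X p q).some.tgt)
    (exists_germRep X p q).some.mk_src (exists_germRep X p q).some.mk_tgt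

/-- The identity germ. -/
noncomputable def Germ.id (p : ColimObj X) : Germ X p p :=
  germ (𝟙 (exists_germRep X p p).some.src) (exists_germRep X p p).some.mk_src
    (exists_germRep X p p).some.mk_src

/-- The composition of germs. -/
noncomputable def Germ.comp (α : Germ X p q) (β : Germ X q r) : Germ X p r :=
  germ ((exists_germ_eq_comp α β).choose.arr ≫
      (exists_germ_eq_comp α β).choose_spec.choose_spec.choose)
    (exists_germ_eq_comp α β).choose.mk_src
    (exists_germ_eq_comp α β).choose_spec.choose_spec.choose_spec.choose

section Operations

variable {j : J} {x y z w : X.obj j} {hx : ColimObj.mk X x = p} {hy : ColimObj.mk X y = q}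
  {hz : ColimObj.mk X z = r} {hw : ColimObj.mk X w = s}

lemma germ_add (a b : x ⟶ y) : germ a hx hy + germ b hx hy = germ (a + b) hx hy := by
  obtain ⟨ha, hb⟩ := (exists_germ_eq₂ (germ a hx hy) (germ b hx hy)).choose_spec.choose_spec
  refine germ_eq_germ_iff.2 ?_
  filter_upwards [germ_eq_germ_iff.1 ha, germ_eq_germ_iff.1 hb] with k ⟨f, f', h⟩ ⟨_, _, h'⟩
  refine ⟨f, f', ?_⟩
  rw [StarFunctor.map_add, StarFunctor.map_add]
  exact arrow_mk_add_congr h h'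

lemma germ_zero : germ (0 : x ⟶ y) hx hy = 0 := by
  refine germ_eq_germ_iff.2 ?_
  filter_upwards [ColimObj.eventually_eq X (hx.trans (exists_germRep X p q).some.mk_src.symm),
    ColimObj.eventually_eq X (hy.trans (exists_germRep X p q).some.mk_tgt.symm)]
    with k ⟨f, f', h⟩ ⟨_, _, h'⟩
  refine ⟨f, f', ?_⟩
  rw [functor_map_zero, functor_map_zero]
  exact arrow_mk_zero_congr h h'

lemma germ_id : germ (𝟙 x) hx hx = Germ.id p := by
  refine germ_eq_germ_iff.2 ?_
  filter_upwards [ColimObj.eventually_eq X (hx.trans (exists_germRep X p p).some.mk_src.symm)]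
    with k ⟨f, f', h⟩
  refine ⟨f, f', ?_⟩
  rw [(functor (trans X f)).map_id, (functor (trans X f')).map_id, h]

lemma germ_comp (a : x ⟶ y) (b : y ⟶ z) :
    (germ a hx hy).comp (germ b hy hz) = germ (a ≫ b) hx hz := by
  obtain ⟨ha, hb⟩ :=
    (exists_germ_eq_comp (germ a hx hy) (germ b hy hz)).choose_spec.choose_spec.choose_spec.choose_spec
  refine germ_eq_germ_iff.2 ?_
  filter_upwards [germ_eq_germ_iff.1 ha, germ_eq_germ_iff.1 hb] with k ⟨f, f', h⟩ ⟨_, _, h'⟩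
  refine ⟨f, f', ?_⟩
  rw [(functor (trans X f)).map_comp, (functor (trans X f')).map_comp]
  exact arrow_mk_comp_congr h h'

end Operations

/-- Germs between representatives of four objects are represented at a common stage. -/
lemma germ_induction {motive : ∀ {p q r s : ColimObj X}, Germ X p q → Germ X p q → Germ X p q →
      Germ X q r → Germ X q r → Germ X r s → Prop}
    (h : ∀ {p q r s : ColimObj X} {j : J} {x y z w : X.obj j} (hx : ColimObj.mk X x = p)
      (hy : ColimObj.mk X y = q) (hz : ColimObj.mk X z = r) (hw : ColimObj.mk X w = s)
      (a₁ a₂ a₃ : x ⟶ y) (b₁ b₂ : y ⟶ z) (c : z ⟶ w),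
      motive (germ a₁ hx hy) (germ a₂ hx hy) (germ a₃ hx hy) (germ b₁ hy hz) (germ b₂ hy hz)
        (germ c hz hw))
    (α₁ α₂ α₃ : Germ X p q) (β₁ β₂ : Germ X q r) (γ : Germ X r s) : motive α₁ α₂ α₃ β₁ β₂ γ := by
  obtain ⟨j, x, y, z, w, rfl, rfl, rfl, rfl⟩ := exists_objects p q r s
  obtain ⟨k, ⟨f, a₁, rfl⟩, ⟨_, a₂, rfl⟩, ⟨_, a₃, rfl⟩, ⟨_, b₁, rfl⟩, ⟨_, b₂, rfl⟩, ⟨_, c, rfl⟩⟩ :=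
    ((eventually_exists_germ_eq rfl rfl α₁).and <| (eventually_exists_germ_eq rfl rfl α₂).and <|
      (eventually_exists_germ_eq rfl rfl α₃).and <| (eventually_exists_germ_eq rfl rfl β₁).and <|
      (eventually_exists_germ_eq rfl rfl β₂).and (eventually_exists_germ_eq rfl rfl γ)).exists
  exact h _ _ _ _ a₁ a₂ a₃ b₁ b₂ c

end Sequence

end CStarCat

namespace CStarCat

variable {𝕜 : Type} [RCLike 𝕜] {A B C D : CStarCat.{u} 𝕜}

/-! ### The colimit of a sequence in which countable sets of stages are bounded -/

section Sequence

open Filter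

variable {J : Type u} [LinearOrder J] {X : J ⥤ CStarCat.{u} 𝕜}
  {p q r s : ColimObj X}

/-- The norm of a germ is the infimum of the norms of its representatives. -/
noncomputable instance : Norm (Germ X p q) where
  norm α := sInf {t | ∃ (j : J) (x y : X.obj j) (a : x ⟶ y) (hx : ColimObj.mk X x = p)
    (hy : ColimObj.mk X y = q), germ a hx hy = α ∧ ‖a‖ = t}

lemma germ_norm_le {j : J} {x y : X.obj j} (hx : ColimObj.mk X x = p) (hy : ColimObj.mk X y = q)
    (a : x ⟶ y) : ‖germ a hx hy‖ ≤ ‖a‖ :=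
  csInf_le ⟨0, by rintro _ ⟨_, _, _, _, _, _, _, rfl⟩; exact norm_nonneg _⟩
    ⟨j, x, y, a, hx, hy, rfl, rfl⟩

lemma germ_map {j k : J} (f : j ≤ k) {x y : X.obj j} (hx : ColimObj.mk X x = p)
    (hy : ColimObj.mk X y = q) (a : x ⟶ y) :
    germ ((functor (trans X f)).map a) ((ColimObj.mk_map X (homOfLE f) x).trans hx)
      ((ColimObj.mk_map X (homOfLE f) y).trans hy) = germ a hx hy :=
  germ_eq_of_arrow_mk_eq f rfl

/-- The norm of a germ is attained by its representatives at all late stages. -/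
lemma eventually_norm_map_eq [CountableInterFilter (atTop : Filter J)] {j : J} {x y : X.obj j} (hx : ColimObj.mk X x = p)
    (hy : ColimObj.mk X y = q) (a : x ⟶ y) :
    ∀ᶠ k in atTop, ∃ f : j ≤ k, ‖(functor (trans X f)).map a‖ = ‖germ a hx hy‖ := by
  -- A representative within `1 / (n + 1)` of the infimum eventually has the same image as `a`, and
  -- transition maps contract.
  have h : ∀ n : ℕ, ∀ᶠ k in atTop, ∃ f : j ≤ k,
      ‖(functor (trans X f)).map a‖ < ‖germ a hx hy‖ + 1 / ((n : ℝ) + 1) := by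
    intro n
    obtain ⟨_, ⟨j', x', y', a', hx', hy', ha', rfl⟩, hlt⟩ := exists_lt_of_csInf_lt
      (s := {t | ∃ (j : J) (x y : X.obj j) (a' : x ⟶ y) (hx' : ColimObj.mk X x = p)
        (hy' : ColimObj.mk X y = q), germ a' hx' hy' = germ a hx hy ∧ ‖a'‖ = t})
      ⟨_, j, x, y, a, hx, hy, rfl, rfl⟩
      (show ‖germ a hx hy‖ < ‖germ a hx hy‖ + 1 / ((n : ℝ) + 1) from
        lt_add_of_pos_right _ Nat.one_div_pos_of_nat)
    filter_upwards [germ_eq_germ_iff.1 ha'] with k ⟨f', f, e⟩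
    exact ⟨f, (norm_eq_of_arrow_mk_eq e).symm.trans_lt ((norm_map_le _ a').trans_lt hlt)⟩
  -- Countable intersections permit all `n` at once, so the infimum is attained and not merely
  -- approached.
  filter_upwards [eventually_countable_forall.2 h, eventually_ge_atTop j] with k hk f
  refine ⟨f, le_antisymm ?_ ?_⟩
  · refine le_of_forall_pos_lt_add fun ε hε => ?_
    obtain ⟨n, hn⟩ := exists_nat_one_div_lt hε
    obtain ⟨_, h'⟩ := hk n
    exact h'.trans (by linarith)
  · exact (germ_map f hx hy a).symm ▸ germ_norm_le _ _ _

variable [Nonempty J]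

noncomputable instance : AddCommGroup (Germ X p q) where
  -- One induction principle serves all the axioms; slots that an axiom does not involve are filled
  -- with identity germs or repetitions.
  add_assoc α β γ := germ_induction (motive := fun α β γ _ _ _ => α + β + γ = α + (β + γ))
    (fun _ _ _ _ a b c _ _ _ => by simp only [germ_add, add_assoc]) α β γ
    (Germ.id q) (Germ.id q) (Germ.id q)
  zero_add α := by
    obtain ⟨j, x, y, a, hx, hy, rfl⟩ := exists_germ_eq α
    rw [← germ_zero (hx := hx) (hy := hy), germ_add, zero_add]
  add_zero α := by
    obtain ⟨j, x, y, a, hx, hy, rfl⟩ := exists_germ_eq α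
    rw [← germ_zero (hx := hx) (hy := hy), germ_add, add_zero]
  nsmul := nsmulRec
  zsmul := zsmulRec
  neg_add_cancel α := by
    obtain ⟨j, x, y, a, hx, hy, rfl⟩ := exists_germ_eq α
    rw [germ_neg, germ_add, neg_add_cancel, germ_zero]
  add_comm α β := germ_induction (motive := fun α β _ _ _ _ => α + β = β + α)
    (fun _ _ _ _ a b _ _ _ _ => by simp only [germ_add, add_comm]) α β α
    (Germ.id q) (Germ.id q) (Germ.id q)

lemma germ_sub {j : J} {x y : X.obj j} (hx : ColimObj.mk X x = p) (hy : ColimObj.mk X y = q)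
    (a b : x ⟶ y) : germ a hx hy - germ b hx hy = germ (a - b) hx hy := by
  rw [sub_eq_add_neg, germ_neg, germ_add, ← sub_eq_add_neg]

noncomputable instance : Module 𝕜 (Germ X p q) where
  one_smul α := by
    obtain ⟨j, x, y, a, hx, hy, rfl⟩ := exists_germ_eq α
    rw [germ_smul, one_smul]
  mul_smul k l α := by
    obtain ⟨j, x, y, a, hx, hy, rfl⟩ := exists_germ_eq α
    simp only [germ_smul, mul_smul]
  smul_zero k := by
    obtain ⟨R⟩ := exists_germRep X p q
    rw [← germ_zero (hx := R.mk_src) (hy := R.mk_tgt), germ_smul, smul_zero]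
  smul_add k α β := germ_induction (motive := fun α β _ _ _ _ => k • (α + β) = k • α + k • β)
    (fun _ _ _ _ a b _ _ _ _ => by simp only [germ_add, germ_smul, smul_add]) α β α
    (Germ.id q) (Germ.id q) (Germ.id q)
  add_smul k l α := by
    obtain ⟨j, x, y, a, hx, hy, rfl⟩ := exists_germ_eq α
    simp only [germ_smul, germ_add, add_smul]
  zero_smul α := by
    obtain ⟨j, x, y, a, hx, hy, rfl⟩ := exists_germ_eq α
    rw [germ_smul, zero_smul, germ_zero]

noncomputable instance germCategory : Category.{u} (ColimObj X) where
  Hom p q := Germ X p q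
  id p := Germ.id p
  comp α β := Germ.comp α β
  id_comp α := by
    obtain ⟨j, x, y, a, hx, hy, rfl⟩ := exists_germ_eq α
    rw [← germ_id (hx := hx), germ_comp, Category.id_comp]
  comp_id α := by
    obtain ⟨j, x, y, a, hx, hy, rfl⟩ := exists_germ_eq α
    rw [← germ_id (hx := hy), germ_comp, Category.comp_id]
  assoc α β γ := germ_induction
    (motive := fun α _ _ β _ γ => (α.comp β).comp γ = α.comp (β.comp γ))
    (fun _ _ _ _ a _ _ b _ c => by simp only [germ_comp, Category.assoc]) α α α β β γ

variable [CountableInterFilter (atTop : Filter J)]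

/-- A germ is represented at all late stages by an arrow of the same norm. -/
lemma eventually_exists_germ_eq_norm_eq {j : J} {x y : X.obj j} (hx : ColimObj.mk X x = p)
    (hy : ColimObj.mk X y = q) (α : Germ X p q) : ∀ᶠ k in atTop, ∃ (f : j ≤ k)
      (a : (functor (trans X f)).obj x ⟶ (functor (trans X f)).obj y),
      germ a ((ColimObj.mk_map X (homOfLE f) x).trans hx)
        ((ColimObj.mk_map X (homOfLE f) y).trans hy) = α ∧ ‖a‖ = ‖α‖ := by
  obtain ⟨k, f, a, rfl⟩ := (eventually_exists_germ_eq hx hy α).exists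
  filter_upwards [eventually_norm_map_eq ((ColimObj.mk_map X (homOfLE f) x).trans hx)
    ((ColimObj.mk_map X (homOfLE f) y).trans hy) a] with l ⟨g, hg⟩
  obtain ⟨a', ha'⟩ := exists_arrow_mk_eq (obj_map_map X f g x) (obj_map_map X f g y)
    ((functor (trans X g)).map a)
  exact ⟨f.trans g, a', germ_eq_of_arrow_mk_eq g ha', (norm_eq_of_arrow_mk_eq ha').trans hg⟩

/-- Attained norms reduce the axioms to a single hom space at a late stage. In particular a germ of
norm zero has a zero representative, so this seminorm is already a norm. -/
lemma germ_normedSpaceCore : NormedSpace.Core 𝕜 (Germ X p q) where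
  norm_nonneg α := Real.sInf_nonneg (by
    rintro _ ⟨_, _, _, _, _, _, _, rfl⟩
    exact norm_nonneg _)
  norm_smul c α := by
    obtain ⟨j, x, y, a, hx, hy, rfl⟩ := exists_germ_eq α
    rw [germ_smul]
    obtain ⟨k, ⟨f, h⟩, ⟨_, h'⟩⟩ := ((eventually_norm_map_eq hx hy a).and
      (eventually_norm_map_eq hx hy (c • a))).exists
    rw [← h, ← h', StarFunctor.map_smul, norm_smul]
  norm_triangle α β := by
    obtain ⟨j, x, y, -, -, hx, hy, -, -⟩ := exists_objects p q p p
    obtain ⟨k, ⟨f, a, rfl, ha⟩, ⟨_, b, rfl, hb⟩⟩ :=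
      ((eventually_exists_germ_eq_norm_eq hx hy α).and
        (eventually_exists_germ_eq_norm_eq hx hy β)).exists
    rw [← ha, ← hb, germ_add]
    exact (germ_norm_le _ _ _).trans (norm_add_le _ _)
  norm_eq_zero_iff α := by
    obtain ⟨j, x, y, -, -, hx, hy, -, -⟩ := exists_objects p q p p
    obtain ⟨k, f, a, rfl, ha⟩ := (eventually_exists_germ_eq_norm_eq hx hy α).exists
    constructor
    · intro h
      rw [h, norm_eq_zero] at ha
      rw [ha, germ_zero]
    · intro h
      rw [h]
      refine le_antisymm ?_ (Real.sInf_nonneg ?_)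
      · have h0 := germ_norm_le hx hy (0 : x ⟶ y)
        rwa [germ_zero, norm_zero] at h0
      · rintro _ ⟨_, _, _, _, _, _, _, rfl⟩
        exact norm_nonneg _

noncomputable instance germNormedAddCommGroup : NormedAddCommGroup (Germ X p q) :=
  NormedAddCommGroup.ofCore germ_normedSpaceCore

noncomputable instance germNormedSpace : NormedSpace 𝕜 (Germ X p q) :=
  NormedSpace.ofCore germ_normedSpaceCore

/-- A Cauchy sequence involves countably many germs, so all of them are represented in one hom space
at one stage, where a limit exists. -/
instance : CompleteSpace (Germ X p q) := by
  refine Metric.complete_of_cauchySeq_tendsto fun α hα => ?_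
  obtain ⟨j, x, y, -, -, hx, hy, -, -⟩ := exists_objects p q p p
  obtain ⟨k, hk⟩ := (eventually_countable_forall.2 fun n : ℕ =>
    eventually_exists_germ_eq hx hy (α n)).exists
  have f : j ≤ k := (hk 0).1
  replace hk : ∀ n, ∃ a : (functor (trans X f)).obj x ⟶ (functor (trans X f)).obj y,
      germ a ((ColimObj.mk_map X (homOfLE f) x).trans hx)
        ((ColimObj.mk_map X (homOfLE f) y).trans hy) = α n := fun n => (hk n).2
  choose a ha using hk
  -- A further stage realizes the norms of all pairwise differences exactly, so the representatives
  -- there are Cauchy.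
  obtain ⟨l, hl⟩ := (eventually_countable_forall.2 fun n : ℕ × ℕ =>
    eventually_norm_map_eq ((ColimObj.mk_map X (homOfLE f) x).trans hx)
      ((ColimObj.mk_map X (homOfLE f) y).trans hy) (a n.1 - a n.2)).exists
  have g : k ≤ l := (hl 0).1
  replace hl : ∀ m n, ‖(functor (trans X g)).map (a m) - (functor (trans X g)).map (a n)‖ =
      ‖α m - α n‖ := fun m n => by
    rw [← functor_map_sub, ← ha m, ← ha n, germ_sub]
    exact (hl (m, n)).2
  have hc : CauchySeq fun n => (functor (trans X g)).map (a n) := by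
    rw [Metric.cauchySeq_iff] at hα ⊢
    intro ε hε
    obtain ⟨N, hN⟩ := hα ε hε
    refine ⟨N, fun m hm n hn => ?_⟩
    rw [dist_eq_norm, hl m n, ← dist_eq_norm]
    exact hN m hm n hn
  obtain ⟨b, hb⟩ := cauchySeq_tendsto_of_complete hc
  have hx' := (ColimObj.mk_map X (homOfLE g) _).trans ((ColimObj.mk_map X (homOfLE f) x).trans hx)
  have hy' := (ColimObj.mk_map X (homOfLE g) _).trans ((ColimObj.mk_map X (homOfLE f) y).trans hy)
  refine ⟨germ b hx' hy', tendsto_iff_norm_sub_tendsto_zero.2 ?_⟩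
  refine squeeze_zero (fun _ => norm_nonneg _) (fun n => ?_)
    (tendsto_iff_norm_sub_tendsto_zero.1 hb)
  rw [← ha n, ← germ_map g, germ_sub]
  exact germ_norm_le _ _ _

/-- The inequality holds for a representative with the norm of `α`, and taking germs does not
increase the left-hand side. -/
lemma norm_smul_germ_id_sub_le (α : Germ X p q) :
    ‖((‖α‖ ^ 2 : ℝ) : 𝕜) • Germ.id p - Germ.comp α (Germ.adj α)‖ ≤ ‖α‖ ^ 2 := by
  obtain ⟨j, x, y, -, -, hx, hy, -, -⟩ := exists_objects (X := X) p q p p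
  obtain ⟨k, f, a, ha', ha⟩ := (eventually_exists_germ_eq_norm_eq hx hy α).exists
  rw [← ha, ← ha', germ_adj, germ_comp,
    ← germ_id (hx := (ColimObj.mk_map X (homOfLE f) x).trans hx), germ_smul, germ_sub]
  exact (germ_norm_le _ _ _).trans (norm_smul_id_sub_le a le_rfl)

variable (X) in
/-- The Banach *-category of germs. -/
noncomputable def germBanach : BanachStarCat.{u} 𝕜 where
  carrier := ColimObj X
  category := germCategory
  normedAddCommGroup p q := germNormedAddCommGroup (p := p) (q := q)
  normedSpace p q := germNormedSpace (p := p) (q := q)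
  completeSpace p q := inferInstanceAs (CompleteSpace (Germ X p q))
  add_comp α β γ := germ_induction
    (motive := fun α β _ γ _ _ => (α + β).comp γ = α.comp γ + β.comp γ)
    (fun _ _ _ _ a b _ c _ _ => by simp only [germ_comp, germ_add, CStarCat.add_comp])
    α β α γ γ (Germ.id _)
  comp_add α β γ := germ_induction
    (motive := fun α _ _ β γ _ => α.comp (β + γ) = α.comp β + α.comp γ)
    (fun _ _ _ _ a _ _ b c _ => by simp only [germ_comp, germ_add, CStarCat.comp_add])
    α α α β γ (Germ.id _)
  smul_comp k α β := germ_induction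
    (motive := fun α _ _ β _ _ => (k • α).comp β = k • α.comp β)
    (fun _ _ _ _ a _ _ b _ _ => by simp only [germ_comp, germ_smul, CStarCat.smul_comp])
    α α α β β (Germ.id _)
  comp_smul α k β := germ_induction
    (motive := fun α _ _ β _ _ => α.comp (k • β) = k • α.comp β)
    (fun _ _ _ _ a _ _ b _ _ => by simp only [germ_comp, germ_smul, CStarCat.comp_smul])
    α α α β β (Germ.id _)
  norm_comp_le {p q r} α β := by
    obtain ⟨j, x, y, z, -, hx, hy, hz, -⟩ := exists_objects p q r p
    obtain ⟨k, ⟨f, a, ha', ha⟩, ⟨_, b, hb', hb⟩⟩ :=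
      ((eventually_exists_germ_eq_norm_eq hx hy α).and
        (eventually_exists_germ_eq_norm_eq hy hz β)).exists
    have h : ‖Germ.comp α β‖ ≤ ‖a ≫ b‖ := by
      rw [← ha', ← hb', germ_comp]
      exact germ_norm_le _ _ _
    refine (h.trans (CStarCat.norm_comp_le _ a b)).trans_eq ?_
    rw [ha, hb]
  adj α := Germ.adj α
  adj_add α β := germ_induction
    (motive := fun α β _ _ _ _ => (α + β).adj = α.adj + β.adj)
    (fun _ _ _ _ a b _ _ _ _ => by simp only [germ_adj, germ_add, CStarCat.adj_add])
    α β α (Germ.id _) (Germ.id _) (Germ.id _)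
  adj_smul c α := by
    obtain ⟨j, x, y, a, hx, hy, rfl⟩ := exists_germ_eq α
    show (c • germ a hx hy).adj = (starRingEnd 𝕜 c) • (germ a hx hy).adj
    simp only [germ_adj, germ_smul, CStarCat.adj_smul]
  adj_comp α β := germ_induction
    (motive := fun α _ _ β _ _ => (α.comp β).adj = β.adj.comp α.adj)
    (fun _ _ _ _ a _ _ b _ _ => by simp only [germ_comp, germ_adj, CStarCat.adj_comp])
    α α α β β (Germ.id _)
  adj_adj α := by
    obtain ⟨j, x, y, a, hx, hy, rfl⟩ := exists_germ_eq α
    show (germ a hx hy).adj.adj = germ a hx hy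
    simp only [germ_adj, CStarCat.adj_adj]
  norm_comp_adj {p q} α := by
    obtain ⟨j, x, y, a, hx, hy, rfl⟩ := exists_germ_eq α
    obtain ⟨k, ⟨f, h⟩, ⟨_, h'⟩⟩ := ((eventually_norm_map_eq hx hy a).and
      (eventually_norm_map_eq hx hx (a ≫ (X.obj j).adj a))).exists
    show ‖(germ a hx hy).comp (germ a hx hy).adj‖ = ‖germ a hx hy‖ ^ 2
    rw [germ_adj, germ_comp, ← h, ← h', ← CStarCat.norm_comp_adj, (functor (trans X f)).map_comp,
      StarFunctor.map_adj]

variable (X) in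
/-- The C*-category of germs. -/
noncomputable def germCat : CStarCat.{u} 𝕜 :=
  (germBanach X).toCStarCat fun α => norm_smul_germ_id_sub_le α

end Sequence

end CStarCat

/-! ### The universal property of the category of germs -/

namespace CStarCat

variable {𝕜 : Type} [RCLike 𝕜] {A B C D : CStarCat.{u} 𝕜}

section Sequence

open Filter

variable {J : Type u} [LinearOrder J] {X : J ⥤ CStarCat.{u} 𝕜} [Nonempty J]
  {p q : ColimObj X}

/-- A cocone identifies arrows that are eventually equal. Quantifying over all representatives
builds independence of the choice into the value. -/
lemma exists_germDescMap (s : Cocone X) (α : Germ X p q) :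
    ∃ m : (coconeRep X s).obj p ⟶ (coconeRep X s).obj q, ∀ {j : J} {x y : X.obj j} (a : x ⟶ y)
      (hx : ColimObj.mk X x = p) (hy : ColimObj.mk X y = q), germ a hx hy = α →
      Arrow.mk m = Arrow.mk ((functor (s.ι.app j)).map a) := by
  obtain ⟨j, x, y, a, rfl, rfl, rfl⟩ := exists_germ_eq α
  refine ⟨(functor (s.ι.app j)).map a, fun {j' x' y'} a' hx' hy' h => ?_⟩
  obtain ⟨k, f', f, e⟩ := (germ_eq_germ_iff.1 h).exists
  exact (arrow_mk_map_congr (s.w (homOfLE f)) a).symm.trans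
    ((map_arrow_congr (s.ι.app k) e).symm.trans (arrow_mk_map_congr (s.w (homOfLE f')) a'))

/-- The action on germs of the *-functor induced by a cocone. -/
noncomputable def germDescMap (s : Cocone X) (α : Germ X p q) :
    (coconeRep X s).obj p ⟶ (coconeRep X s).obj q :=
  (exists_germDescMap s α).choose

lemma arrow_mk_germDescMap (s : Cocone X) {j : J} {x y : X.obj j} (a : x ⟶ y)
    (hx : ColimObj.mk X x = p) (hy : ColimObj.mk X y = q) :
    Arrow.mk (germDescMap s (germ a hx hy)) = Arrow.mk ((functor (s.ι.app j)).map a) :=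
  (exists_germDescMap s (germ a hx hy)).choose_spec a hx hy rfl

variable [CountableInterFilter (atTop : Filter J)]

/-- The germ of an arrow, as an arrow of the C*-category of germs. -/
def germHom {p q : germCat X} {j : J} {x y : X.obj j} (a : x ⟶ y) (hx : ColimObj.mk X x = p)
    (hy : ColimObj.mk X y = q) : p ⟶ q :=
  germ (X := X) a hx hy

lemma exists_germHom_eq {p q : germCat X} (α : p ⟶ q) : ∃ (j : J) (x y : X.obj j) (a : x ⟶ y)
    (hx : ColimObj.mk X x = p) (hy : ColimObj.mk X y = q), germHom a hx hy = α :=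
  exists_germ_eq (X := X) α

lemma arrow_mk_germHom_eq_iff {p q p' q' : germCat X} {j j' : J} {x y : X.obj j} {x' y' : X.obj j'}
    {a : x ⟶ y} {a' : x' ⟶ y'} {hx : ColimObj.mk X x = p} {hy : ColimObj.mk X y = q}
    {hx' : ColimObj.mk X x' = p'} {hy' : ColimObj.mk X y' = q'} :
    Arrow.mk (germHom a hx hy) = Arrow.mk (germHom a' hx' hy') ↔ EventuallyEq a a' := by
  constructor
  · intro h
    obtain rfl : p = p' := congrArg Comma.left h
    obtain rfl : q = q' := congrArg Comma.right h
    exact germ_eq_germ_iff.1 ((arrow_mk_eq_iff _ _).1 h)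
  · intro h
    obtain ⟨k, f, f', e⟩ := h.exists
    obtain rfl : p = p' := hx.symm.trans ((ColimObj.mk_map X (homOfLE f) x).symm.trans
      ((congrArg (ColimObj.mk X) (congrArg Comma.left e)).trans
        ((ColimObj.mk_map X (homOfLE f') x').trans hx')))
    obtain rfl : q = q' := hy.symm.trans ((ColimObj.mk_map X (homOfLE f) y).symm.trans
      ((congrArg (ColimObj.mk X) (congrArg Comma.right e)).trans
        ((ColimObj.mk_map X (homOfLE f') y').trans hy')))
    exact congrArg Arrow.mk (germ_eq_germ_iff.2 h)

variable (X) in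
/-- The *-functor from a term of the sequence to the C*-category of germs. -/
noncomputable def germIn (j : J) : X.obj j ⟶ germCat X :=
  show StarFunctor (X.obj j) (germCat X) from
  { obj := fun x => ColimObj.mk X x
    map := fun a => germHom a rfl rfl
    map_id := fun _ => germ_id
    map_comp := fun a b => (germ_comp a b).symm
    map_add := fun a b => (germ_add a b).symm
    map_smul := fun k a => (germ_smul k a).symm
    map_adj := fun a => (germ_adj a).symm }

lemma arrow_mk_germHom {p q : germCat X} {j : J} {x y : X.obj j} (a : x ⟶ y)
    (hx : ColimObj.mk X x = p) (hy : ColimObj.mk X y = q) :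
    Arrow.mk (germHom a hx hy) = Arrow.mk ((functor (germIn X j)).map a) := by
  subst hx hy
  rfl

lemma trans_germIn {j k : J} (f : j ≤ k) : trans X f ≫ germIn X k = germIn X j :=
  hom_ext fun _ => arrow_mk_germHom_eq_iff.2
    (eventuallyEq_of_arrow_mk_eq X le_rfl f (arrow_mk_map_id X _))

variable (X) in
/-- The cocone with point the C*-category of germs. -/
noncomputable def germCocone : Cocone X where
  pt := germCat X
  ι :=
    { app := germIn X
      naturality := fun j k f => by
        rw [Subsingleton.elim f (homOfLE (leOfHom f))]
        exact (trans_germIn (leOfHom f)).trans (Category.comp_id _).symm }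

/-- The *-functor out of the C*-category of germs induced by a cocone. -/
noncomputable def germDesc (s : Cocone X) : germCat X ⟶ s.pt :=
  show StarFunctor (germCat X) s.pt from
  { obj := (coconeRep X s).obj
    map := fun {p q} α => germDescMap (p := p) (q := q) s α
    map_id := fun p => by
      obtain ⟨j, x, rfl⟩ := ColimObj.exists_eq_mk X p
      refine (arrow_mk_eq_iff _ _).1 ?_
      refine (congrArg (fun α => Arrow.mk (germDescMap s α)) (germ_id (x := x) (hx := rfl)).symm).trans
        ((arrow_mk_germDescMap s _ _ _).trans ?_)
      exact congrArg Arrow.mk ((functor (s.ι.app j)).map_id x)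
    map_comp := fun α β => germ_induction (motive := fun α _ _ β _ _ =>
        germDescMap s (α.comp β) = germDescMap s α ≫ germDescMap s β)
      (fun _ _ _ _ a _ _ b _ _ => by
        rw [germ_comp]
        refine (arrow_mk_eq_iff _ _).1 ((arrow_mk_germDescMap s _ _ _).trans ?_)
        refine (congrArg Arrow.mk ((functor (s.ι.app _)).map_comp a b)).trans ?_
        exact (arrow_mk_comp_congr (arrow_mk_germDescMap s a _ _)
          (arrow_mk_germDescMap s b _ _)).symm) α α α β β (Germ.id _)
    map_add := fun α β => germ_induction (motive := fun α β _ _ _ _ =>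
        germDescMap s (α + β) = germDescMap s α + germDescMap s β)
      (fun _ _ _ _ a b _ _ _ _ => by
        rw [germ_add]
        refine (arrow_mk_eq_iff _ _).1 ((arrow_mk_germDescMap s _ _ _).trans ?_)
        refine (congrArg Arrow.mk (StarFunctor.map_add (s.ι.app _) a b)).trans ?_
        exact (arrow_mk_add_congr (arrow_mk_germDescMap s a _ _)
          (arrow_mk_germDescMap s b _ _)).symm) α β α (Germ.id _) (Germ.id _) (Germ.id _)
    map_smul := fun {p q} k α => by
      obtain ⟨j, x, y, a, hx, hy, rfl⟩ := exists_germ_eq (p := p) (q := q) α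
      refine (arrow_mk_eq_iff _ _).1 ?_
      refine (congrArg (fun α => Arrow.mk (germDescMap s α)) (germ_smul k a)).trans
        ((arrow_mk_germDescMap s _ _ _).trans ?_)
      refine (congrArg Arrow.mk (StarFunctor.map_smul (s.ι.app _) k a)).trans ?_
      exact (arrow_mk_smul_congr k (arrow_mk_germDescMap s a _ _)).symm
    map_adj := fun {p q} α => by
      obtain ⟨j, x, y, a, hx, hy, rfl⟩ := exists_germ_eq (p := p) (q := q) α
      refine (arrow_mk_eq_iff _ _).1 ?_
      refine (congrArg (fun α => Arrow.mk (germDescMap s α)) (germ_adj a)).trans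
        ((arrow_mk_germDescMap s _ _ _).trans ?_)
      refine (congrArg Arrow.mk (StarFunctor.map_adj (s.ι.app _) a)).trans ?_
      exact (arrow_mk_adj_congr (arrow_mk_germDescMap s a _ _)).symm }

variable (X) in
/-- The C*-category of germs is the colimit of the sequence. -/
noncomputable def germCoconeIsColimit : IsColimit (germCocone X) where
  desc := germDesc
  fac s j := hom_ext fun a => arrow_mk_germDescMap s a rfl rfl
  uniq s m hm := hom_ext fun {p q} α => by
    obtain ⟨j, x, y, a, rfl, rfl, rfl⟩ := exists_germHom_eq α
    exact (arrow_mk_map_congr (hm j) a).trans (arrow_mk_germDescMap s a rfl rfl).symm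

end Sequence

/-! ### Smallness -/

/-- It is enough to examine one colimit cocone: the presented colimit for the finite objects, the
germs for `P`. -/
lemma preservesColimit_coyoneda {E : Type (u + 1)} [LargeCategory.{u} E] {J : Type u}
    [LinearOrder J] [Nonempty J] {X : J ⥤ E} {c : Cocone X} (hc : IsColimit c) (Y : E)
    (hsurj : ∀ f : Y ⟶ c.pt, ∃ (j : J) (g : Y ⟶ X.obj j), g ≫ c.ι.app j = f)
    (hinj : ∀ (j : J) (g g' : Y ⟶ X.obj j), g ≫ c.ι.app j = g' ≫ c.ι.app j →
      ∃ (k : J) (h : j ≤ k), g ≫ X.map (homOfLE h) = g' ≫ X.map (homOfLE h)) :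
    PreservesColimit X (coyoneda.obj (Opposite.op Y)) := by
  refine preservesColimit_of_preserves_colimit_cocone hc
    (Types.FilteredColimit.isColimitOf' _ _ (fun f => ?_) fun j g g' h => ?_)
  · obtain ⟨j, g, hg⟩ := hsurj f
    exact ⟨j, g, hg.symm⟩
  · obtain ⟨k, f, e⟩ := hinj j g g' h
    exact ⟨k, homOfLE f, e⟩

/-- Here `κ = 0`: in a nonempty order the boundedness condition is then void. This suffices for
objects whose maps to a colimit see only its object set. -/
lemma isFiniteObject_of_colimCocone (Y : CStarCat.{u} 𝕜)
    (hsurj : ∀ {J : Type u} [LinearOrder J] [Nonempty J] (X : J ⥤ CStarCat.{u} 𝕜)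
      (f : Y ⟶ (colimCocone X).pt), ∃ (j : J) (g : Y ⟶ X.obj j), g ≫ (colimCocone X).ι.app j = f)
    (hinj : ∀ {J : Type u} [LinearOrder J] [Nonempty J] (X : J ⥤ CStarCat.{u} 𝕜) (j : J)
      (g g' : Y ⟶ X.obj j), g ≫ (colimCocone X).ι.app j = g' ≫ (colimCocone X).ι.app j →
      ∃ (k : J) (h : j ≤ k), g ≫ X.map (homOfLE h) = g' ≫ X.map (homOfLE h)) :
    IsFiniteObject Y :=
  ⟨0, fun _ _ _ _ _ _ _ X _ _ =>
    preservesColimit_coyoneda (colimCoconeIsColimit X) Y (hsurj X) (hinj X)⟩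

lemma isFiniteObject_empty : IsFiniteObject (empty.{u} 𝕜) :=
  isFiniteObject_of_colimCocone _
    (fun _ _ => ⟨Classical.arbitrary _, fromEmpty _, empty_hom_ext _ _⟩)
    fun _ j _ _ _ => ⟨j, le_rfl, empty_hom_ext _ _⟩

lemma ofObj_comp_colimCocone {J : Type u} [LinearOrder J] (X : J ⥤ CStarCat.{u} 𝕜) {j : J}
    (x : X.obj j) : ofObj x ≫ (colimCocone X).ι.app j =
      ofObj (A := (colimCocone X).pt) (ColimObj.mk X x) :=
  ofObj_comp _

lemma isFiniteObject_base : IsFiniteObject (base.{u} 𝕜) := by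
  refine isFiniteObject_of_colimCocone _ (fun X f => ?_) fun X j g g' h => ?_
  · obtain ⟨j, x, hx⟩ := ColimObj.exists_eq_mk X ((functor f).obj .pt)
    exact ⟨j, ofObj x, (ofObj_comp_colimCocone X x).trans
      ((congrArg (ofObj (A := (colimCocone X).pt)) hx).trans (base_hom_eq f).symm)⟩
  · obtain ⟨k, f, _, e⟩ := (ColimObj.eventually_eq X (obj_congr h .pt)).exists
    refine ⟨k, f, (base_hom_eq _).trans (Eq.trans ?_ (base_hom_eq _).symm)⟩
    exact congrArg ofObj e

lemma Generators.isFiniteObject_two (G : Generators.{u} 𝕜) : IsFiniteObject G.two := by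
  refine isFiniteObject_of_colimCocone _ (fun X f => ?_) fun X j g g' h => ?_
  · obtain ⟨j, x, hx⟩ := ColimObj.exists_eq_mk X ((functor (G.inl ≫ f)).obj .pt)
    obtain ⟨j', y, hy⟩ := ColimObj.exists_eq_mk X ((functor (G.inr ≫ f)).obj .pt)
    obtain ⟨k, h, h'⟩ := exists_ge_ge j j'
    obtain ⟨F, hF, hF'⟩ := G.exists_two_hom ((functor (trans X h)).obj x)
      ((functor (trans X h')).obj y)
    refine ⟨k, F, G.two_hom_ext ?_ ?_⟩
    · refine (Category.assoc _ _ _).symm.trans ((congrArg (· ≫ (colimCocone X).ι.app k) hF).trans ?_)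
      refine (ofObj_comp_colimCocone X _).trans (Eq.trans ?_ (base_hom_eq _).symm)
      exact congrArg (ofObj (A := (colimCocone X).pt)) ((ColimObj.mk_map X _ _).trans hx)
    · refine (Category.assoc _ _ _).symm.trans
        ((congrArg (· ≫ (colimCocone X).ι.app k) hF').trans ?_)
      refine (ofObj_comp_colimCocone X _).trans (Eq.trans ?_ (base_hom_eq _).symm)
      exact congrArg (ofObj (A := (colimCocone X).pt)) ((ColimObj.mk_map X _ _).trans hy)
  · have h₁ : (G.inl ≫ g) ≫ (colimCocone X).ι.app j = (G.inl ≫ g') ≫ (colimCocone X).ι.app j := by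
      rw [Category.assoc, h, Category.assoc]
    have h₂ : (G.inr ≫ g) ≫ (colimCocone X).ι.app j = (G.inr ≫ g') ≫ (colimCocone X).ι.app j := by
      rw [Category.assoc, h, Category.assoc]
    obtain ⟨k, ⟨f, _, e⟩, ⟨_, _, e'⟩⟩ := ((ColimObj.eventually_eq X (obj_congr h₁ .pt)).and
      (ColimObj.eventually_eq X (obj_congr h₂ .pt))).exists
    refine ⟨k, f, G.two_hom_ext ?_ ?_⟩
    · exact (base_hom_eq _).trans ((congrArg ofObj e).trans (base_hom_eq (G.inl ≫ g' ≫ trans X f)).symm)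
    · exact (base_hom_eq _).trans ((congrArg ofObj e').trans (base_hom_eq (G.inr ≫ g' ≫ trans X f)).symm)

/-! ### Smallness of `P` -/

section Pushout

open Filter

variable (G : Generators.{u} 𝕜) {J : Type u} [LinearOrder J] [Nonempty J]
  [CountableInterFilter (atTop : Filter J)] (X : J ⥤ CStarCat.{u} 𝕜)

/-- A map out of `P` is a pair of parallel contractions. At a late stage their germs have
representatives with common endpoints and unchanged norms, hence contractions again; with norms only
approached, the bound `1` could be lost. -/
lemma exists_comp_germIn_eq (f : G.P ⟶ germCat X) :
    ∃ (j : J) (g : G.P ⟶ X.obj j), g ≫ germIn X j = f := by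
  have hw : G.V ≫ G.in₁ ≫ f = G.V ≫ G.in₂ ≫ f := by
    rw [← Category.assoc, ← Category.assoc, G.isPushout.w]
  obtain ⟨hs, ht⟩ := G.V_comp_eq_V_comp_iff.1 hw
  -- The second contraction is moved to the endpoints of the first, so that both are germs between
  -- the same two objects.
  obtain ⟨β, hβ⟩ := exists_arrow_mk_eq hs.symm ht.symm ((functor (G.in₂ ≫ f)).map G.arr)
  have hβ' : ‖β‖ ≤ 1 := (norm_eq_of_arrow_mk_eq hβ).trans_le (G.norm_map_arr_le _)
  obtain ⟨j, x, y, -, -, hx, hy, -, -⟩ := exists_objects (X := X)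
    ((functor (G.in₁ ≫ f)).obj G.s) ((functor (G.in₁ ≫ f)).obj G.t)
    ((functor (G.in₁ ≫ f)).obj G.s) ((functor (G.in₁ ≫ f)).obj G.t)
  obtain ⟨k, ⟨h, a, ha, ha'⟩, ⟨_, b, hb, hb'⟩⟩ := ((eventually_exists_germ_eq_norm_eq hx hy
    ((functor (G.in₁ ≫ f)).map G.arr)).and (eventually_exists_germ_eq_norm_eq hx hy β)).exists
  obtain ⟨F, hF⟩ := G.exists_one_hom a (ha'.trans_le (G.norm_map_arr_le (G.in₁ ≫ f)))
  obtain ⟨F', hF'⟩ := G.exists_one_hom b (hb'.trans_le hβ')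
  obtain ⟨H, hH, hH'⟩ := G.exists_P_hom F F' (hF.src.trans hF'.src.symm)
    (hF.tgt.trans hF'.tgt.symm)
  refine ⟨k, H, G.isPushout.hom_ext ?_ ?_⟩
  · rw [← Category.assoc, hH]
    exact G.one_hom_ext ((hF.comp (G := germIn X k)).trans
      ((arrow_mk_germHom a _ _).symm.trans (congrArg Arrow.mk ha)))
  · rw [← Category.assoc, hH']
    exact G.one_hom_ext ((hF'.comp (G := germIn X k)).trans
      ((arrow_mk_germHom b _ _).symm.trans ((congrArg Arrow.mk hb).trans hβ)))

lemma exists_comp_trans_eq (j : J) (g g' : G.P ⟶ X.obj j) (h : g ≫ germIn X j = g' ≫ germIn X j) :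
    ∃ (k : J) (f : j ≤ k), g ≫ trans X f = g' ≫ trans X f := by
  have h₁ : (G.in₁ ≫ g) ≫ germIn X j = (G.in₁ ≫ g') ≫ germIn X j := by
    rw [Category.assoc, h, Category.assoc]
  have h₂ : (G.in₂ ≫ g) ≫ germIn X j = (G.in₂ ≫ g') ≫ germIn X j := by
    rw [Category.assoc, h, Category.assoc]
  obtain ⟨k, ⟨f, _, e⟩, ⟨_, _, e'⟩⟩ :=
    ((arrow_mk_germHom_eq_iff.1 (arrow_mk_map_congr h₁ G.arr)).and
      (arrow_mk_germHom_eq_iff.1 (arrow_mk_map_congr h₂ G.arr))).exists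
  refine ⟨k, f, G.isPushout.hom_ext ?_ ?_⟩
  · rw [← Category.assoc, ← Category.assoc]
    exact G.one_hom_ext e
  · rw [← Category.assoc, ← Category.assoc]
    exact G.one_hom_ext e'

end Pushout

lemma Generators.isCardinalSmall_P (G : Generators.{u} 𝕜) : IsCardinalSmall ℵ₀ G.P := by
  intro J _ _ _ _ _ hJ X _ _
  -- Each of countably many eventual conditions has a threshold, and an upper bound of the
  -- thresholds serves for all.
  have : CountableInterFilter (Filter.atTop : Filter J) := by
    refine ⟨fun S hS h => ?_⟩
    have h' : ∀ s : S, ∃ j : J, ∀ k, j ≤ k → k ∈ s.1 := fun s => Filter.mem_atTop_sets.1 (h s.1 s.2)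
    choose j hj using h'
    have := hS.to_subtype
    obtain ⟨b, hb⟩ := hJ (Set.range j) (Cardinal.le_aleph0_iff_set_countable.2 (Set.countable_range j))
    exact Filter.mem_atTop_sets.2 ⟨b, fun k hk s hs =>
      hj ⟨s, hs⟩ k ((hb (Set.mem_range_self _)).trans hk)⟩
  exact preservesColimit_coyoneda (germCoconeIsColimit X) G.P (exists_comp_germIn_eq G X)
    (exists_comp_trans_eq G X)

end CStarCat

/-! ### Comparison of smallness conditions -/

section Small

variable {C : Type (u + 1)} [LargeCategory.{u} C]

/-- A larger `κ` leaves fewer index orders to test, and a smaller class of maps leaves fewer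
sequences. -/
lemma IsCardinalSmallRel.mono {κ κ' : Cardinal.{u}} (hκ : κ ≤ κ') {W W' : MorphismProperty C}
    (hW : W' ≤ W) {A : C} (h : IsCardinalSmallRel κ W A) : IsCardinalSmallRel κ' W' A :=
  fun J _ _ _ _ _ hJ X _ hX => h J (fun S hS => hJ S (hS.trans hκ)) X fun j => hW _ (hX j)

lemma IsCardinalSmall.isSmallRel {κ : Cardinal.{u}} {A : C} (h : IsCardinalSmall κ A)
    (W : MorphismProperty C) : IsSmallRel W A :=
  ⟨κ, h.mono le_rfl le_top⟩

lemma IsFiniteObject.isSmallRel {A : C} (h : IsFiniteObject A) (W : MorphismProperty C) :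
    IsSmallRel W A := by
  obtain ⟨n, hn⟩ := h
  exact hn.isSmallRel W

end Small

/-! ### Cofibrant generation and the final statement -/

namespace CStarCat

variable {𝕜 : Type} [RCLike 𝕜]

lemma isCofibrantlyGeneratedBy (G : Generators.{u} 𝕜) :
    IsCofibrantlyGeneratedBy (unitaryModelStructure.{u} 𝕜) G.I G.J where
  isSmall_I := inferInstance
  isSmall_J := inferInstance
  I_le_cofibrations := generators_I_le G
  J_le_trivialCofibrations := generators_J_le G
  small_I := by
    rintro A B f ((⟨⟨⟩⟩ | ⟨⟨⟩⟩) | ⟨⟨⟩⟩)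
    exacts [isFiniteObject_empty.isSmallRel _, G.isFiniteObject_two.isSmallRel _,
      G.isCardinalSmall_P.isSmallRel _]
  small_J := by
    rintro A B f ⟨⟨⟩⟩
    exact isFiniteObject_base.isSmallRel _
  fibrations_eq := unitaryFibrations_eq_rlp_J G
  trivialFibrations_eq := trivialFibrations_eq_rlp_I G

end CStarCat

theorem proposition3p14 (𝕜 : Type) [RCLike 𝕜] :
    ∃ M : ModelCategory (CStarCat.{u} 𝕜),
      CStarCat.IsUnitaryModelStructure M ∧
      Nonempty (CStarCat.Generators.{u} 𝕜) ∧
      ∀ G : CStarCat.Generators.{u} 𝕜,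
        IsCofibrantlyGeneratedBy M G.I G.J ∧
        IsFiniteObject (CStarCat.empty.{u} 𝕜) ∧
        IsFiniteObject (CStarCat.base.{u} 𝕜) ∧
        IsFiniteObject G.two ∧
        IsCardinalSmall ℵ₁ G.P ∧
        -- the same for all limit ordinals of uncountable cofinality
        IsCardinalSmall ℵ₀ G.P := by
  refine ⟨CStarCat.unitaryModelStructure 𝕜, CStarCat.isUnitaryModelStructure,
    CStarCat.nonempty_generators, fun G => ⟨CStarCat.isCofibrantlyGeneratedBy G,
      CStarCat.isFiniteObject_empty, CStarCat.isFiniteObject_base, G.isFiniteObject_two,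
      G.isCardinalSmall_P.mono ?_ le_rfl, G.isCardinalSmall_P⟩⟩
  exact Cardinal.aleph_zero.symm.trans_le (Cardinal.aleph_le_aleph.2 zero_le_one)
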